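/- A unit disk intersection representation of a finite simple graph $G$ is a bijection $v\mapsto d(v)$ from its vertices onto a set of closed unit disks in the Euclidean plane such that, for distinct vertices $u,v$, the disks $d(u)$ and $d(v)$ intersect if and only if $uv$ is an edge of $G$. A caterpillar is a tree which becomes a (possibly empty) path, called its backbone, when all vertices of degree $1$ are removed. Theorem. A caterpillar $G$ admits a unit disk intersection representation if and only if all its vertices have degree at most $5$ and no two adjacent backbone vertices both have degree $5$. Moreover, on a real RAM (a random access machine with unit-cost addition, subtraction and comparison of natural numbers and unit-cost $+,-,\cdot,/,\sqrt{\phantom{x}}$ and comparison of real numbers) that receives a caterpillar $G$ with $n$ vertices as a list of its edges, it can be tested in $O(n)$ steps whether this condition holds, and whenever $G$ admits a unit disk intersection representation, the coordinates of the centres of the disks of such a representation can be computed in $O(n)$ steps. -/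

import Mathlib

/-! ### Unit disk intersection representations and caterpillars -/

/-- The Euclidean plane. -/
abbrev Plane : Type := EuclideanSpace ℝ (Fin 2)

/-- The closed unit disk with centre `p`. -/
def unitDisk (p : Plane) : Set Plane := Metric.closedBall p 1

/-- The disks `unitDisk (c v)` form a unit disk intersection representation of `G`:
`v ↦ unitDisk (c v)` is a bijection from the vertices onto a set of unit disks, and the disks of
two distinct vertices intersect if and only if the vertices are adjacent. -/
structure IsUDR {V : Type*} (G : SimpleGraph V) (c : V → Plane) : Prop where
  injective : Function.Injective fun v => unitDisk (c v)
  adj_iff : ∀ u v : V, u ≠ v → (G.Adj u v ↔ (unitDisk (c u) ∩ unitDisk (c v)).Nonempty)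

/-- `G` admits a unit disk intersection representation. -/
def AdmitsUDR {V : Type*} (G : SimpleGraph V) : Prop :=
  ∃ c : V → Plane, IsUDR G c

/-- The vertices that remain when all leaves (vertices of degree one) are removed. -/
def backbone {V : Type*} [Fintype V] (G : SimpleGraph V) [DecidableRel G.Adj] : Set V :=
  {v | G.degree v ≠ 1}

/-- A caterpillar is a tree that yields a path when all its leaves are removed.  (The path may have
a single vertex; for the tree with two vertices it is empty.) -/
structure IsCaterpillar {V : Type*} [Fintype V] (G : SimpleGraph V) [DecidableRel G.Adj] :
    Prop where
  isTree : G.IsTree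
  backbone_path : ∃ k : ℕ, Nonempty (G.induce (backbone G) ≃g SimpleGraph.pathGraph k)

/-- All degrees are at most five, and no two adjacent backbone vertices both have degree five. -/
def DegreeCondition {V : Type*} [Fintype V] (G : SimpleGraph V) [DecidableRel G.Adj] : Prop :=
  (∀ v, G.degree v ≤ 5) ∧
    ∀ u ∈ backbone G, ∀ v ∈ backbone G, G.Adj u v → ¬ (G.degree u = 5 ∧ G.degree v = 5)

/-! ### A real RAM with unit-cost operations

The memory consists of registers and arrays of natural numbers (used for indexing) and of registers
and arrays of real numbers.  A program mentions only finitely many registers and arrays by name;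
array cells are addressed by natural numbers computed at run time.  Natural numbers can be added,
subtracted and compared; real numbers can be added, subtracted, multiplied, divided and compared,
and square roots can be taken.  There is no rounding of reals to integers, and the
only constants are natural numbers. -/

namespace RealRAM

/-- A memory configuration. -/
@[ext] structure State where
  /-- natural-number registers -/
  nreg : ℕ → ℕ
  /-- natural-number arrays: `narr a i` is cell `i` of array `a` -/
  narr : ℕ → ℕ → ℕ
  /-- real registers -/
  rreg : ℕ → ℝ
  /-- real arrays: `rarr a i` is cell `i` of array `a` -/
  rarr : ℕ → ℕ → ℝ

/-- Natural-number expressions. -/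
inductive NExp : Type
  | const (k : ℕ)
  | reg (r : ℕ)
  | cell (a : ℕ) (i : NExp)
  | add (x y : NExp)
  | sub (x y : NExp)

/-- Value of a natural-number expression (subtraction is truncated). -/
def NExp.eval (σ : State) : NExp → ℕ
  | .const k => k
  | .reg r => σ.nreg r
  | .cell a i => σ.narr a (i.eval σ)
  | .add x y => x.eval σ + y.eval σ
  | .sub x y => x.eval σ - y.eval σ

/-- Number of elementary operations needed to evaluate a natural-number expression. -/
def NExp.cost : NExp → ℕ
  | .const _ => 1
  | .reg _ => 1
  | .cell _ i => i.cost + 1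
  | .add x y => x.cost + y.cost + 1
  | .sub x y => x.cost + y.cost + 1

/-- Real expressions. -/
inductive RExp : Type
  | ofNat (x : NExp)
  | reg (r : ℕ)
  | cell (a : ℕ) (i : NExp)
  | add (x y : RExp)
  | sub (x y : RExp)
  | mul (x y : RExp)
  | div (x y : RExp)
  | sqrt (x : RExp)

/-- Value of a real expression (by convention, division by zero and the square root of a negative
number return zero). -/
noncomputable def RExp.eval (σ : State) : RExp → ℝ
  | .ofNat x => (x.eval σ : ℝ)
  | .reg r => σ.rreg r
  | .cell a i => σ.rarr a (i.eval σ)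
  | .add x y => x.eval σ + y.eval σ
  | .sub x y => x.eval σ - y.eval σ
  | .mul x y => x.eval σ * y.eval σ
  | .div x y => x.eval σ / y.eval σ
  | .sqrt x => Real.sqrt (x.eval σ)

/-- Number of elementary operations needed to evaluate a real expression. -/
def RExp.cost : RExp → ℕ
  | .ofNat x => x.cost + 1
  | .reg _ => 1
  | .cell _ i => i.cost + 1
  | .add x y => x.cost + y.cost + 1
  | .sub x y => x.cost + y.cost + 1
  | .mul x y => x.cost + y.cost + 1
  | .div x y => x.cost + y.cost + 1
  | .sqrt x => x.cost + 1

/-- Tests. -/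
inductive Cond : Type
  | nlt (x y : NExp)
  | neq (x y : NExp)
  | rlt (x y : RExp)
  | not (b : Cond)
  | and (b c : Cond)
  | or (b c : Cond)

/-- The test succeeds in the given configuration (`nlt` and `rlt` are strict comparisons, `neq` is
equality of natural numbers). -/
def Cond.holds (σ : State) : Cond → Prop
  | .nlt x y => x.eval σ < y.eval σ
  | .neq x y => x.eval σ = y.eval σ
  | .rlt x y => x.eval σ < y.eval σ
  | .not b => ¬ b.holds σ
  | .and b c => b.holds σ ∧ c.holds σ
  | .or b c => b.holds σ ∨ c.holds σ

/-- Number of elementary operations needed to evaluate a test. -/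
def Cond.cost : Cond → ℕ
  | .nlt x y => x.cost + y.cost + 1
  | .neq x y => x.cost + y.cost + 1
  | .rlt x y => x.cost + y.cost + 1
  | .not b => b.cost + 1
  | .and b c => b.cost + c.cost + 1
  | .or b c => b.cost + c.cost + 1

/-- Programs. -/
inductive Prog : Type
  | skip
  | setNReg (r : ℕ) (e : NExp)
  | setNCell (a : ℕ) (i e : NExp)
  | setRReg (r : ℕ) (e : RExp)
  | setRCell (a : ℕ) (i : NExp) (e : RExp)
  | seq (p q : Prog)
  | ite (b : Cond) (p q : Prog)
  | loop (b : Cond) (p : Prog)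

/-- `Runs p σ t τ`: started in configuration `σ`, the program `p` halts in configuration `τ` after
exactly `t` elementary steps.  (`loop b p` is the loop `while b do p`.) -/
inductive Runs : Prog → State → ℕ → State → Prop
  | skip (σ : State) : Runs .skip σ 1 σ
  | setNReg (σ : State) (r : ℕ) (e : NExp) :
      Runs (.setNReg r e) σ (e.cost + 1)
        { σ with nreg := Function.update σ.nreg r (e.eval σ) }
  | setNCell (σ : State) (a : ℕ) (i e : NExp) :
      Runs (.setNCell a i e) σ (i.cost + e.cost + 1)
        { σ with
          narr := Function.update σ.narr a (Function.update (σ.narr a) (i.eval σ) (e.eval σ)) }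
  | setRReg (σ : State) (r : ℕ) (e : RExp) :
      Runs (.setRReg r e) σ (e.cost + 1)
        { σ with rreg := Function.update σ.rreg r (e.eval σ) }
  | setRCell (σ : State) (a : ℕ) (i : NExp) (e : RExp) :
      Runs (.setRCell a i e) σ (i.cost + e.cost + 1)
        { σ with
          rarr := Function.update σ.rarr a (Function.update (σ.rarr a) (i.eval σ) (e.eval σ)) }
  | seq {p q : Prog} {σ τ υ : State} {s t : ℕ} :
      Runs p σ s τ → Runs q τ t υ → Runs (.seq p q) σ (s + t) υ
  | ite_true {b : Cond} {p q : Prog} {σ τ : State} {t : ℕ} :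
      b.holds σ → Runs p σ t τ → Runs (.ite b p q) σ (b.cost + t + 1) τ
  | ite_false {b : Cond} {p q : Prog} {σ τ : State} {t : ℕ} :
      ¬ b.holds σ → Runs q σ t τ → Runs (.ite b p q) σ (b.cost + t + 1) τ
  | loop_true {b : Cond} {p : Prog} {σ τ υ : State} {s t : ℕ} :
      b.holds σ → Runs p σ s τ → Runs (.loop b p) τ t υ →
        Runs (.loop b p) σ (b.cost + s + t + 1) υ
  | loop_false {b : Cond} {p : Prog} {σ : State} :
      ¬ b.holds σ → Runs (.loop b p) σ (b.cost + 1) σ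

/-- The initial configuration for a graph with vertices `0, …, n - 1` given by a list of `m` pairs
of vertices: register `0` holds `n`, register `1` holds `m`, cell `i` of the arrays `0` and `1`
holds the first and the second entry of the `i`-th pair, and the rest of the memory is zero. -/
def initial (n : ℕ) (es : List (Fin n × Fin n)) : State where
  nreg r := if r = 0 then n else if r = 1 then es.length else 0
  narr a i :=
    if a = 0 then (es[i]?).elim 0 (fun e => (e.1 : ℕ))
    else if a = 1 then (es[i]?).elim 0 (fun e => (e.2 : ℕ))
    else 0
  rreg _ := 0
  rarr _ _ := 0

/-- The points whose coordinates are stored in the real arrays `0` and `1`. -/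
def State.points (σ : State) (n : ℕ) : Fin n → Plane :=
  fun v => !₂[σ.rarr 0 v, σ.rarr 1 v]

end RealRAM

/-- `es` lists every edge of `G` exactly once, in arbitrary order and orientation. -/
def IsEdgeList {n : ℕ} (G : SimpleGraph (Fin n)) (es : List (Fin n × Fin n)) : Prop :=
  (es.map fun e => s(e.1, e.2)).Nodup ∧
    ∀ e : Sym2 (Fin n), e ∈ es.map (fun e => s(e.1, e.2)) ↔ e ∈ G.edgeSet

/-!
Necessity. Let `u` and `v` be adjacent. In coordinates in which `u` is the origin and `v` lies on
the positive real axis, at distance `s ≤ 2`, the other neighbours of `u` form a *fan* (`IsFan`):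
they have norm at most `2`, while their distances from each other and from `v` exceed `2`. The
directions from the origin to a point of the fan of norm `r` and to another such point or to `v`
differ by more than `arccos (r / 4) ≥ π / 3`. So a fan has at most two points above and at most two
points below the axis (`IsFan.card_le`), whence all degrees are at most five. If a fan has four
points, then the innermost point above and the innermost point below, with arguments `α`, `-β` and
norms `r`, `q`, satisfy `α + arccos (r / 4) + β + arccos (q / 4) < 5 * π / 3`
(`IsFan.exists_pair`), since otherwise the two outermost points would be too close. If `u` and `v`
both have degree five, this inequality holds around both ends of the segment. One of the two sides
of the segment then has a fan point at each end such that the sum of their angles and of the two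
arccosines is at most `5 * π / 3`; but these points are neighbours of `u` and of `v`, hence at
distance more than `2`, and this forces the sum to exceed `5 * π / 3` (`angle_sum_gt`, resting on
the trigonometric inequality `cos_quad_nonpos`). This contradiction is `IsFan.not_both`.

Sufficiency. The layout is computed by a finite automaton that walks along the spine, i.e. the
vertices of degree different from one. The state of a spine vertex (`CaterpillarLayout.state`)
depends on which of the vertices around it have degree five. It determines the positions of the
leaves relative to the vertex, and the states of two consecutive vertices determine the vector
between them, both up to a reflection (`orientation`). All of this is given by integer tables in
units of `1 / 1000`. The spine is extended by one dummy vertex at either end, whose disks are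
available to leaves; a spine vertex then has three free places if its degree is five and two
otherwise. Every step of the walk moves by at least `1.808` to the right, so only pairs of points
whose spine vertices are at most two steps apart have to be examined, and for these the distances
are determined by at most three consecutive states: a finite check
(`CaterpillarLayout.sqDist_spec`, `CaterpillarLayout.IsLabelling.isUDR`).

Linear time. Programs are compositions of loop-free programs and of loops `for r < b` with
loop-free bodies; `RealRAM.runs_forTo` gives correctness, from an invariant, together with the time
bound. The spine is traversed without adjacency lists: every spine vertex stores the sum of the
numbers of its spine neighbours, so subtracting the preceding vertex yields the next one
(`RealRAM.walkLoop_spec`). Since a tree has fewer edges than vertices, the total time is `O(n)`.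
The correctness of this program also proves sufficiency, after transport to the vertex set `Fin n`.
-/

/-! ### An angle inequality -/

open Real in
/-- The trigonometric core of the necessity proof. With `T = x + y` fixed, each cosine depending on
`x` or `y` is, up to the factor `sin T`, a combination with nonnegative coefficients `sin x`, `sin
y` of its values at the two ends `x = 0` and `y = 0`; as `sin T ≤ sin x + sin y`, this reduces the
claim to the ends. -/
theorem cos_quad_nonpos {φ ψ x y : ℝ} (hφ : π / 3 ≤ φ) (hφ' : φ ≤ π / 2) (hψ : π / 3 ≤ ψ)
    (hψ' : ψ ≤ π / 2) (hx : 0 ≤ x) (hy : 0 ≤ y) (h : 2 * φ + 2 * ψ + x + y ≤ 5 * π / 3) :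
    cos φ * (cos φ - cos (φ + x)) + cos ψ * (cos ψ - cos (ψ + y))
      + 2 * cos φ * cos ψ * cos (φ + ψ + (x + y)) ≤ 0 := by
  have hπ := pi_pos
  obtain ⟨T, hT⟩ : ∃ T, T = x + y := ⟨_, rfl⟩
  have cφ : 0 ≤ cos φ := cos_nonneg_of_mem_Icc ⟨by linarith, by linarith⟩
  have cψ : 0 ≤ cos ψ := cos_nonneg_of_mem_Icc ⟨by linarith, by linarith⟩
  have hT0 : 0 ≤ T := by linarith
  have hT1 : T ≤ π / 3 := by linarith
  have endpt : ∀ a b : ℝ, π / 3 ≤ a → a ≤ π / 2 → π / 3 ≤ b → b ≤ π / 2 →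
      2 * a + 2 * b + T ≤ 5 * π / 3 → 0 ≤ cos b →
      cos b * (cos b - cos (b + T)) + 2 * cos a * cos b * cos (a + b + T) ≤ 0 := by
    intro a b h1 h2 h3 h4 h5 h6
    have e : cos b * (cos b - cos (b + T)) + 2 * cos a * cos b * cos (a + b + T)
        = cos b * (2 * cos (a + b + T / 2) * cos (a + T / 2)) := by
      have e1 : cos (a + b + T) = cos a * cos (b + T) - sin a * sin (b + T) := by
        rw [← cos_add]; ring_nf
      have e2 : 2 * cos (a + b + T / 2) * cos (a + T / 2) = cos (2 * a + b + T) + cos b := by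
        have := cos_add_cos (2 * a + b + T) b
        rw [this]; ring_nf
      have e3 : cos (2 * a + b + T) = cos (2 * a) * cos (b + T) - sin (2 * a) * sin (b + T) := by
        rw [← cos_add]; ring_nf
      rw [e2, e3, e1, cos_two_mul, sin_two_mul]; ring
    rw [e]
    have f1 : cos (a + b + T / 2) ≤ 0 :=
      cos_nonpos_of_pi_div_two_le_of_le (by linarith) (by linarith)
    have f2 : 0 ≤ cos (a + T / 2) := cos_nonneg_of_mem_Icc ⟨by linarith, by linarith⟩
    nlinarith [mul_nonneg h6 f2, mul_nonneg (mul_nonneg h6 f2) (neg_nonneg.2 f1)]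
  have E0 := endpt φ ψ hφ hφ' hψ hψ' (by linarith) cψ
  have E1 := endpt ψ φ hψ hψ' hφ hφ' (by linarith) cφ
  rw [show ψ + φ + T = φ + ψ + T by ring] at E1
  rw [← hT]
  rcases hT0.eq_or_lt with h0 | h0
  · have hx0 : x = 0 := by linarith
    have hy0 : y = 0 := by linarith
    subst hx0 hy0
    rw [← h0] at E0 ⊢
    simp only [add_zero, sub_self, mul_zero, zero_add] at E0 ⊢
    exact E0
  have sT : 0 < sin T := sin_pos_of_pos_of_lt_pi h0 (by linarith)
  have sx : 0 ≤ sin x := sin_nonneg_of_nonneg_of_le_pi hx (by linarith)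
  have sy : 0 ≤ sin y := sin_nonneg_of_nonneg_of_le_pi hy (by linarith)
  have id1 : sin T = sin x * cos y + cos x * sin y := by rw [hT, sin_add]
  have sub : sin T ≤ sin x + sin y := by
    rw [id1]; nlinarith [cos_le_one x, cos_le_one y]
  have lin : ∀ a, sin T * cos (a + x) = sin y * cos a + sin x * cos (a + T) := by
    intro a
    rw [hT, ← add_assoc, cos_add (a + x) y, sin_add x y, cos_add a x, sin_add a x]
    have := sin_sq_add_cos_sq x
    linear_combination (cos a * sin y) * this
  have lin' : ∀ a, sin T * cos (a + y) = sin x * cos a + sin y * cos (a + T) := by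
    intro a
    rw [hT, add_comm x y, ← add_assoc, cos_add (a + y) x, sin_add y x, cos_add a y, sin_add a y]
    have := sin_sq_add_cos_sq y
    linear_combination (cos a * sin x) * this
  obtain ⟨K, hK⟩ : ∃ K, K = cos φ ^ 2 + cos ψ ^ 2 + 2 * cos φ * cos ψ * cos (φ + ψ + T) := ⟨_, rfl⟩
  have K0 : 0 ≤ K := by
    rw [hK]
    nlinarith [mul_nonneg (mul_nonneg cφ cψ) (by linarith [neg_one_le_cos (φ + ψ + T)] :
      0 ≤ 1 + cos (φ + ψ + T)), sq_nonneg (cos φ - cos ψ)]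
  have G0 : K ≤ cos φ * cos φ + cos ψ * cos (ψ + T) := by rw [hK]; nlinarith
  have G1 : K ≤ cos φ * cos (φ + T) + cos ψ * cos ψ := by rw [hK]; nlinarith
  have g : sin T * (cos φ * cos (φ + x) + cos ψ * cos (ψ + y))
      = sin y * (cos φ * cos φ + cos ψ * cos (ψ + T))
        + sin x * (cos φ * cos (φ + T) + cos ψ * cos ψ) := by
    linear_combination cos φ * lin φ + cos ψ * lin' ψ
  have fin : sin T * K ≤ sin T * (cos φ * cos (φ + x) + cos ψ * cos (ψ + y)) := by
    rw [g]
    nlinarith [mul_le_mul_of_nonneg_left G0 sy, mul_le_mul_of_nonneg_left G1 sx,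
      mul_le_mul_of_nonneg_right sub K0]
  have := le_of_mul_le_mul_left fin sT
  rw [hK] at this
  nlinarith

open Real in
theorem arccos_div_four_mem {r : ℝ} (h0 : 0 ≤ r) (h2 : r ≤ 2) :
    π / 3 ≤ arccos (r / 4) ∧ arccos (r / 4) ≤ π / 2 := by
  constructor
  · rw [← arccos_cos (x := π / 3) (by positivity) (by linarith [pi_pos]), cos_pi_div_three]
    exact arccos_le_arccos (by linarith)
  · exact arccos_le_pi_div_two.2 (by linarith)

open Real in
theorem arccos_lt_of_cos_lt {θ t : ℝ} (h0 : 0 ≤ θ) (hπ : θ ≤ π) (ht' : t ≤ 1)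
    (h : cos θ < t) :
    arccos t < θ := by
  rw [← arccos_cos h0 hπ]
  exact arccos_lt_arccos (neg_one_le_cos θ) h ht'

open Real in
theorem cos_lt_quarter_of_dist {r s c : ℝ} (hr : 0 < r) (hr2 : r ≤ 2) (hs : 0 < s) (hs2 : s ≤ 2)
    (h : 4 < r ^ 2 + s ^ 2 - 2 * r * s * c) : c < r / 4 := by
  have h0 : 0 ≤ 2 + s - r ^ 2 / 2 := by nlinarith
  have : r ^ 2 + s ^ 2 - 4 ≤ 2 * r * s * (r / 4) := by
    nlinarith [mul_nonneg (sub_nonneg.2 hs2) h0]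
  have h3 : 2 * r * s * c < 2 * r * s * (r / 4) := by linarith
  exact lt_of_mul_lt_mul_left h3 (by positivity)

open Real in
/-- Let `p` and `p'` be two points on the same side of a segment of length `s ≤ 2`, at distance `r
≤ 2` from its left end in direction `α`, and at distance `q ≤ 2` from its right end in the mirrored
direction `β`. If `p` is far from the right end, `p'` is far from the left end, and the points are
far from each other, then the angles are large. -/
theorem angle_sum_gt {r q s α β : ℝ} (hr : 0 < r) (hr2 : r ≤ 2) (hq : 0 < q) (hq2 : q ≤ 2)
    (hs : 0 < s) (hs2 : s ≤ 2) (hα : 0 ≤ α) (hα' : α ≤ π) (hβ : 0 ≤ β) (hβ' : β ≤ π)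
    (h1 : 4 < r ^ 2 + s ^ 2 - 2 * r * s * cos α) (h2 : 4 < q ^ 2 + s ^ 2 - 2 * q * s * cos β)
    (h3 : 4 < s ^ 2 + r ^ 2 + q ^ 2 - 2 * s * r * cos α - 2 * s * q * cos β
      + 2 * r * q * cos (α + β)) :
    5 * π / 3 < α + β + arccos (r / 4) + arccos (q / 4) := by
  by_contra! hcon
  have c1 := cos_lt_quarter_of_dist hr hr2 hs hs2 h1
  have c2 := cos_lt_quarter_of_dist hq hq2 hs hs2 h2
  have a1 := arccos_lt_of_cos_lt hα hα' (by linarith) c1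
  have a2 := arccos_lt_of_cos_lt hβ hβ' (by linarith) c2
  have m1 := arccos_div_four_mem hr.le hr2
  have m2 := arccos_div_four_mem hq.le hq2
  have k := cos_quad_nonpos m1.1 m1.2 m2.1 m2.2 (sub_nonneg.2 a1.le) (sub_nonneg.2 a2.le)
    (by linarith)
  rw [cos_arccos (by linarith) (by linarith), cos_arccos (by linarith) (by linarith),
    add_sub_cancel, add_sub_cancel] at k
  rw [show arccos (r / 4) + arccos (q / 4) + (α - arccos (r / 4) + (β - arccos (q / 4))) = α + β
    by ring] at k
  -- increasing `s` to `2` keeps the two far points apart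
  have mono : 0 ≤ 2 * s - 2 * r * cos α - 2 * q * cos β := by
    have : 0 ≤ s * (2 * s - 2 * r * cos α - 2 * q * cos β) := by nlinarith
    exact nonneg_of_mul_nonneg_right this hs
  nlinarith [mul_nonneg (sub_nonneg.2 hs2)
    (by linarith : 0 ≤ 2 + s - 2 * r * cos α - 2 * q * cos β)]

/-! ### Fans of points with pairwise distances exceeding two -/

theorem norm_sub_sq_polar (z w : ℂ) :
    ‖z - w‖ ^ 2 = ‖z‖ ^ 2 + ‖w‖ ^ 2 - 2 * ‖z‖ * ‖w‖ * Real.cos (z.arg - w.arg) := by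
  have hz1 := Complex.norm_mul_cos_arg z
  have hz2 := Complex.norm_mul_sin_arg z
  have hw1 := Complex.norm_mul_cos_arg w
  have hw2 := Complex.norm_mul_sin_arg w
  have e1 : ‖z‖ ^ 2 = z.re * z.re + z.im * z.im := by rw [Complex.sq_norm, Complex.normSq_apply]
  have e2 : ‖w‖ ^ 2 = w.re * w.re + w.im * w.im := by rw [Complex.sq_norm, Complex.normSq_apply]
  have e3 : ‖z - w‖ ^ 2 = (z.re - w.re) * (z.re - w.re) + (z.im - w.im) * (z.im - w.im) := by
    rw [Complex.sq_norm, Complex.normSq_apply, Complex.sub_re, Complex.sub_im]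
  rw [e3, e1, e2, Real.cos_sub, ← hz1, ← hz2, ← hw1, ← hw2]; ring

theorem norm_sub_ofReal_sq_polar (z : ℂ) {s : ℝ} (hs : 0 < s) :
    ‖z - s‖ ^ 2 = ‖z‖ ^ 2 + s ^ 2 - 2 * ‖z‖ * s * Real.cos z.arg := by
  have := norm_sub_sq_polar z s
  rwa [Complex.arg_ofReal_of_nonneg hs.le, sub_zero, Complex.norm_real, Real.norm_of_nonneg hs.le]
    at this

open Real in
theorem arg_gap {z w : ℂ} (hz : z ≠ 0) (hw : w ≠ 0) (hz2 : ‖z‖ ≤ 2) (hw2 : ‖w‖ ≤ 2)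
    (h : 2 < ‖z - w‖) : cos (z.arg - w.arg) < ‖z‖ / 4 := by
  have := norm_sub_sq_polar z w
  exact cos_lt_quarter_of_dist (norm_pos_iff.2 hz) hz2 (norm_pos_iff.2 hw) hw2
    (c := cos (z.arg - w.arg)) (by nlinarith)

open Real in
theorem arg_gap_of_le {z w : ℂ} (hz : z ≠ 0) (hw : w ≠ 0) (hz2 : ‖z‖ ≤ 2) (hw2 : ‖w‖ ≤ 2)
    (h : 2 < ‖z - w‖) (h1 : z.arg ≤ w.arg) (h2 : w.arg ≤ z.arg + π) :
    z.arg + arccos (‖z‖ / 4) < w.arg := by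
  have := arg_gap hz hw hz2 hw2 h
  rw [← neg_sub, cos_neg] at this
  linarith [arccos_lt_of_cos_lt (sub_nonneg.2 h1) (by linarith) (by linarith) this]

open Real in
theorem not_three_in_sector {z w y : ℂ} (hz : z ≠ 0) (hw : w ≠ 0) (hy : y ≠ 0) (hz2 : ‖z‖ ≤ 2)
    (hw2 : ‖w‖ ≤ 2) (hy2 : ‖y‖ ≤ 2) (hzw : 2 < ‖z - w‖) (hwy : 2 < ‖w - y‖) (hzy : 2 < ‖z - y‖)
    (h1 : π / 3 < z.arg) (h2 : π / 3 < w.arg) (h3 : π / 3 < y.arg) : False := by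
  have hπ := pi_pos
  have key : ∀ z w : ℂ, z ≠ 0 → w ≠ 0 → ‖z‖ ≤ 2 → ‖w‖ ≤ 2 → 2 < ‖z - w‖ → π / 3 < z.arg →
      π / 3 < w.arg → z.arg + π / 3 < w.arg ∨ w.arg + π / 3 < z.arg := by
    intro z w hz hw hz2 hw2 h h1 h2
    rcases le_total z.arg w.arg with h3 | h3
    · left
      have := arg_gap_of_le hz hw hz2 hw2 h h3 (by linarith [Complex.arg_le_pi w])
      linarith [(arccos_div_four_mem (norm_nonneg z) hz2).1]
    · right
      rw [norm_sub_rev] at h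
      have := arg_gap_of_le hw hz hw2 hz2 h h3 (by linarith [Complex.arg_le_pi z])
      linarith [(arccos_div_four_mem (norm_nonneg w) hw2).1]
  have k1 := key z w hz hw hz2 hw2 hzw h1 h2
  have k2 := key w y hw hy hw2 hy2 hwy h2 h3
  have k3 := key z y hz hy hz2 hy2 hzy h1 h3
  have := Complex.arg_le_pi z
  have := Complex.arg_le_pi w
  have := Complex.arg_le_pi y
  rcases k1 with k1 | k1 <;> rcases k2 with k2 | k2 <;> rcases k3 with k3 | k3 <;> linarith

/-- The points `z i` with `i ∈ S` are disk centres around a disk centred at `0` which also meets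
the disk centred at the real number `s`: all of them have norm at most two, and their distances
from each other and from `s` exceed two. -/
structure IsFan {ι : Type*} (S : Finset ι) (z : ι → ℂ) (s : ℝ) : Prop where
  pos : 0 < s
  le_two : s ≤ 2
  norm_le : ∀ i ∈ S, ‖z i‖ ≤ 2
  far : ∀ i ∈ S, 2 < ‖z i - s‖
  apart : ∀ i ∈ S, ∀ j ∈ S, i ≠ j → 2 < ‖z i - z j‖

namespace IsFan

variable {ι : Type*} {S : Finset ι} {z : ι → ℂ} {s : ℝ}

theorem ne_zero (h : IsFan S z s) {i : ι} (hi : i ∈ S) : z i ≠ 0 := by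
  intro h0
  have := h.far i hi
  rw [h0, zero_sub, norm_neg, Complex.norm_real, Real.norm_of_nonneg h.pos.le] at this
  linarith [h.le_two]

theorem conj (h : IsFan S z s) : IsFan S (fun i => (starRingEnd ℂ) (z i)) s where
  pos := h.pos
  le_two := h.le_two
  norm_le i hi := by rw [Complex.norm_conj]; exact h.norm_le i hi
  far i hi := by
    have := h.far i hi
    rwa [← Complex.norm_conj, map_sub, Complex.conj_ofReal] at this
  apart i hi j hj hij := by
    rw [← map_sub, Complex.norm_conj]; exact h.apart i hi j hj hij

open Real in
theorem cos_arg_lt (h : IsFan S z s) {i : ι} (hi : i ∈ S) : cos (z i).arg < 1 / 2 := by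
  have h1 := h.far i hi
  have h2 := norm_sub_ofReal_sq_polar (z i) h.pos
  have := cos_lt_quarter_of_dist (norm_pos_iff.2 (h.ne_zero hi)) (h.norm_le i hi) h.pos h.le_two
    (c := cos (z i).arg) (by nlinarith)
  linarith [h.norm_le i hi]

open Real in
theorem pi_div_three_lt_abs_arg (h : IsFan S z s) {i : ι} (hi : i ∈ S) :
    π / 3 < |(z i).arg| := by
  have := h.cos_arg_lt hi
  rw [← cos_abs, ← cos_pi_div_three] at this
  by_contra! hle
  have := cos_le_cos_of_nonneg_of_le_pi (abs_nonneg _) (by linarith [pi_pos]) hle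
  linarith

open Real in
theorem pi_div_three_lt_arg (h : IsFan S z s) {i : ι} (hi : i ∈ S) (h0 : 0 < (z i).arg) :
    π / 3 < (z i).arg := by
  have := h.pi_div_three_lt_abs_arg hi
  rwa [abs_of_pos h0] at this

open Classical in
theorem card_upper_le (h : IsFan S z s) : (S.filter fun i => 0 < (z i).arg).card ≤ 2 := by
  by_contra! hc
  obtain ⟨a, b, c, ha, hb, hc, hab, hac, hbc⟩ := Finset.two_lt_card_iff.1 hc
  rw [Finset.mem_filter] at ha hb hc
  exact not_three_in_sector (h.ne_zero ha.1) (h.ne_zero hb.1) (h.ne_zero hc.1) (h.norm_le a ha.1)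
    (h.norm_le b hb.1) (h.norm_le c hc.1) (h.apart a ha.1 b hb.1 hab) (h.apart b hb.1 c hc.1 hbc)
    (h.apart a ha.1 c hc.1 hac) (h.pi_div_three_lt_arg ha.1 ha.2) (h.pi_div_three_lt_arg hb.1 hb.2)
    (h.pi_div_three_lt_arg hc.1 hc.2)

open Classical in
theorem card_lower_le (h : IsFan S z s) : (S.filter fun i => ¬ 0 < (z i).arg).card ≤ 2 := by
  refine le_trans (Finset.card_le_card ?_) h.conj.card_upper_le
  intro i hi
  rw [Finset.mem_filter] at hi ⊢
  refine ⟨hi.1, ?_⟩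
  by_cases hp : (z i).arg = Real.pi
  · exact absurd (hp ▸ Real.pi_pos) hi.2
  · rw [Complex.arg_conj, if_neg hp]
    have := h.pi_div_three_lt_abs_arg hi.1
    rw [abs_of_nonpos (not_lt.1 hi.2)] at this
    linarith [Real.pi_pos]

open Classical in
theorem card_le (h : IsFan S z s) : S.card ≤ 4 := by
  have := Finset.card_filter_add_card_filter_not (s := S) (fun i => 0 < (z i).arg)
  have := h.card_upper_le
  have := h.card_lower_le
  omega

open Real in
open Classical in
theorem exists_pair (h : IsFan S z s) (hS : S.card = 4) :
    ∃ i ∈ S, ∃ k ∈ S, 0 < (z i).arg ∧ (z k).arg ≤ 0 ∧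
      (z i).arg + arccos (‖z i‖ / 4) - (z k).arg + arccos (‖z k‖ / 4) < 5 * π / 3 := by
  have hπ := pi_pos
  have e := Finset.card_filter_add_card_filter_not (s := S) (fun i => 0 < (z i).arg)
  have hu := h.card_upper_le
  have hl := h.card_lower_le
  have up : ∃ i ∈ S, ∃ j ∈ S, 0 < (z i).arg ∧ (z i).arg + arccos (‖z i‖ / 4) < (z j).arg := by
    obtain ⟨i, j, hij, he⟩ := Finset.card_eq_two.1 (by omega :
      (S.filter fun i => 0 < (z i).arg).card = 2)
    have hi : i ∈ S.filter fun i => 0 < (z i).arg := by rw [he]; simp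
    have hj : j ∈ S.filter fun i => 0 < (z i).arg := by rw [he]; simp
    rw [Finset.mem_filter] at hi hj
    have hd := h.apart i hi.1 j hj.1 hij
    rcases le_total (z i).arg (z j).arg with hle | hle
    · exact ⟨i, hi.1, j, hj.1, hi.2, arg_gap_of_le (h.ne_zero hi.1) (h.ne_zero hj.1)
        (h.norm_le i hi.1) (h.norm_le j hj.1) hd hle (by linarith [Complex.arg_le_pi (z j)])⟩
    · rw [norm_sub_rev] at hd
      exact ⟨j, hj.1, i, hi.1, hj.2, arg_gap_of_le (h.ne_zero hj.1) (h.ne_zero hi.1)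
        (h.norm_le j hj.1) (h.norm_le i hi.1) hd hle (by linarith [Complex.arg_le_pi (z i)])⟩
  have low : ∃ k ∈ S, ∃ l ∈ S, (z k).arg ≤ 0 ∧ (z l).arg < (z k).arg - arccos (‖z k‖ / 4) := by
    obtain ⟨i, j, hij, he⟩ := Finset.card_eq_two.1 (by omega :
      (S.filter fun i => ¬ 0 < (z i).arg).card = 2)
    have hi : i ∈ S.filter fun i => ¬ 0 < (z i).arg := by rw [he]; simp
    have hj : j ∈ S.filter fun i => ¬ 0 < (z i).arg := by rw [he]; simp
    rw [Finset.mem_filter, not_lt] at hi hj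
    have ci : ∀ i, (z i).arg ≤ 0 → ((starRingEnd ℂ) (z i)).arg = - (z i).arg := by
      intro i hi
      rw [Complex.arg_conj, if_neg (by linarith)]
    have hd := h.conj.apart i hi.1 j hj.1 hij
    have g1 := ci i hi.2
    have g2 := ci j hj.2
    rcases le_total (z j).arg (z i).arg with hle | hle
    · have := arg_gap_of_le (h.conj.ne_zero hi.1) (h.conj.ne_zero hj.1)
        (h.conj.norm_le i hi.1) (h.conj.norm_le j hj.1) hd (by linarith)
        (by linarith [Complex.arg_le_pi ((starRingEnd ℂ) (z j))])
      rw [Complex.norm_conj] at this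
      exact ⟨i, hi.1, j, hj.1, hi.2, by linarith⟩
    · rw [norm_sub_rev] at hd
      have := arg_gap_of_le (h.conj.ne_zero hj.1) (h.conj.ne_zero hi.1)
        (h.conj.norm_le j hj.1) (h.conj.norm_le i hi.1) hd (by linarith)
        (by linarith [Complex.arg_le_pi ((starRingEnd ℂ) (z i))])
      rw [Complex.norm_conj] at this
      exact ⟨j, hj.1, i, hi.1, hj.2, by linarith⟩
  obtain ⟨i, hi, j, hj, hi0, hij⟩ := up
  obtain ⟨k, hk, l, hl, hk0, hkl⟩ := low
  refine ⟨i, hi, k, hk, hi0, hk0, ?_⟩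
  -- the gap between the two outermost points, across the negative real axis
  have gap : (z j).arg - (z l).arg < 5 * π / 3 := by
    have m1 := arccos_nonneg (‖z i‖ / 4)
    have m2 := arccos_nonneg (‖z k‖ / 4)
    have hjl : j ≠ l := by rintro rfl; linarith
    have c := arg_gap (h.ne_zero hj) (h.ne_zero hl) (h.norm_le j hj) (h.norm_le l hl)
      (h.apart j hj l hl hjl)
    by_contra! hge
    have c2 : cos ((z j).arg - (z l).arg) = cos (2 * π - ((z j).arg - (z l).arg)) := by
      rw [cos_two_pi_sub]
    have c3 := cos_le_cos_of_nonneg_of_le_pi (x := 2 * π - ((z j).arg - (z l).arg)) (y := π / 3)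
      (by linarith [Complex.arg_le_pi (z j), Complex.neg_pi_lt_arg (z l)]) (by linarith)
      (by linarith)
    rw [cos_pi_div_three] at c3
    linarith [h.norm_le j hj]
  linarith

end IsFan

open Real in
/-- There are no two fans of four points around both ends of a segment such that the points of one
are far from the points of the other. The second fan is given in mirrored coordinates, in which its
centre is the origin and the other end of the segment is `s`; mirroring keeps the half-planes above
and below the axis. -/
theorem IsFan.not_both {ι κ : Type*} {S : Finset ι} {T : Finset κ} {z : ι → ℂ} {w : κ → ℂ} {s : ℝ}
    (hz : IsFan S z s) (hw : IsFan T w s) (hS : S.card = 4) (hT : T.card = 4)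
    (h : ∀ i ∈ S, ∀ j ∈ T, 2 < ‖z i - (s - (starRingEnd ℂ) (w j))‖) : False := by
  obtain ⟨i, hi, k, hk, hi0, hk0, hsum⟩ := hz.exists_pair hS
  obtain ⟨j, hj, l, hl, hj0, hl0, hsum'⟩ := hw.exists_pair hT
  have far : ∀ i ∈ S, ∀ j ∈ T, 4 < s ^ 2 + ‖z i‖ ^ 2 + ‖w j‖ ^ 2 - 2 * s * ‖z i‖ * cos (z i).arg
      - 2 * s * ‖w j‖ * cos (w j).arg + 2 * ‖z i‖ * ‖w j‖ * cos ((z i).arg + (w j).arg) := by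
    intro i hi j hj
    have h1 := h i hi j hj
    have hz1 := Complex.norm_mul_cos_arg (z i)
    have hz2 := Complex.norm_mul_sin_arg (z i)
    have hw1 := Complex.norm_mul_cos_arg (w j)
    have hw2 := Complex.norm_mul_sin_arg (w j)
    have e1 : ‖z i‖ ^ 2 = (z i).re * (z i).re + (z i).im * (z i).im := by
      rw [Complex.sq_norm, Complex.normSq_apply]
    have e2 : ‖w j‖ ^ 2 = (w j).re * (w j).re + (w j).im * (w j).im := by
      rw [Complex.sq_norm, Complex.normSq_apply]
    have e3 : ‖z i - (s - (starRingEnd ℂ) (w j))‖ ^ 2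
        = ((z i).re - (s - (w j).re)) * ((z i).re - (s - (w j).re))
          + ((z i).im - (w j).im) * ((z i).im - (w j).im) := by
      rw [Complex.sq_norm, Complex.normSq_apply]; simp
    have e4 : s ^ 2 + ‖z i‖ ^ 2 + ‖w j‖ ^ 2 - 2 * s * ‖z i‖ * cos (z i).arg
      - 2 * s * ‖w j‖ * cos (w j).arg + 2 * ‖z i‖ * ‖w j‖ * cos ((z i).arg + (w j).arg)
      = ‖z i - (s - (starRingEnd ℂ) (w j))‖ ^ 2 := by
      rw [e3, e1, e2, cos_add, ← hz1, ← hz2, ← hw1, ← hw2]; ring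
    rw [e4]; nlinarith
  have near : ∀ i ∈ S, 4 < ‖z i‖ ^ 2 + s ^ 2 - 2 * ‖z i‖ * s * cos (z i).arg := by
    intro i hi
    rw [← norm_sub_ofReal_sq_polar _ hz.pos]
    nlinarith [hz.far i hi]
  have near' : ∀ i ∈ T, 4 < ‖w i‖ ^ 2 + s ^ 2 - 2 * ‖w i‖ * s * cos (w i).arg := by
    intro i hi
    rw [← norm_sub_ofReal_sq_polar _ hz.pos]
    nlinarith [hw.far i hi]
  have g1 := angle_sum_gt (norm_pos_iff.2 (hz.ne_zero hi)) (hz.norm_le i hi)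
    (norm_pos_iff.2 (hw.ne_zero hj)) (hw.norm_le j hj) hz.pos hz.le_two hi0.le
    (Complex.arg_le_pi _) hj0.le (Complex.arg_le_pi _) (near i hi) (near' j hj) (far i hi j hj)
  have g2 := angle_sum_gt (norm_pos_iff.2 (hz.ne_zero hk)) (hz.norm_le k hk)
    (norm_pos_iff.2 (hw.ne_zero hl)) (hw.norm_le l hl) hz.pos hz.le_two (neg_nonneg.2 hk0)
    (by linarith [Complex.neg_pi_lt_arg (z k)]) (neg_nonneg.2 hl0)
    (by linarith [Complex.neg_pi_lt_arg (w l)])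
    (by rw [cos_neg]; exact near k hk) (by rw [cos_neg]; exact near' l hl)
    (by rw [cos_neg, cos_neg, ← neg_add, cos_neg]; exact far k hk l hl)
  linarith

/-! ### The degree condition is necessary -/

theorem unitDisk_inter_nonempty_iff (p q : Plane) :
    (unitDisk p ∩ unitDisk q).Nonempty ↔ dist p q ≤ 2 := by
  rw [← Set.not_disjoint_iff_nonempty_inter, unitDisk, unitDisk,
    disjoint_closedBall_closedBall_iff zero_le_one zero_le_one, not_lt]
  norm_num

/-- A point of the plane as a complex number. -/
def Plane.toComplex (p : Plane) : ℂ := ⟨p 0, p 1⟩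

theorem Plane.dist_eq_norm_toComplex (p q : Plane) : dist p q = ‖p.toComplex - q.toComplex‖ := by
  rw [EuclideanSpace.dist_eq, Fin.sum_univ_two, Complex.norm_def, Complex.normSq_apply]
  simp only [Real.dist_eq, sq_abs]
  simp only [Plane.toComplex, Complex.sub_re, Complex.sub_im, pow_two]

theorem unitDisk_injective : Function.Injective unitDisk := by
  intro p q h
  by_contra hne
  have hd : 0 < dist q p := dist_pos.2 (Ne.symm hne)
  have hm : p + (dist q p)⁻¹ • (p - q) ∈ unitDisk p := by
    rw [unitDisk, Metric.mem_closedBall, dist_eq_norm, add_sub_cancel_left, norm_smul,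
      ← dist_eq_norm, dist_comm p q, Real.norm_of_nonneg (by positivity), inv_mul_cancel₀ hd.ne']
  rw [h, unitDisk, Metric.mem_closedBall, dist_eq_norm] at hm
  have e : p + (dist q p)⁻¹ • (p - q) - q = (1 + (dist q p)⁻¹) • (p - q) := by
    rw [add_smul, one_smul]; abel
  rw [e, norm_smul, ← dist_eq_norm, dist_comm p q, Real.norm_of_nonneg (by positivity), add_mul,
    inv_mul_cancel₀ hd.ne'] at hm
  linarith

namespace SimpleGraph.IsAcyclic

variable {V : Type*} {G : SimpleGraph V}

theorem not_adj_of_common_neighbor (hG : G.IsAcyclic) {u a b : V} (ha : G.Adj u a)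
    (hb : G.Adj u b) : ¬ G.Adj a b := by
  intro hab
  have h1 : (Walk.cons hab Walk.nil : G.Walk a b).IsPath := by simp [hab.ne]
  have h2 : (Walk.cons ha.symm (Walk.cons hb Walk.nil) : G.Walk a b).IsPath := by
    simp [hb.ne, ha.ne', hab.ne]
  have := congrArg (fun p : G.Path a b => p.1.length)
    ((hG.subsingleton_path a b).elim ⟨_, h1⟩ ⟨_, h2⟩)
  simp at this

theorem not_adj_of_adj_neighbors (hG : G.IsAcyclic) {u v a c : V} (huv : G.Adj u v)
    (ha : G.Adj u a) (hav : a ≠ v) (hc : G.Adj v c) (hcu : c ≠ u) : a ≠ c ∧ ¬ G.Adj a c := by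
  have hac : a ≠ c := by
    rintro rfl
    exact hG.not_adj_of_common_neighbor ha.symm hc.symm huv
  refine ⟨hac, fun h => ?_⟩
  have h1 : (Walk.cons h Walk.nil : G.Walk a c).IsPath := by simp [hac]
  have h2 : (Walk.cons ha.symm (Walk.cons huv (Walk.cons hc Walk.nil)) : G.Walk a c).IsPath := by
    simp [hc.ne, ha.ne', hac, hav, huv.ne, Ne.symm hcu]
  have := congrArg (fun p : G.Path a c => p.1.length)
    ((hG.subsingleton_path a c).elim ⟨_, h1⟩ ⟨_, h2⟩)
  simp at this

end SimpleGraph.IsAcyclic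

/-- The orientation-preserving motion of the plane that moves `u` to zero and `v` to the positive
real axis, applied to `p` (for `u ≠ v`). -/
noncomputable def alongAxis (u v p : Plane) : ℂ :=
  (p.toComplex - u.toComplex) * ((starRingEnd ℂ) (v.toComplex - u.toComplex) / dist u v)

theorem norm_alongAxis_sub {u v : Plane} (h : u ≠ v) (p q : Plane) :
    ‖alongAxis u v p - alongAxis u v q‖ = dist p q := by
  have hd : 0 < dist u v := dist_pos.2 h
  rw [alongAxis, alongAxis, ← sub_mul, sub_sub_sub_cancel_right, norm_mul, norm_div,
    Complex.norm_conj, Complex.norm_real, Real.norm_of_nonneg hd.le, ← norm_sub_rev,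
    ← Plane.dist_eq_norm_toComplex, dist_comm u v, norm_sub_rev, ← Plane.dist_eq_norm_toComplex,
    dist_comm q p, dist_comm v u, div_self hd.ne', mul_one]

theorem alongAxis_left (u v : Plane) : alongAxis u v u = 0 := by simp [alongAxis]

theorem alongAxis_right {u v : Plane} (h : u ≠ v) : alongAxis u v v = (dist u v : ℝ) := by
  have hd : (0 : ℝ) < dist u v := dist_pos.2 h
  rw [alongAxis, ← mul_div_assoc, Complex.mul_conj, Complex.normSq_eq_norm_sq,
    ← Plane.dist_eq_norm_toComplex, dist_comm v u]
  rw [div_eq_iff (by exact_mod_cast hd.ne')]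
  push_cast; ring

namespace IsUDR

variable {V : Type*} {G : SimpleGraph V} {c : V → Plane}

theorem dist_le (h : IsUDR G c) {u v : V} (ha : G.Adj u v) : dist (c u) (c v) ≤ 2 :=
  (unitDisk_inter_nonempty_iff _ _).1 ((h.adj_iff u v ha.ne).1 ha)

theorem lt_dist (h : IsUDR G c) {u v : V} (hne : u ≠ v) (ha : ¬ G.Adj u v) :
    2 < dist (c u) (c v) := by
  rw [h.adj_iff u v hne, unitDisk_inter_nonempty_iff, not_le] at ha
  exact ha

theorem ne (h : IsUDR G c) {u v : V} (hne : u ≠ v) : c u ≠ c v :=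
  fun e => hne (h.injective (congrArg unitDisk e))

variable [Fintype V] [DecidableRel G.Adj] [DecidableEq V]

theorem isFan (h : IsUDR G c) (hG : G.IsAcyclic) {u v : V} (huv : G.Adj u v) :
    IsFan ((G.neighborFinset u).erase v) (fun a => alongAxis (c u) (c v) (c a))
      (dist (c u) (c v)) where
  pos := dist_pos.2 (h.ne huv.ne)
  le_two := h.dist_le huv
  norm_le a ha := by
    rw [Finset.mem_erase, SimpleGraph.mem_neighborFinset] at ha
    have := norm_alongAxis_sub (h.ne huv.ne) (c a) (c u)
    rw [alongAxis_left, sub_zero] at this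
    rw [this]; exact h.dist_le ha.2.symm
  far a ha := by
    rw [Finset.mem_erase, SimpleGraph.mem_neighborFinset] at ha
    rw [← alongAxis_right (h.ne huv.ne), norm_alongAxis_sub (h.ne huv.ne)]
    exact h.lt_dist ha.1 (hG.not_adj_of_common_neighbor ha.2 huv)
  apart a ha b hb hab := by
    rw [Finset.mem_erase, SimpleGraph.mem_neighborFinset] at ha hb
    rw [norm_alongAxis_sub (h.ne huv.ne)]
    exact h.lt_dist hab (hG.not_adj_of_common_neighbor ha.2 hb.2)

theorem degree_le (h : IsUDR G c) (hG : G.IsAcyclic) (u : V) : G.degree u ≤ 5 := by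
  by_cases h0 : G.degree u = 0
  · omega
  · rw [← SimpleGraph.card_neighborFinset_eq_degree] at h0
    obtain ⟨v, hv⟩ := Finset.card_ne_zero.1 h0
    have huv : G.Adj u v := (G.mem_neighborFinset u v).1 hv
    have := (h.isFan hG huv).card_le
    rw [Finset.card_erase_of_mem hv, SimpleGraph.card_neighborFinset_eq_degree] at this
    omega

theorem not_adj_of_degree_eq_five (h : IsUDR G c) (hG : G.IsAcyclic) {u v : V}
    (huv : G.Adj u v) (hu : G.degree u = 5) (hv : G.degree v = 5) : False := by
  have cu : ((G.neighborFinset u).erase v).card = 4 := by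
    rw [Finset.card_erase_of_mem ((G.mem_neighborFinset u v).2 huv),
      SimpleGraph.card_neighborFinset_eq_degree, hu]
  have cv : ((G.neighborFinset v).erase u).card = 4 := by
    rw [Finset.card_erase_of_mem ((G.mem_neighborFinset v u).2 huv.symm),
      SimpleGraph.card_neighborFinset_eq_degree, hv]
  have hne := h.ne huv.ne
  have hs : (dist (c u) (c v) : ℂ) = alongAxis (c u) (c v) (c v) := (alongAxis_right hne).symm
  -- the mirrored coordinates around `c v`
  have fv : IsFan ((G.neighborFinset v).erase u)
      (fun a => (dist (c u) (c v) : ℂ) - (starRingEnd ℂ) (alongAxis (c u) (c v) (c a)))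
      (dist (c u) (c v)) := by
    have hcs : (dist (c u) (c v) : ℂ) = (starRingEnd ℂ) (alongAxis (c u) (c v) (c v)) := by
      rw [← hs, Complex.conj_ofReal]
    refine ⟨dist_pos.2 hne, h.dist_le huv, fun a ha => ?_, fun a ha => ?_, fun a ha b hb hab => ?_⟩
    · rw [Finset.mem_erase, SimpleGraph.mem_neighborFinset] at ha
      rw [hcs, ← map_sub, Complex.norm_conj, norm_alongAxis_sub hne]
      exact h.dist_le ha.2
    · rw [Finset.mem_erase, SimpleGraph.mem_neighborFinset] at ha
      rw [sub_sub_cancel_left, norm_neg, Complex.norm_conj]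
      have := norm_alongAxis_sub hne (c a) (c u)
      rw [alongAxis_left, sub_zero] at this
      rw [this]
      exact h.lt_dist ha.1 (hG.not_adj_of_common_neighbor ha.2 huv.symm)
    · rw [Finset.mem_erase, SimpleGraph.mem_neighborFinset] at ha hb
      rw [sub_sub_sub_cancel_left, ← map_sub, Complex.norm_conj, norm_alongAxis_sub hne]
      exact h.lt_dist hab.symm (hG.not_adj_of_common_neighbor hb.2 ha.2)
  refine (h.isFan hG huv).not_both fv cu cv fun a ha b hb => ?_
  rw [Finset.mem_erase, SimpleGraph.mem_neighborFinset] at ha hb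
  rw [map_sub, Complex.conj_conj, Complex.conj_ofReal, sub_sub_cancel, norm_alongAxis_sub hne]
  obtain ⟨h1, h2⟩ := hG.not_adj_of_adj_neighbors huv ha.2 ha.1 hb.2 hb.1
  exact h.lt_dist h1 h2

end IsUDR

theorem AdmitsUDR.degreeCondition {V : Type*} [Fintype V] {G : SimpleGraph V} [DecidableRel G.Adj]
    (hG : G.IsAcyclic) (h : AdmitsUDR G) : DegreeCondition G := by
  classical
  obtain ⟨c, hc⟩ := h
  exact ⟨hc.degree_le hG, fun u _ v _ huv hd => hc.not_adj_of_degree_eq_five hG huv hd.1 hd.2⟩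

/-! ### The tables of the layout -/

namespace CaterpillarLayout

/-- The successor table of the spine automaton; its cell `4 * s + 2 * f + g` holds the state that
follows `s`, where `f` tells whether the next spine vertex has degree five and `g` tells the same
of the vertex after it.  States `0` and `2` are those of vertices of degree five, and the remaining
vertices are classified by the states of their two neighbours: `1` and `3` lie between two
vertices of degree five, `4` and `5` follow one (in state `0` and `2`, respectively), `6` precedes
one, and `7` is not next to any. -/
def nextTable : List ℕ := [
    4, 1, 0, 0, 7, 6, 2, 2, 5, 3, 0, 0, 7, 6, 0, 0,
    7, 6, 0, 0, 7, 6, 0, 0, 7, 6, 0, 0, 7, 6, 0, 0]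

/-- Horizontal displacement from a spine vertex in state `s` to its successor in state `s'`, in
thousandths, in cell `8 * s + s'` (zero if `s'` cannot follow `s`). -/
def dxTable : List ℤ := [
    0, 1986, 0, 0, 1980, 0, 0, 0,
    0, 0, 1978, 0, 0, 0, 0, 0,
    0, 0, 0, 1834, 0, 1836, 0, 0,
    1826, 0, 0, 0, 0, 0, 0, 0,
    0, 0, 0, 0, 0, 0, 1924, 1945,
    0, 0, 0, 0, 0, 0, 1810, 1808,
    1925, 0, 0, 0, 0, 0, 0, 0,
    0, 0, 0, 0, 0, 0, 1917, 1979]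

/-- Vertical displacement between consecutive spine vertices, as in `dxTable`; it has to be
multiplied by the orientation of the second vertex. -/
def dyTable : List ℤ := [
    0, -167, 0, 0, -223, 0, 0, 0,
    0, 0, -255, 0, 0, 0, 0, 0,
    0, 0, 0, -782, 0, -774, 0, 0,
    798, 0, 0, 0, 0, 0, 0, 0,
    0, 0, 0, 0, 0, 0, -502, -426,
    0, 0, 0, 0, 0, 0, -834, -836,
    517, 0, 0, 0, 0, 0, 0, 0,
    0, 0, 0, 0, 0, 0, -513, 102]

/-- Cell `4 * s + j` holds the horizontal offset, in thousandths, of the `j`-th leaf of a spine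
vertex in state `s`; cell `4 * s` stands for the vertex itself. -/
def oxTable : List ℤ := [
    0, 928, 278, -1085,
    0, 114, 25, 0,
    0, -174, 1412, -538,
    0, -1102, 106, 0,
    0, 53, 117, 0,
    0, 108, -672, 0,
    0, -103, 177, 0,
    0, 101, 90, 0]

/-- Vertical offsets of the leaves, as in `oxTable`; they have to be multiplied by the orientation
of the spine vertex. -/
def oyTable : List ℤ := [
    0, 1764, -1296, 1668,
    0, -1990, 229, 0,
    0, -640, 1408, 1918,
    0, -1658, 246, 0,
    0, 282, -1982, 0,
    0, 240, -1824, 0,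
    0, -376, 1825, 0,
    0, 1984, -864, 0]

/-- The layout is reflected after the spine vertices whose state has the entry `-1`. -/
def flipTable : List ℤ := [1, 1, 1, -1, 1, 1, -1, -1]

/-- The state after `s`, see `nextTable`. -/
def next (s f g : ℕ) : ℕ := nextTable.getD (4 * s + 2 * f + g) 0

/-- The horizontal displacement, see `dxTable`. -/
def dx (s s' : ℕ) : ℤ := dxTable.getD (8 * s + s') 0

/-- The vertical displacement, see `dyTable`. -/
def dy (s s' : ℕ) : ℤ := dyTable.getD (8 * s + s') 0

/-- The horizontal leaf offset, see `oxTable`. -/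
def ox (s j : ℕ) : ℤ := oxTable.getD (4 * s + j) 0

/-- The vertical leaf offset, see `oyTable`. -/
def oy (s j : ℕ) : ℤ := oyTable.getD (4 * s + j) 0

/-- The change of orientation, see `flipTable`. -/
def flip (s : ℕ) : ℤ := flipTable.getD s 0

/-- The number of places for leaves around a spine vertex in state `s`. -/
def slots (s : ℕ) : ℕ := if s = 0 ∨ s = 2 then 3 else 2

/-- The states of the vertices that are followed by a vertex of degree five. -/
def PrecedesFive (s : ℕ) : Prop := s = 1 ∨ s = 3 ∨ s = 6

instance (s : ℕ) : Decidable (PrecedesFive s) := by unfold PrecedesFive; infer_instance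

/-- `s'` can follow `s` on the spine. -/
def Follows (s s' : ℕ) : Prop :=
  ∃ f < 2, ∃ g < 2, next s f g = s' ∧ (f = 1 ↔ PrecedesFive s)

instance (s s' : ℕ) : Decidable (Follows s s') := by unfold Follows; infer_instance

/-- The state of the `i`-th spine vertex, where `f j = 1` if the `j`-th vertex has degree five and
`f j = 0` otherwise. -/
def state (f : ℕ → ℕ) : ℕ → ℕ
  | 0 => next 7 0 (f 1)
  | i + 1 => next (state f i) (f (i + 1)) (f (i + 2))

/-- The orientation of the `i`-th spine vertex. -/
def orientation (f : ℕ → ℕ) : ℕ → ℤ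
  | 0 => 1
  | i + 1 => orientation f i * flip (state f i)

/-- The first coordinate of the `i`-th spine vertex, in thousandths. -/
def spineX (f : ℕ → ℕ) : ℕ → ℤ
  | 0 => 0
  | i + 1 => spineX f i + dx (state f i) (state f (i + 1))

/-- The second coordinate of the `i`-th spine vertex, in thousandths. -/
def spineY (f : ℕ → ℕ) : ℕ → ℤ
  | 0 => 0
  | i + 1 => spineY f i + orientation f (i + 1) * dy (state f i) (state f (i + 1))

/-- The first coordinate of the `j`-th leaf of the `i`-th spine vertex (of the spine vertex itself
if `j = 0`), in thousandths. -/
def posX (f : ℕ → ℕ) (i j : ℕ) : ℤ := spineX f i + ox (state f i) j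

/-- The second coordinate of the `j`-th leaf of the `i`-th spine vertex (of the spine vertex itself
if `j = 0`), in thousandths. -/
def posY (f : ℕ → ℕ) (i j : ℕ) : ℤ := spineY f i + orientation f i * oy (state f i) j

/-- The squared distance of two points of the layout, in millionths. -/
def sqDist (f : ℕ → ℕ) (i j i' j' : ℕ) : ℤ :=
  (posX f i' j' - posX f i j) ^ 2 + (posY f i' j' - posY f i j) ^ 2

/-- The flags of a spine: they are `0` or `1`, no two consecutive ones are `1`, and the
dummy vertex `0` has the flag `0`. -/
structure IsFlags (f : ℕ → ℕ) : Prop where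
  lt_two : ∀ i, f i < 2
  zero : f 0 = 0
  not_both : ∀ i, f i = 1 → f (i + 1) = 0

set_option synthInstance.maxSize 4096 in
set_option synthInstance.maxHeartbeats 400000 in
theorem next_spec : ∀ s < 8, ∀ f < 2, ∀ g < 2, (f = 1 → g = 0) → (f = 1 ↔ PrecedesFive s) →
    next s f g < 8 ∧ (g = 1 ↔ PrecedesFive (next s f g)) ∧ (f = 1 → slots (next s f g) = 3) := by
  decide +kernel

theorem slots_le (s : ℕ) : 2 ≤ slots s ∧ slots s ≤ 3 := by
  unfold slots; split_ifs <;> omega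

theorem flip_sq : ∀ s < 8, flip s * flip s = 1 := by decide +kernel

theorem dx_bound : ∀ s < 8, ∀ s' < 8, Follows s s' → 1808 ≤ dx s s' := by decide +kernel

theorem ox_bound : ∀ s < 8, ∀ j < 4, -1103 ≤ ox s j ∧ ox s j ≤ 1412 := by decide +kernel

set_option synthInstance.maxSize 4096 in
set_option synthInstance.maxHeartbeats 400000 in
/-- The points around one spine vertex. As lengths are given in thousandths, the threshold `2 ^ 2`
becomes `4000000`. -/
theorem same_vertex_check : ∀ s < 8, ∀ j < 4, ∀ j' < 4, j < j' → j' ≤ slots s →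
    0 < (ox s j' - ox s j) ^ 2 + (oy s j' - oy s j) ^ 2 ∧
    ((ox s j' - ox s j) ^ 2 + (oy s j' - oy s j) ^ 2 ≤ 4000000 ↔ j = 0) := by
  decide +kernel

set_option synthInstance.maxSize 4096 in
set_option synthInstance.maxHeartbeats 400000 in
/-- The points around two consecutive spine vertices, in coordinates that have been reflected
according to the orientation of the second one. -/
theorem next_vertex_check : ∀ s < 8, ∀ s' < 8, Follows s s' → ∀ j < 4, j ≤ slots s → ∀ j' < 4,
    j' ≤ slots s' →
    0 < (dx s s' + ox s' j' - ox s j) ^ 2 + (dy s s' + oy s' j' - flip s * oy s j) ^ 2 ∧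
    ((dx s s' + ox s' j' - ox s j) ^ 2 + (dy s s' + oy s' j' - flip s * oy s j) ^ 2 ≤ 4000000 ↔
      j = 0 ∧ j' = 0) := by
  decide +kernel

set_option synthInstance.maxSize 4096 in
set_option synthInstance.maxHeartbeats 400000 in
/-- The points around two spine vertices with one spine vertex between them, in coordinates that
have been reflected according to the orientation of the one between them. -/
theorem second_next_vertex_check : ∀ s < 8, ∀ s' < 8, Follows s s' → ∀ s'' < 8, Follows s' s'' →
    ∀ j < 4, j ≤ slots s → ∀ j' < 4, j' ≤ slots s'' →
    4000000 < (dx s s' + dx s' s'' + ox s'' j' - ox s j) ^ 2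
      + (dy s s' + flip s' * (dy s' s'' + oy s'' j') - flip s * oy s j) ^ 2 := by
  decide +kernel

theorem state_spec {f : ℕ → ℕ} (hf : IsFlags f) (i : ℕ) : state f i < 8 ∧
    (f (i + 1) = 1 ↔ PrecedesFive (state f i)) ∧ (f i = 1 → slots (state f i) = 3) := by
  induction i with
  | zero =>
    have h := next_spec 7 (by norm_num) 0 (by norm_num) (f 1) (hf.lt_two 1) (by simp) (by decide)
    refine ⟨h.1, h.2.1, fun h0 => ?_⟩
    rw [hf.zero] at h0; omega
  | succ i ih => exact next_spec _ ih.1 _ (hf.lt_two _) _ (hf.lt_two _) (hf.not_both _) ih.2.1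

theorem state_lt {f : ℕ → ℕ} (hf : IsFlags f) (i : ℕ) : state f i < 8 := (state_spec hf i).1

theorem follows {f : ℕ → ℕ} (hf : IsFlags f) (i : ℕ) : Follows (state f i) (state f (i + 1)) :=
  ⟨f (i + 1), hf.lt_two _, f (i + 2), hf.lt_two _, rfl, (state_spec hf i).2.1⟩

theorem orientation_sq {f : ℕ → ℕ} (hf : IsFlags f) (i : ℕ) :
    orientation f i * orientation f i = 1 := by
  induction i with
  | zero => rfl
  | succ i ih =>
    rw [orientation, mul_mul_mul_comm, ih, flip_sq _ (state_lt hf i), one_mul]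

theorem orientation_eq {f : ℕ → ℕ} (hf : IsFlags f) (i : ℕ) :
    orientation f i = orientation f (i + 1) * flip (state f i) := by
  rw [orientation, mul_assoc, flip_sq _ (state_lt hf i), mul_one]

theorem spineX_add {f : ℕ → ℕ} (hf : IsFlags f) (i m : ℕ) :
    spineX f i + 1808 * m ≤ spineX f (i + m) := by
  induction m with
  | zero => simp
  | succ m ih =>
    have := dx_bound _ (state_lt hf (i + m)) _ (state_lt hf (i + m + 1)) (follows hf (i + m))
    rw [← add_assoc, spineX]; push_cast; linarith

theorem sqDist_same {f : ℕ → ℕ} (hf : IsFlags f) (i : ℕ) {j j' : ℕ} (h : j < j')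
    (hj' : j' ≤ slots (state f i)) :
    0 < sqDist f i j i j' ∧ (sqDist f i j i j' ≤ 4000000 ↔ j = 0) := by
  have h3 := (slots_le (state f i)).2
  have e : sqDist f i j i j' = (ox (state f i) j' - ox (state f i) j) ^ 2
      + (oy (state f i) j' - oy (state f i) j) ^ 2 := by
    rw [sqDist, posX, posX, posY, posY]
    linear_combination (oy (state f i) j' - oy (state f i) j) ^ 2 * orientation_sq hf i
  rw [e]
  exact same_vertex_check _ (state_lt hf i) j (by omega) j' (by omega) h hj'

theorem sqDist_next {f : ℕ → ℕ} (hf : IsFlags f) (i : ℕ) {j j' : ℕ} (hj : j ≤ slots (state f i))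
    (hj' : j' ≤ slots (state f (i + 1))) : 0 < sqDist f i j (i + 1) j' ∧
      (sqDist f i j (i + 1) j' ≤ 4000000 ↔ j = 0 ∧ j' = 0) := by
  have h3 := (slots_le (state f i)).2
  have h4 := (slots_le (state f (i + 1))).2
  have e : sqDist f i j (i + 1) j'
      = (dx (state f i) (state f (i + 1)) + ox (state f (i + 1)) j' - ox (state f i) j) ^ 2
        + (dy (state f i) (state f (i + 1)) + oy (state f (i + 1)) j'
          - flip (state f i) * oy (state f i) j) ^ 2 := by
    rw [sqDist, posX, posX, posY, posY, spineX, spineY, orientation_eq hf i]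
    linear_combination (dy (state f i) (state f (i + 1)) + oy (state f (i + 1)) j'
          - flip (state f i) * oy (state f i) j) ^ 2 * orientation_sq hf (i + 1)
  rw [e]
  exact next_vertex_check _ (state_lt hf i) _ (state_lt hf (i + 1)) (follows hf i) j (by omega) hj
    j' (by omega) hj'

theorem sqDist_second_next {f : ℕ → ℕ} (hf : IsFlags f) (i : ℕ) {j j' : ℕ}
    (hj : j ≤ slots (state f i))
    (hj' : j' ≤ slots (state f (i + 2))) : 4000000 < sqDist f i j (i + 2) j' := by
  have h3 := (slots_le (state f i)).2
  have h4 := (slots_le (state f (i + 2))).2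
  have e : sqDist f i j (i + 2) j'
      = (dx (state f i) (state f (i + 1)) + dx (state f (i + 1)) (state f (i + 2))
          + ox (state f (i + 2)) j' - ox (state f i) j) ^ 2
        + (dy (state f i) (state f (i + 1)) + flip (state f (i + 1))
          * (dy (state f (i + 1)) (state f (i + 2)) + oy (state f (i + 2)) j')
          - flip (state f i) * oy (state f i) j) ^ 2 := by
    rw [sqDist, posX, posX, posY, posY, spineX, spineX, spineY, spineY, orientation_eq hf i]
    rw [show orientation f (i + 1 + 1) = orientation f (i + 1) * flip (state f (i + 1)) from rfl]
    linear_combination (dy (state f i) (state f (i + 1)) + flip (state f (i + 1))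
          * (dy (state f (i + 1)) (state f (i + 2)) + oy (state f (i + 2)) j')
          - flip (state f i) * oy (state f i) j) ^ 2 * orientation_sq hf (i + 1)
  rw [e]
  exact second_next_vertex_check _ (state_lt hf i) _ (state_lt hf (i + 1)) (follows hf i) _
    (state_lt hf (i + 2)) (follows hf (i + 1)) j (by omega) hj j' (by omega) hj'

/-- Spine vertices that are three or more steps apart are so far from each other horizontally that
the points around them cannot be close. -/
theorem sqDist_far {f : ℕ → ℕ} (hf : IsFlags f) (i : ℕ) {m j j' : ℕ} (hm : 3 ≤ m)
    (hj : j ≤ slots (state f i))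
    (hj' : j' ≤ slots (state f (i + m))) : 4000000 < sqDist f i j (i + m) j' := by
  have h3 := (slots_le (state f i)).2
  have h4 := (slots_le (state f (i + m))).2
  have b1 := ox_bound _ (state_lt hf i) j (by omega)
  have b2 := ox_bound _ (state_lt hf (i + m)) j' (by omega)
  have b3 := spineX_add hf i m
  have hm' : (3 : ℤ) ≤ m := by exact_mod_cast hm
  have : 2001 ≤ posX f (i + m) j' - posX f i j := by rw [posX, posX]; linarith
  rw [sqDist]
  nlinarith [sq_nonneg (posY f (i + m) j' - posY f i j)]

/-- Two distinct points of the layout have distance at most two exactly if they belong to the same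
spine vertex and one is that vertex, or if they are consecutive spine vertices. -/
theorem sqDist_spec {f : ℕ → ℕ} (hf : IsFlags f) {i j i' j' : ℕ} (hi : i ≤ i')
    (hne : i = i' → j < j')
    (hj : j ≤ slots (state f i)) (hj' : j' ≤ slots (state f i')) :
    0 < sqDist f i j i' j' ∧
      (sqDist f i j i' j' ≤ 4000000 ↔ (i = i' ∧ j = 0) ∨ (i + 1 = i' ∧ j = 0 ∧ j' = 0)) := by
  obtain ⟨m, rfl⟩ := Nat.exists_eq_add_of_le hi
  rcases m with _ | _ | _ | m
  · have := sqDist_same hf i (hne rfl) hj'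
    simpa using this
  · have := sqDist_next hf i hj hj'
    simpa using this
  · have := sqDist_second_next hf i hj hj'
    refine ⟨by simp only [zero_add, Nat.reduceAdd]; linarith, ?_⟩
    constructor
    · intro h; simp only [zero_add, Nat.reduceAdd] at h; linarith
    · rintro (h | h) <;> omega
  · have := sqDist_far hf i (m := m + 1 + 1 + 1) (by omega) hj hj'
    refine ⟨by linarith, ?_⟩
    constructor
    · intro h; linarith
    · rintro (h | h) <;> omega

end CaterpillarLayout

/-! ### Loop-free programs and bounded loops -/

namespace RealRAM

/-- The program contains no loop. -/
def Prog.LoopFree : Prog → Prop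
  | .seq p q => p.LoopFree ∧ q.LoopFree
  | .ite _ p q => p.LoopFree ∧ q.LoopFree
  | .loop _ _ => False
  | _ => True

open Classical in
/-- The configuration in which a loop-free program halts (loops are ignored). -/
noncomputable def Prog.exec : Prog → State → State
  | .skip, σ => σ
  | .setNReg r e, σ => { σ with nreg := Function.update σ.nreg r (e.eval σ) }
  | .setNCell a i e, σ =>
    { σ with narr := Function.update σ.narr a (Function.update (σ.narr a) (i.eval σ) (e.eval σ)) }
  | .setRReg r e, σ => { σ with rreg := Function.update σ.rreg r (e.eval σ) }
  | .setRCell a i e, σ =>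
    { σ with rarr := Function.update σ.rarr a (Function.update (σ.rarr a) (i.eval σ) (e.eval σ)) }
  | .seq p q, σ => q.exec (p.exec σ)
  | .ite b p q, σ => if b.holds σ then p.exec σ else q.exec σ
  | .loop _ _, σ => σ

/-- An upper bound for the running time of a loop-free program. -/
def Prog.bound : Prog → ℕ
  | .skip => 1
  | .setNReg _ e => e.cost + 1
  | .setNCell _ i e => i.cost + e.cost + 1
  | .setRReg _ e => e.cost + 1
  | .setRCell _ i e => i.cost + e.cost + 1
  | .seq p q => p.bound + q.bound
  | .ite b p q => b.cost + (p.bound + q.bound) + 1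
  | .loop _ _ => 0

/-- The natural-number registers that a program may change. -/
def Prog.nregs : Prog → List ℕ
  | .setNReg r _ => [r]
  | .seq p q => p.nregs ++ q.nregs
  | .ite _ p q => p.nregs ++ q.nregs
  | .loop _ p => p.nregs
  | _ => []

/-- The natural-number arrays that a program may change. -/
def Prog.narrs : Prog → List ℕ
  | .setNCell a _ _ => [a]
  | .seq p q => p.narrs ++ q.narrs
  | .ite _ p q => p.narrs ++ q.narrs
  | .loop _ p => p.narrs
  | _ => []

/-- The real arrays that a program may change. -/
def Prog.rarrs : Prog → List ℕ
  | .setRCell a _ _ => [a]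
  | .seq p q => p.rarrs ++ q.rarrs
  | .ite _ p q => p.rarrs ++ q.rarrs
  | .loop _ p => p.rarrs
  | _ => []

/-- `τ` differs from `σ` at most in memory that the program `p` may change. (Real registers are not
used by the programs below.) -/
structure Unchanged (p : Prog) (σ τ : State) : Prop where
  nreg : ∀ r, r ∉ p.nregs → τ.nreg r = σ.nreg r
  narr : ∀ a, a ∉ p.narrs → τ.narr a = σ.narr a
  rarr : ∀ a, a ∉ p.rarrs → τ.rarr a = σ.rarr a

theorem Unchanged.refl (p : Prog) (σ : State) : Unchanged p σ σ :=
  ⟨fun _ _ => rfl, fun _ _ => rfl, fun _ _ => rfl⟩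

theorem Unchanged.trans {p : Prog} {σ τ υ : State} (h : Unchanged p σ τ) (h' : Unchanged p τ υ) :
    Unchanged p σ υ :=
  ⟨fun r hr => (h'.nreg r hr).trans (h.nreg r hr), fun r hr => (h'.narr r hr).trans (h.narr r hr),
    fun r hr => (h'.rarr r hr).trans (h.rarr r hr)⟩

theorem Unchanged.mono {p q : Prog} {σ τ : State} (h : Unchanged p σ τ)
    (h1 : p.nregs ⊆ q.nregs) (h2 : p.narrs ⊆ q.narrs) (h3 : p.rarrs ⊆ q.rarrs) :
    Unchanged q σ τ :=
  ⟨fun r hr => h.nreg r fun h' => hr (h1 h'), fun r hr => h.narr r fun h' => hr (h2 h'),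
    fun r hr => h.rarr r fun h' => hr (h3 h')⟩

theorem Runs.unchanged {p : Prog} {σ τ : State} {t : ℕ} (h : Runs p σ t τ) : Unchanged p σ τ := by
  induction h with
  | skip σ => exact Unchanged.refl _ _
  | setNReg σ r e =>
    refine ⟨fun r' hr => ?_, fun _ _ => rfl, fun _ _ => rfl⟩
    exact Function.update_of_ne (by simpa [Prog.nregs] using hr) _ _
  | setNCell σ a i e =>
    refine ⟨fun _ _ => rfl, fun a' ha => ?_, fun _ _ => rfl⟩
    exact Function.update_of_ne (by simpa [Prog.narrs] using ha) _ _
  | setRReg σ r e => exact ⟨fun _ _ => rfl, fun _ _ => rfl, fun _ _ => rfl⟩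
  | setRCell σ a i e =>
    refine ⟨fun _ _ => rfl, fun _ _ => rfl, fun a' ha => ?_⟩
    exact Function.update_of_ne (by simpa [Prog.rarrs] using ha) _ _
  | seq _ _ h1 h2 =>
    exact (h1.mono (List.subset_append_left _ _) (List.subset_append_left _ _)
      (List.subset_append_left _ _)).trans (h2.mono (List.subset_append_right _ _)
      (List.subset_append_right _ _) (List.subset_append_right _ _))
  | ite_true _ _ h =>
    exact h.mono (List.subset_append_left _ _) (List.subset_append_left _ _)
      (List.subset_append_left _ _)
  | ite_false _ _ h =>
    exact h.mono (List.subset_append_right _ _) (List.subset_append_right _ _)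
      (List.subset_append_right _ _)
  | loop_true _ _ _ h1 h2 => exact Unchanged.trans ⟨h1.nreg, h1.narr, h1.rarr⟩ h2
  | loop_false _ => exact Unchanged.refl _ _

theorem Prog.LoopFree.runs {p : Prog} (hp : p.LoopFree) (σ : State) :
    ∃ t ≤ p.bound, Runs p σ t (p.exec σ) := by
  induction p generalizing σ with
  | skip => exact ⟨_, le_rfl, Runs.skip σ⟩
  | setNReg r e => exact ⟨_, le_rfl, Runs.setNReg σ r e⟩
  | setNCell a i e => exact ⟨_, le_rfl, Runs.setNCell σ a i e⟩
  | setRReg r e => exact ⟨_, le_rfl, Runs.setRReg σ r e⟩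
  | setRCell a i e => exact ⟨_, le_rfl, Runs.setRCell σ a i e⟩
  | seq p q ihp ihq =>
    obtain ⟨s, hs, h1⟩ := ihp hp.1 σ
    obtain ⟨t, ht, h2⟩ := ihq hp.2 (p.exec σ)
    exact ⟨s + t, Nat.add_le_add hs ht, Runs.seq h1 h2⟩
  | ite b p q ihp ihq =>
    by_cases hb : b.holds σ
    · obtain ⟨s, hs, h1⟩ := ihp hp.1 σ
      refine ⟨b.cost + s + 1, by simp only [Prog.bound]; omega, ?_⟩
      rw [Prog.exec, if_pos hb]
      exact Runs.ite_true hb h1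
    · obtain ⟨s, hs, h1⟩ := ihq hp.2 σ
      refine ⟨b.cost + s + 1, by simp only [Prog.bound]; omega, ?_⟩
      rw [Prog.exec, if_neg hb]
      exact Runs.ite_false hb h1
  | loop b p => exact hp.elim

/-- `for r = 0, …, b - 1 do p`. -/
def Prog.forTo (r : ℕ) (b : NExp) (p : Prog) : Prog :=
  .seq (.setNReg r (.const 0))
    (.loop (.nlt (.reg r) b) (.seq p (.setNReg r (.add (.reg r) (.const 1)))))

/-- The factor in the running time of a loop. -/
def Prog.loopFactor (b : NExp) (p : Prog) : ℕ := p.bound + b.cost + 9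

/-- The rule for loops whose body is loop-free and does not change the loop counter: an invariant
that is preserved by the body, for counters below `N`, holds at the end. -/
theorem runs_forTo {r : ℕ} {b : NExp} {p : Prog} (hp : p.LoopFree) (hr : r ∉ p.nregs)
    (Inv : ℕ → State → Prop) (N : ℕ) (σ : State)
    (hb : ∀ τ, Unchanged (Prog.forTo r b p) σ τ → b.eval τ = N)
    (h0 : Inv 0 { σ with nreg := Function.update σ.nreg r 0 })
    (hstep : ∀ i < N, ∀ τ, Unchanged (Prog.forTo r b p) σ τ → τ.nreg r = i → Inv i τ →
      Inv (i + 1) { p.exec τ with nreg := Function.update (p.exec τ).nreg r (i + 1) }) :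
    ∃ t τ, Runs (Prog.forTo r b p) σ t τ ∧ t ≤ Prog.loopFactor b p * (N + 1) ∧ Inv N τ := by
  set L : Prog := .loop (.nlt (.reg r) b) (.seq p (.setNReg r (.add (.reg r) (.const 1)))) with hL
  have key : ∀ k i τ, i + k = N → Unchanged (Prog.forTo r b p) σ τ → τ.nreg r = i → Inv i τ →
      ∃ t υ, Runs L τ t υ ∧ t ≤ (p.bound + b.cost + 7) * k + (b.cost + 3) ∧ Inv N υ := by
    intro k
    induction k with
    | zero =>
      intro i τ hi hu hri hI
      have hbe := hb τ hu
      refine ⟨_, τ, Runs.loop_false ?_, ?_, by simpa [← hi] using hI⟩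
      · simp only [Cond.holds, NExp.eval]; omega
      · simp only [Cond.cost, NExp.cost]; omega
    | succ k ih =>
      intro i τ hi hu hri hI
      have hbe := hb τ hu
      obtain ⟨s, hs, hrun⟩ := hp.runs τ
      have hI' := hstep i (by omega) τ hu hri hI
      have hrr : (p.exec τ).nreg r = i := by rw [hrun.unchanged.nreg r hr, hri]
      have hrun2 := Runs.seq hrun (Runs.setNReg (p.exec τ) r (.add (.reg r) (.const 1)))
      have e : (NExp.add (.reg r) (.const 1)).eval (p.exec τ) = i + 1 := by
        simp only [NExp.eval]; omega
      rw [e] at hrun2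
      have hu2 : Unchanged (Prog.forTo r b p) σ
          { p.exec τ with nreg := Function.update (p.exec τ).nreg r (i + 1) } := by
        refine hu.trans (hrun2.unchanged.mono ?_ ?_ ?_)
        · simp [Prog.forTo, Prog.nregs]
        · simp [Prog.forTo, Prog.narrs]
        · simp [Prog.forTo, Prog.rarrs]
      obtain ⟨t, υ, h1, h2, h3⟩ := ih (i + 1) _ (by omega) hu2 (Function.update_self _ _ _) hI'
      refine ⟨_, υ, Runs.loop_true ?_ hrun2 h1, ?_, h3⟩
      · simp only [Cond.holds, NExp.eval]; omega
      · simp only [Cond.cost, NExp.cost]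
        rw [Nat.mul_succ]; omega
  have hu0 : Unchanged (Prog.forTo r b p) σ { σ with nreg := Function.update σ.nreg r 0 } := by
    refine (Runs.setNReg σ r (.const 0)).unchanged.mono ?_ ?_ ?_
    · simp [Prog.forTo, Prog.nregs]
    · simp [Prog.narrs]
    · simp [Prog.rarrs]
  obtain ⟨t, υ, h1, h2, h3⟩ := key N 0 _ (by omega) hu0 (Function.update_self _ _ _) h0
  refine ⟨_, υ, Runs.seq (Runs.setNReg σ r (.const 0)) h1, ?_, h3⟩
  simp only [NExp.cost, Prog.loopFactor]
  have : (p.bound + b.cost + 9) * (N + 1)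
      = (p.bound + b.cost + 7) * N + 2 * N + (p.bound + b.cost + 9) := by ring
  omega

/-- `addTo a i e` adds `e` to cell `i` of the array `a`. -/
def Prog.addTo (a : ℕ) (i e : NExp) : Prog := .setNCell a i (.add (.cell a i) e)

/-- The program that stores a list of integers in a real array, from cell `k` on. -/
def Prog.storeR (a : ℕ) : ℕ → List ℤ → Prog
  | _, [] => .skip
  | k, z :: l => .seq (.setRCell a (.const k)
      (.sub (.ofNat (.const z.toNat)) (.ofNat (.const (-z).toNat)))) (storeR a (k + 1) l)

/-- The program that stores a list of natural numbers in an array, from cell `k` on. -/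
def Prog.storeN (a : ℕ) : ℕ → List ℕ → Prog
  | _, [] => .skip
  | k, z :: l => .seq (.setNCell a (.const k) (.const z)) (storeN a (k + 1) l)

theorem Prog.loopFree_storeR (a k : ℕ) (l : List ℤ) : (storeR a k l).LoopFree := by
  induction l generalizing k with
  | nil => trivial
  | cons z l ih => exact ⟨trivial, ih _⟩

theorem Prog.loopFree_storeN (a k : ℕ) (l : List ℕ) : (storeN a k l).LoopFree := by
  induction l generalizing k with
  | nil => trivial
  | cons z l ih => exact ⟨trivial, ih _⟩

theorem Prog.exec_storeR_of_lt (a k : ℕ) (l : List ℤ) (σ : State) {j : ℕ} (hj : j < k) :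
    ((storeR a k l).exec σ).rarr a j = σ.rarr a j := by
  induction l generalizing k σ with
  | nil => rfl
  | cons z l ih =>
    rw [storeR, exec, ih _ _ (by omega)]
    simp only [exec, Function.update_self, NExp.eval]
    rw [Function.update_of_ne hj.ne]

theorem Prog.exec_storeN_of_lt (a k : ℕ) (l : List ℕ) (σ : State) {j : ℕ} (hj : j < k) :
    ((storeN a k l).exec σ).narr a j = σ.narr a j := by
  induction l generalizing k σ with
  | nil => rfl
  | cons z l ih =>
    rw [storeN, exec, ih _ _ (by omega)]
    simp only [exec, Function.update_self, NExp.eval]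
    rw [Function.update_of_ne hj.ne]

theorem Prog.exec_storeR (a k : ℕ) (l : List ℤ) (σ : State) {j : ℕ} (hj : j < l.length) :
    ((storeR a k l).exec σ).rarr a (k + j) = (l.getD j 0 : ℤ) := by
  induction l generalizing k σ j with
  | nil => simp at hj
  | cons z l ih =>
    rw [storeR, exec]
    cases j with
    | zero =>
      rw [add_zero, exec_storeR_of_lt _ _ _ _ (Nat.lt_succ_self k)]
      simp only [exec, Function.update_self, NExp.eval, RExp.eval, List.getD_cons_zero]
      have h := Int.toNat_sub_toNat_neg z
      exact_mod_cast congrArg (Int.cast : ℤ → ℝ) h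
    | succ j =>
      rw [show k + (j + 1) = k + 1 + j by ring, ih _ _ (by simpa using hj), List.getD_cons_succ]

theorem Prog.exec_storeN (a k : ℕ) (l : List ℕ) (σ : State) {j : ℕ} (hj : j < l.length) :
    ((storeN a k l).exec σ).narr a (k + j) = l.getD j 0 := by
  induction l generalizing k σ j with
  | nil => simp at hj
  | cons z l ih =>
    rw [storeN, exec]
    cases j with
    | zero =>
      rw [add_zero, exec_storeN_of_lt _ _ _ _ (Nat.lt_succ_self k)]
      simp only [exec, Function.update_self, NExp.eval, List.getD_cons_zero]
    | succ j =>
      rw [show k + (j + 1) = k + 1 + j by ring, ih _ _ (by simpa using hj), List.getD_cons_succ]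

end RealRAM

/-! ### Sums over incident edges, and the spine of a caterpillar -/

/-- The sum of the weights `w v u` over all pairs in `es`, in either order, that consist of `v` and
another vertex `u`. -/
def incidenceSum {n : ℕ} (w : Fin n → Fin n → ℕ) (es : List (Fin n × Fin n)) (v : Fin n) : ℕ :=
  (es.map fun e => (if e.1 = v then w v e.2 else 0) + (if e.2 = v then w v e.1 else 0)).sum

section

variable {n : ℕ} {w : Fin n → Fin n → ℕ}

theorem incidenceSum_append_singleton (es : List (Fin n × Fin n)) (e : Fin n × Fin n) (v : Fin n) :
    incidenceSum w (es ++ [e]) v = incidenceSum w es v +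
      ((if e.1 = v then w v e.2 else 0) + (if e.2 = v then w v e.1 else 0)) := by
  simp [incidenceSum]

theorem incidenceSum_eq_sum_count (es : List (Fin n × Fin n)) (h : ∀ e ∈ es, e.1 ≠ e.2)
    (v : Fin n) : incidenceSum w es v =
      ∑ u, (es.map fun e => s(e.1, e.2)).count s(v, u) * w v u := by
  induction es with
  | nil => simp [incidenceSum]
  | cons e es ih =>
    have ih := ih fun e he => h e (List.mem_cons_of_mem _ he)
    have hne := h e List.mem_cons_self
    have : incidenceSum w (e :: es) v = ((if e.1 = v then w v e.2 else 0) +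
        (if e.2 = v then w v e.1 else 0)) + incidenceSum w es v := by simp [incidenceSum]
    rw [this, ih]
    simp only [List.map_cons, List.count_cons, add_mul, Finset.sum_add_distrib]
    rw [add_comm]
    congr 1
    simp only [beq_iff_eq, Sym2.eq_iff, ite_mul, one_mul, zero_mul]
    by_cases h1 : e.1 = v
    · have h2 : e.2 ≠ v := fun h2 => hne (h1.trans h2.symm)
      simp [h1, h2]
    · by_cases h2 : e.2 = v
      · simp [h1, h2]
      · simp [h1, h2]

variable {G : SimpleGraph (Fin n)} {es : List (Fin n × Fin n)}

theorem IsEdgeList.adj (h : IsEdgeList G es) {e : Fin n × Fin n} (he : e ∈ es) : G.Adj e.1 e.2 := by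
  rw [← SimpleGraph.mem_edgeSet, ← h.2]
  exact List.mem_map_of_mem (f := fun e => s(e.1, e.2)) he

theorem IsEdgeList.exists_mem (h : IsEdgeList G es) {u v : Fin n} (huv : G.Adj u v) :
    (u, v) ∈ es ∨ (v, u) ∈ es := by
  rw [← SimpleGraph.mem_edgeSet, ← h.2, List.mem_map] at huv
  obtain ⟨⟨a, b⟩, he, hab⟩ := huv
  rcases Sym2.eq_iff.1 hab with ⟨h1, h2⟩ | ⟨h1, h2⟩
  · left; rw [← h1, ← h2]; exact he
  · right; rw [← h1, ← h2]; exact he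

theorem IsEdgeList.incidenceSum_eq [DecidableRel G.Adj] (h : IsEdgeList G es)
    (w : Fin n → Fin n → ℕ) (v : Fin n) :
    incidenceSum w es v = ∑ u ∈ G.neighborFinset v, w v u := by
  rw [incidenceSum_eq_sum_count es (fun e he => (h.adj he).ne)]
  have : ∀ u, (es.map fun e => s(e.1, e.2)).count s(v, u) * w v u
      = if G.Adj v u then w v u else 0 := by
    intro u
    simp only [h.1.count, h.2, SimpleGraph.mem_edgeSet, ite_mul, one_mul, zero_mul]
  rw [Finset.sum_congr rfl fun u _ => this u, ← Finset.sum_filter]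
  congr 1
  ext u; simp

theorem IsEdgeList.length_lt [DecidableRel G.Adj] (h : IsEdgeList G es) (hG : G.IsTree) :
    es.length < n := by
  classical
  have h1 := hG.card_edgeFinset
  rw [Fintype.card_fin] at h1
  have h2 : (es.map fun e => s(e.1, e.2)).toFinset = G.edgeFinset := by
    ext e; rw [List.mem_toFinset, h.2, SimpleGraph.mem_edgeFinset]
  rw [← h2, List.toFinset_card_of_nodup h.1, List.length_map] at h1
  omega

end

/-- `q 0, …, q (K - 1)` is an enumeration without repetition of the spine of `G`, i.e. of the
vertices of degree different from one, such that precisely consecutive vertices are adjacent. (The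
values `q i` with `K ≤ i` do not matter.) -/
structure IsSpine {n : ℕ} (G : SimpleGraph (Fin n)) [DecidableRel G.Adj] (K : ℕ) (q : ℕ → Fin n) :
    Prop where
  inj : ∀ i < K, ∀ j < K, q i = q j → i = j
  degree_ne : ∀ i < K, G.degree (q i) ≠ 1
  surj : ∀ v, G.degree v ≠ 1 → ∃ i < K, q i = v
  adj_iff : ∀ i < K, ∀ j < K, G.Adj (q i) (q j) ↔ i + 1 = j ∨ j + 1 = i

section

variable {n : ℕ} {G : SimpleGraph (Fin n)} [DecidableRel G.Adj]

theorem IsCaterpillar.exists_isSpine (h : IsCaterpillar G) : ∃ K q, IsSpine G K q := by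
  obtain ⟨K, ⟨φ⟩⟩ := h.backbone_path
  obtain ⟨x⟩ := h.isTree.connected.nonempty
  refine ⟨K, fun i => if hi : i < K then (φ.symm ⟨i, hi⟩ : backbone G) else x,
    fun i hi j hj hij => ?_, fun i hi => ?_, fun v hv => ?_, fun i hi j hj => ?_⟩
  · rw [dif_pos hi, dif_pos hj] at hij
    have := φ.symm.injective (Subtype.ext hij)
    simpa using this
  · rw [dif_pos hi]
    exact (φ.symm ⟨i, hi⟩).2
  · refine ⟨φ ⟨v, hv⟩, (φ ⟨v, hv⟩).2, ?_⟩
    rw [dif_pos (φ ⟨v, hv⟩).2, Fin.eta, φ.symm_apply_apply]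
  · rw [dif_pos hi, dif_pos hj]
    have := φ.symm.map_adj_iff (v := ⟨i, hi⟩) (w := ⟨j, hj⟩)
    rw [SimpleGraph.pathGraph_adj] at this
    simpa using this

theorem IsSpine.reverse {K : ℕ} {q : ℕ → Fin n} (h : IsSpine G K q) :
    IsSpine G K fun i => q (K - 1 - i) := by
  refine ⟨fun i hi j hj hij => ?_, fun i hi => h.degree_ne _ (by omega), fun v hv => ?_,
    fun i hi j hj => ?_⟩
  · have := h.inj _ (by omega) _ (by omega) hij
    omega
  · obtain ⟨i, hi, rfl⟩ := h.surj v hv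
    exact ⟨K - 1 - i, by omega, by congr 1; omega⟩
  · rw [h.adj_iff _ (by omega) _ (by omega)]
    omega

/-- Summation over the neighbours on the spine, which are the preceding and the following vertex.
-/
theorem IsSpine.sum_neighbors {K : ℕ} {q : ℕ → Fin n} (h : IsSpine G K q) (w : Fin n → ℕ) {i : ℕ}
    (hi : i < K) : ∑ u ∈ G.neighborFinset (q i), (if G.degree u ≠ 1 then w u else 0)
      = (if 0 < i then w (q (i - 1)) else 0) + (if i + 1 < K then w (q (i + 1)) else 0) := by
  have e : (G.neighborFinset (q i)).filter (fun u => G.degree u ≠ 1)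
      = (if 0 < i then {q (i - 1)} else ∅) ∪ (if i + 1 < K then {q (i + 1)} else ∅) := by
    ext u
    rw [Finset.mem_filter, SimpleGraph.mem_neighborFinset, Finset.mem_union]
    constructor
    · rintro ⟨h1, h2⟩
      obtain ⟨j, hj, rfl⟩ := h.surj u h2
      rw [h.adj_iff _ hi _ hj] at h1
      rcases h1 with rfl | rfl
      · right; simp [hj]
      · left; simp
    · rintro (h1 | h1)
      · split_ifs at h1 with h0
        · rw [Finset.mem_singleton] at h1
          subst h1
          exact ⟨(h.adj_iff _ hi _ (by omega)).2 (by omega), h.degree_ne _ (by omega)⟩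
        · simp at h1
      · split_ifs at h1 with h0
        · rw [Finset.mem_singleton] at h1
          subst h1
          exact ⟨(h.adj_iff _ hi _ (by omega)).2 (by omega), h.degree_ne _ (by omega)⟩
        · simp at h1
  rw [← Finset.sum_filter, e, Finset.sum_union]
  · congr 1
    · split_ifs <;> simp
    · split_ifs <;> simp
  · split_ifs with h1 h2
    · rw [Finset.disjoint_singleton]
      intro he
      have := h.inj _ (by omega) _ h2 he
      omega
    all_goals simp

theorem IsSpine.card_eq {K : ℕ} {q : ℕ → Fin n} (h : IsSpine G K q) :
    (Finset.univ.filter fun v => G.degree v ≠ 1).card = K := by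
  have : (Finset.univ.filter fun v => G.degree v ≠ 1) = (Finset.range K).image q := by
    ext v
    simp only [Finset.mem_filter, Finset.mem_univ, true_and, Finset.mem_image, Finset.mem_range]
    exact ⟨h.surj v, by rintro ⟨i, hi, rfl⟩; exact h.degree_ne i hi⟩
  rw [this, Finset.card_image_of_injOn, Finset.card_range]
  intro i hi j hj hij
  exact h.inj i (by simpa using hi) j (by simpa using hj) hij

theorem degree_ne_one_of_adj_leaf (hG : G.Connected) (hn : n ≠ 2) {l b : Fin n}
    (hlb : G.Adj l b) (hl : G.degree l = 1) : G.degree b ≠ 1 := by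
  intro hb
  have ul : ∀ x, G.Adj l x → x = b := by
    intro x hx
    rw [← SimpleGraph.card_neighborFinset_eq_degree] at hl
    exact Finset.card_le_one.1 hl.le x (by simpa using hx) b (by simpa using hlb)
  have ub : ∀ x, G.Adj b x → x = l := by
    intro x hx
    rw [← SimpleGraph.card_neighborFinset_eq_degree] at hb
    exact Finset.card_le_one.1 hb.le x (by simpa using hx) l (by simpa using hlb.symm)
  have all : ∀ x, x = l ∨ x = b := by
    intro x
    have := (SimpleGraph.reachable_iff_reflTransGen l x).1 (hG.preconnected l x)
    induction this with
    | refl => exact Or.inl rfl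
    | tail _ h ih =>
      rcases ih with rfl | rfl
      · exact Or.inr (ul _ h)
      · exact Or.inl (ub _ h)
  have : (Finset.univ : Finset (Fin n)) = {l, b} := by
    ext x; simpa using all x
  have := congrArg Finset.card this
  rw [Finset.card_univ, Fintype.card_fin, Finset.card_pair hlb.ne] at this
  exact hn this

theorem exists_degree_ne_one (hG : G.Connected) (hn : n ≠ 2) : ∃ v, G.degree v ≠ 1 := by
  obtain ⟨x⟩ := hG.nonempty
  by_cases hx : G.degree x = 1
  · have : (G.neighborFinset x).Nonempty := by
      rw [← Finset.card_pos, SimpleGraph.card_neighborFinset_eq_degree, hx]; norm_num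
    obtain ⟨b, hb⟩ := this
    exact ⟨b, degree_ne_one_of_adj_leaf hG hn ((G.mem_neighborFinset x b).1 hb) hx⟩
  · exact ⟨x, hx⟩

theorem IsSpine.pos {K : ℕ} {q : ℕ → Fin n} (h : IsSpine G K q) (hG : G.Connected) (hn : n ≠ 2) :
    0 < K := by
  obtain ⟨v, hv⟩ := exists_degree_ne_one hG hn
  obtain ⟨i, hi, -⟩ := h.surj v hv
  omega

end

/-! ### From labellings to representations -/

namespace CaterpillarLayout

/-- The place `(i', j)` in the layout of a vertex with label `(i, s)`, on a spine with vertices `1,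
…, K`: it is the `j`-th leaf of the `i'`-th spine vertex, or this spine vertex itself if `j = 0`.
Spine vertices have `s = 0`, and the leaves of the `i`-th one have the ranks `s = 1, 2, …`. The
first leaf of an end of the spine takes the place of the dummy spine vertex `0` or `K + 1` next to
it; if `K = 1`, this applies to the first two leaves. -/
def place (K i s : ℕ) : ℕ × ℕ :=
  if s = 0 then (i, 0)
  else if s ≤ (if i = 1 then 1 else 0) then (0, 0)
  else if s ≤ (if i = 1 then 1 else 0) + (if i = K then 1 else 0) then (K + 1, 0)
  else (i, s - ((if i = 1 then 1 else 0) + (if i = K then 1 else 0)))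

/-- The point of the plane at a place of the layout. -/
noncomputable def point (f : ℕ → ℕ) (ij : ℕ × ℕ) : Plane :=
  !₂[(posX f ij.1 ij.2 : ℝ) / 1000, (posY f ij.1 ij.2 : ℝ) / 1000]

theorem dist_point_sq (f : ℕ → ℕ) (i j i' j' : ℕ) :
    dist (point f (i, j)) (point f (i', j')) ^ 2 = (sqDist f i j i' j' : ℝ) / 1000000 := by
  rw [EuclideanSpace.dist_eq, Real.sq_sqrt (by positivity), Fin.sum_univ_two, sqDist]
  simp only [point, Real.dist_eq, sq_abs]
  push_cast
  ring

/-- A labelling of the vertices of a caterpillar by pairs `(i v, s v)` with `1 ≤ i v ≤ K`: the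
spine vertices carry the labels `(i, 0)`, in their order on the spine, and the leaves of the `i`-th
one carry labels `(i, s)` with `s ≠ 0`. The ranks `s v` are small enough for all leaves to find
places, where `f` marks the spine vertices of degree five. -/
structure IsLabelling {V : Type*} (G : SimpleGraph V) (K : ℕ) (f : ℕ → ℕ) (i s : V → ℕ) : Prop where
  one_le : ∀ v, 1 ≤ i v
  le : ∀ v, i v ≤ K
  inj : ∀ u v, i u = i v → s u = s v → u = v
  adj_iff : ∀ u v, u ≠ v → (G.Adj u v ↔ (s u = 0 ∧ s v = 0 ∧ (i u + 1 = i v ∨ i v + 1 = i u)) ∨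
    (i u = i v ∧ (s u = 0 ∨ s v = 0)))
  le_slots : ∀ v, s v ≤ (if i v = 1 then 1 else 0) + (if i v = K then 1 else 0) + (2 + f (i v))

variable {V : Type*} {G : SimpleGraph V} {K : ℕ} {f : ℕ → ℕ} {i s : V → ℕ}

theorem IsLabelling.place_inj (h : IsLabelling G K f i s) {u v : V}
    (he : place K (i u) (s u) = place K (i v) (s v)) : u = v := by
  have h1 := h.one_le u
  have h2 := h.one_le v
  have h3 := h.le u
  have h4 := h.le v
  have key : i u = i v ∧ s u = s v := by
    unfold place at he
    split_ifs at he <;> simp only [Prod.mk.injEq] at he <;> omega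
  exact h.inj u v key.1 key.2

theorem IsLabelling.place_le_slots (h : IsLabelling G K f i s) (hf : IsFlags f) (v : V) :
    (place K (i v) (s v)).2 ≤ slots (state f (place K (i v) (s v)).1) := by
  have h1 := h.le_slots v
  have h2 := hf.lt_two (i v)
  have h3 := (state_spec hf (i v)).2.2
  have h4 := (slots_le (state f (i v))).1
  unfold place
  split_ifs at h1 ⊢ <;> simp only <;> omega

theorem place_cases (K i s : ℕ) :
    (s = 0 ∧ (place K i s).1 = i ∧ (place K i s).2 = 0) ∨
    (0 < s ∧ i = 1 ∧ (place K i s).1 = 0 ∧ (place K i s).2 = 0) ∨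
    (0 < s ∧ i = K ∧ (place K i s).1 = K + 1 ∧ (place K i s).2 = 0) ∨
    (0 < s ∧ (place K i s).1 = i ∧ 0 < (place K i s).2) := by
  unfold place
  generalize hp : (if i = 1 then 1 else 0 : ℕ) = p
  generalize hl : (if i = K then 1 else 0 : ℕ) = l
  have hp' : 0 < p → i = 1 := by split_ifs at hp <;> omega
  have hl' : 0 < l → i = K := by split_ifs at hl <;> omega
  split_ifs with h1 h2 h3
  · exact Or.inl ⟨h1, rfl, rfl⟩
  · exact Or.inr (Or.inl ⟨by omega, by omega, rfl, rfl⟩)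
  · exact Or.inr (Or.inr (Or.inl ⟨by omega, by omega, rfl, rfl⟩))
  · exact Or.inr (Or.inr (Or.inr ⟨by omega, rfl, Nat.sub_pos_of_lt (by omega)⟩))

theorem IsLabelling.adj_iff_place (h : IsLabelling G K f i s) {u v : V} (hne : u ≠ v)
    (hle : (place K (i u) (s u)).1 ≤ (place K (i v) (s v)).1)
    (hlt : (place K (i u) (s u)).1 = (place K (i v) (s v)).1 →
      (place K (i u) (s u)).2 < (place K (i v) (s v)).2) :
    G.Adj u v ↔
      ((place K (i u) (s u)).1 = (place K (i v) (s v)).1 ∧ (place K (i u) (s u)).2 = 0) ∨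
      ((place K (i u) (s u)).1 + 1 = (place K (i v) (s v)).1 ∧ (place K (i u) (s u)).2 = 0 ∧
        (place K (i v) (s v)).2 = 0) := by
  have h1 := h.one_le u
  have h2 := h.one_le v
  have h3 := h.le u
  have h4 := h.le v
  rw [h.adj_iff u v hne]
  have c1 := place_cases K (i u) (s u)
  have c2 := place_cases K (i v) (s v)
  generalize place K (i u) (s u) = p at hle hlt c1 ⊢
  generalize place K (i v) (s v) = p' at hle hlt c2 ⊢
  rcases c1 with c1 | c1 | c1 | c1 <;> rcases c2 with c2 | c2 | c2 | c2 <;> omega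

theorem IsLabelling.isUDR (h : IsLabelling G K f i s) (hf : IsFlags f) :
    IsUDR G fun v => point f (place K (i v) (s v)) := by
  have key : ∀ u v, u ≠ v → (place K (i u) (s u)).1 ≤ (place K (i v) (s v)).1 →
      ((place K (i u) (s u)).1 = (place K (i v) (s v)).1 →
      (place K (i u) (s u)).2 < (place K (i v) (s v)).2) →
      0 < dist (point f (place K (i u) (s u))) (point f (place K (i v) (s v))) ∧
      (G.Adj u v ↔ dist (point f (place K (i u) (s u))) (point f (place K (i v) (s v))) ≤ 2) := by
    intro u v hne hle hlt
    obtain ⟨h1, h2⟩ := sqDist_spec hf hle hlt (h.place_le_slots hf u) (h.place_le_slots hf v)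
    rw [← h.adj_iff_place hne hle hlt] at h2
    have hd := dist_point_sq f (place K (i u) (s u)).1 (place K (i u) (s u)).2
      (place K (i v) (s v)).1 (place K (i v) (s v)).2
    have h1' : (0 : ℝ) < sqDist f (place K (i u) (s u)).1 (place K (i u) (s u)).2
      (place K (i v) (s v)).1 (place K (i v) (s v)).2 := by exact_mod_cast h1
    have d0 : 0 ≤ dist (point f (place K (i u) (s u))) (point f (place K (i v) (s v))) :=
      dist_nonneg
    refine ⟨lt_of_le_of_ne d0 fun h0 => ?_, ?_⟩
    · rw [Prod.mk.eta, Prod.mk.eta, ← h0] at hd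
      linarith
    · rw [← h2, ← Int.cast_le (R := ℝ)]
      rw [Prod.mk.eta, Prod.mk.eta] at hd
      push_cast
      constructor
      · intro h; nlinarith
      · intro h; nlinarith
  have key' : ∀ u v, u ≠ v →
      0 < dist (point f (place K (i u) (s u))) (point f (place K (i v) (s v))) ∧
      (G.Adj u v ↔ dist (point f (place K (i u) (s u))) (point f (place K (i v) (s v))) ≤ 2) := by
    intro u v hne
    have hp : place K (i u) (s u) ≠ place K (i v) (s v) := fun he => hne (h.place_inj he)
    rw [Ne, Prod.ext_iff] at hp
    by_cases hc : (place K (i u) (s u)).1 < (place K (i v) (s v)).1 ∨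
        ((place K (i u) (s u)).1 = (place K (i v) (s v)).1 ∧
          (place K (i u) (s u)).2 < (place K (i v) (s v)).2)
    · exact key u v hne (by omega) (by omega)
    · have := key v u hne.symm (by omega) (by omega)
      rwa [dist_comm, G.adj_comm] at this
  refine ⟨fun u v huv => ?_, fun u v hne => ?_⟩
  · by_contra hne
    have h1 := (key' u v hne).1
    rw [unitDisk_injective huv, dist_self] at h1
    exact lt_irrefl _ h1
  · rw [(key' u v hne).2, unitDisk_inter_nonempty_iff]

end CaterpillarLayout

/-! ### Degrees, spine neighbours and leaves -/

namespace RealRAM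

/-- `σ` holds the list `es` of edges of a graph with `n` vertices, like the initial
configuration. -/
structure HoldsInput (n : ℕ) (es : List (Fin n × Fin n)) (σ : State) : Prop where
  size : σ.nreg 0 = n
  length : σ.nreg 1 = es.length
  fst : ∀ i (hi : i < es.length), σ.narr 0 i = es[i].1
  snd : ∀ i (hi : i < es.length), σ.narr 1 i = es[i].2

theorem holdsInput_initial (n : ℕ) (es : List (Fin n × Fin n)) :
    HoldsInput n es (initial n es) where
  size := rfl
  length := rfl
  fst i hi := by simp [initial, hi]
  snd i hi := by simp [initial, hi]

theorem HoldsInput.of_unchanged {n : ℕ} {es : List (Fin n × Fin n)} {σ τ : State} {p : Prog}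
    (h : HoldsInput n es σ) (hu : Unchanged p σ τ)
    (hp : 0 ∉ p.nregs ∧ 1 ∉ p.nregs ∧ 0 ∉ p.narrs ∧ 1 ∉ p.narrs) : HoldsInput n es τ where
  size := by rw [hu.nreg 0 hp.1, h.size]
  length := by rw [hu.nreg 1 hp.2.1, h.length]
  fst i hi := by rw [hu.narr 0 hp.2.2.1, h.fst i hi]
  snd i hi := by rw [hu.narr 1 hp.2.2.2, h.snd i hi]

theorem take_succ_eq {α : Type*} {l : List α} {i : ℕ} (hi : i < l.length) :
    l.take (i + 1) = l.take i ++ [l[i]] := by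
  rw [List.take_concat_get']

/-- The first end of the current edge, while register `2` runs through the edges. -/
def NExp.fstEnd : NExp := .cell 0 (.reg 2)

/-- The second end of the current edge, while register `2` runs through the edges. -/
def NExp.sndEnd : NExp := .cell 1 (.reg 2)

/-- Adds one to the degrees, in array `2`, of the ends of the current edge. -/
def degreeBody : Prog := .seq (.addTo 2 .fstEnd (.const 1)) (.addTo 2 .sndEnd (.const 1))

/-- Computes the degrees in array `2`. -/
def degreeLoop : Prog := .forTo 2 (.reg 1) degreeBody

theorem degreeLoop_spec : ∃ C, ∀ {n : ℕ} {es : List (Fin n × Fin n)} {σ : State},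
    HoldsInput n es σ → (∀ v : Fin n, σ.narr 2 v = 0) →
    ∃ t τ, Runs degreeLoop σ t τ ∧ t ≤ C * (es.length + 1) ∧
      ∀ v : Fin n, τ.narr 2 v = incidenceSum (fun _ _ => 1) es v := by
  refine ⟨Prog.loopFactor (.reg 1) degreeBody, fun {n es σ} h hd => ?_⟩
  obtain ⟨t, τ, h1, h2, h3⟩ := runs_forTo (r := 2) (b := .reg 1)
    (p := degreeBody) ⟨trivial, trivial⟩ (by decide)
    (fun i τ => ∀ v : Fin n, τ.narr 2 v = incidenceSum (fun _ _ => 1) (es.take i) v)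
    es.length σ
    (fun τ hu => (h.of_unchanged hu (by decide)).length)
    (fun v => by simpa [incidenceSum] using hd v)
    (fun i hi τ hu hri hI v => by
      have hin := h.of_unchanged hu (by decide)
      have e1 := hin.fst i hi
      have e2 := hin.snd i hi
      rw [take_succ_eq hi, incidenceSum_append_singleton, ← hI v]
      simp [degreeBody, Prog.exec, Prog.addTo, NExp.eval, NExp.fstEnd, NExp.sndEnd, hri, e1, e2,
        Function.update_apply, Fin.val_inj]
      grind)
  exact ⟨t, τ, h1, h2, by simpa using h3⟩

/-- If both ends of the current edge lie on the spine, their numbers are added to each other's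
cells in array `3`, and the numbers of their spine neighbours, in array `4`, are increased. -/
def spineBody : Prog :=
  .ite (.and (.not (.neq (.cell 2 .fstEnd) (.const 1))) (.not (.neq (.cell 2 .sndEnd) (.const 1))))
    (.seq (.addTo 3 .fstEnd .sndEnd) (.seq (.addTo 3 .sndEnd .fstEnd)
      (.seq (.addTo 4 .fstEnd (.const 1)) (.addTo 4 .sndEnd (.const 1)))))
    .skip

/-- Computes the sum of the neighbours on the spine in array `3` and their number in array `4`, for
every vertex of the spine. -/
def spineLoop : Prog := .forTo 2 (.reg 1) spineBody

theorem spineLoop_spec : ∃ C, ∀ {n : ℕ} {es : List (Fin n × Fin n)} {σ : State} {d : Fin n → ℕ},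
    HoldsInput n es σ → (∀ v : Fin n, σ.narr 2 v = d v) → (∀ v : Fin n, σ.narr 3 v = 0) →
    (∀ v : Fin n, σ.narr 4 v = 0) →
    ∃ t τ, Runs spineLoop σ t τ ∧ t ≤ C * (es.length + 1) ∧
      (∀ v : Fin n, τ.narr 3 v =
        incidenceSum (fun v u => if d v ≠ 1 ∧ d u ≠ 1 then (u : ℕ) else 0) es v) ∧
      ∀ v : Fin n, τ.narr 4 v = incidenceSum (fun v u => if d v ≠ 1 ∧ d u ≠ 1 then 1 else 0) es v
      := by
  refine ⟨Prog.loopFactor (.reg 1) spineBody, fun {n es σ d} h hd h3 h4 => ?_⟩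
  obtain ⟨t, τ, r1, r2, r3⟩ := runs_forTo (r := 2) (b := .reg 1)
    (p := spineBody) ⟨⟨trivial, trivial, trivial, trivial⟩, trivial⟩ (by decide)
    (fun i τ => (∀ v : Fin n, τ.narr 3 v = incidenceSum
        (fun v u => if d v ≠ 1 ∧ d u ≠ 1 then (u : ℕ) else 0) (es.take i) v) ∧
      ∀ v : Fin n, τ.narr 4 v = incidenceSum
        (fun v u => if d v ≠ 1 ∧ d u ≠ 1 then 1 else 0) (es.take i) v)
    es.length σ
    (fun τ hu => (h.of_unchanged hu (by decide)).length)
    ⟨fun v => by simpa [incidenceSum] using h3 v, fun v => by simpa [incidenceSum] using h4 v⟩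
    (fun i hi τ hu hri hI => by
      have hin := h.of_unchanged hu (by decide)
      have e1 := hin.fst i hi
      have e2 := hin.snd i hi
      have d1 : ∀ v : Fin n, τ.narr 2 v = d v := fun v => by rw [hu.narr 2 (by decide), hd]
      obtain ⟨I1, I2⟩ := hI
      by_cases hc : d es[i].1 ≠ 1 ∧ d es[i].2 ≠ 1
      · refine ⟨fun v => ?_, fun v => ?_⟩
        · rw [take_succ_eq hi, incidenceSum_append_singleton, ← I1 v]
          simp [spineBody, Prog.exec, Prog.addTo, NExp.eval, NExp.fstEnd, NExp.sndEnd, hri, e1, e2,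
            Function.update_apply, Fin.val_inj, Cond.holds, d1, hc.1, hc.2]
          grind
        · rw [take_succ_eq hi, incidenceSum_append_singleton, ← I2 v]
          simp [spineBody, Prog.exec, Prog.addTo, NExp.eval, NExp.fstEnd, NExp.sndEnd, hri, e1, e2,
            Function.update_apply, Fin.val_inj, Cond.holds, d1, hc.1, hc.2]
          grind
      · have hno : ¬ (Cond.and (.not (.neq (.cell 2 .fstEnd) (.const 1)))
            (.not (.neq (.cell 2 .sndEnd) (.const 1)))).holds τ := by
          simpa [Cond.holds, NExp.eval, NExp.fstEnd, NExp.sndEnd, hri, e1, e2, d1] using hc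
        rw [spineBody, Prog.exec, if_neg hno]
        refine ⟨fun v => ?_, fun v => ?_⟩
        · rw [take_succ_eq hi, incidenceSum_append_singleton, ← I1 v]
          simp only [Prog.exec]
          grind
        · rw [take_succ_eq hi, incidenceSum_append_singleton, ← I2 v]
          simp only [Prog.exec]
          grind)
  exact ⟨t, τ, r1, r2, by simpa using r3⟩

/-- An invariant of the attachment of leaves to spine vertices: the leaves treated so far are those
with nonzero rank `s v`, each of them has recorded its neighbour `b v`, and the leaves at `u` have
distinct ranks up to `c u`. -/
structure LeafInv {n : ℕ} (G : SimpleGraph (Fin n)) [DecidableRel G.Adj] (c s b : ℕ → ℕ) :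
    Prop where
  spec : ∀ v : Fin n, s v ≠ 0 → G.degree v = 1 ∧ ∃ u : Fin n, G.Adj v u ∧ b v = u ∧ s v ≤ c u
  inj : ∀ v v' : Fin n, s v ≠ 0 → s v = s v' → b v = b v' → v = v'

theorem LeafInv.step {n : ℕ} {G : SimpleGraph (Fin n)} [DecidableRel G.Adj] {c s b : ℕ → ℕ}
    (h : LeafInv G c s b) {l u : Fin n} (hl : G.degree l = 1) (hlu : G.Adj l u) :
    LeafInv G (Function.update c u (c u + 1)) (Function.update s l (c u + 1))
      (Function.update b l u) := by
  have old : ∀ v : Fin n, s v ≠ 0 → b v = u → s v < c u + 1 := by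
    intro v hv hb
    obtain ⟨-, u', -, h2, h3⟩ := h.spec v hv
    rw [hb] at h2
    have := Fin.ext h2
    subst this
    omega
  refine ⟨fun v hv => ?_, fun v v' hv hvv' hb => ?_⟩
  · by_cases hvl : v = l
    · subst hvl
      exact ⟨hl, u, hlu, by simp, by simp⟩
    · have hvl' : (v : ℕ) ≠ l := fun h => hvl (Fin.ext h)
      rw [Function.update_of_ne hvl'] at hv ⊢
      rw [Function.update_of_ne hvl']
      obtain ⟨h1, u', h2, h3, h4⟩ := h.spec v hv
      refine ⟨h1, u', h2, h3, h4.trans ?_⟩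
      rw [Function.update_apply]
      split_ifs with he
      · rw [he]; omega
      · exact le_rfl
  · by_cases hvl : v = l <;> by_cases hvl' : v' = l
    · rw [hvl, hvl']
    · have hne : (v' : ℕ) ≠ l := fun h => hvl' (Fin.ext h)
      subst hvl
      simp only [Function.update_self, Function.update_of_ne hne] at hvv' hb
      have := old v' (by omega) hb.symm
      omega
    · have hne : (v : ℕ) ≠ l := fun h => hvl (Fin.ext h)
      subst hvl'
      simp only [Function.update_self, Function.update_of_ne hne] at hvv' hb hv
      have := old v hv hb
      omega
    · have hne : (v : ℕ) ≠ l := fun h => hvl (Fin.ext h)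
      have hne' : (v' : ℕ) ≠ l := fun h => hvl' (Fin.ext h)
      simp only [Function.update_of_ne hne, Function.update_of_ne hne'] at hvv' hb hv
      exact h.inj v v' hv hvv' hb

/-- Attaches the leaf `l` to the spine vertex `u`: array `7` counts the leaves of the spine
vertices, array `6` holds the rank of a leaf, and array `11` holds the spine vertex that it is
attached to. -/
def leafStep (l u : NExp) : Prog :=
  .seq (.addTo 7 u (.const 1)) (.seq (.setNCell 6 l (.cell 7 u)) (.setNCell 11 l u))

/-- Attaches the leaf of the current edge, if there is one, to the other end. -/
def leafBody : Prog :=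
  .ite (.neq (.cell 2 .fstEnd) (.const 1)) (leafStep .fstEnd .sndEnd)
    (.ite (.neq (.cell 2 .sndEnd) (.const 1)) (leafStep .sndEnd .fstEnd) .skip)

/-- Attaches the leaves to the spine. -/
def leafLoop : Prog := .forTo 2 (.reg 1) leafBody

theorem leafLoop_spec : ∃ C, ∀ {n : ℕ} {G : SimpleGraph (Fin n)} [DecidableRel G.Adj]
    {es : List (Fin n × Fin n)} {σ : State}, IsEdgeList G es →
    (∀ u v, G.Adj u v → G.degree u = 1 → G.degree v ≠ 1) →
    HoldsInput n es σ → (∀ v : Fin n, σ.narr 2 v = G.degree v) →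
    (∀ v : Fin n, σ.narr 6 v = 0) → (∀ v : Fin n, σ.narr 7 v = 0) →
    ∃ t τ, Runs leafLoop σ t τ ∧ t ≤ C * (es.length + 1) ∧
      LeafInv G (τ.narr 7) (τ.narr 6) (τ.narr 11) ∧
      (∀ v : Fin n, τ.narr 7 v =
        incidenceSum (fun _ u => if G.degree u = 1 then 1 else 0) es v) ∧
      ∀ v : Fin n, G.degree v = 1 → τ.narr 6 v ≠ 0 := by
  refine ⟨Prog.loopFactor (.reg 1) leafBody, fun {n G _ es σ} hes hG h hd h6 h7 => ?_⟩
  obtain ⟨t, τ, r1, r2, r3, r4, r5⟩ := runs_forTo (r := 2) (b := .reg 1) (p := leafBody)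
    ⟨⟨trivial, trivial, trivial⟩, ⟨trivial, trivial, trivial⟩, trivial⟩ (by decide)
    (fun i τ => LeafInv G (τ.narr 7) (τ.narr 6) (τ.narr 11) ∧
      (∀ v : Fin n, τ.narr 7 v =
        incidenceSum (fun _ u => if G.degree u = 1 then 1 else 0) (es.take i) v) ∧
      ∀ e ∈ es.take i, (G.degree e.1 = 1 → τ.narr 6 e.1 ≠ 0) ∧
        (G.degree e.2 = 1 → τ.narr 6 e.2 ≠ 0))
    es.length σ
    (fun τ hu => (h.of_unchanged hu (by decide)).length)
    ⟨⟨fun v hv => absurd (h6 v) hv, fun v _ hv => absurd (h6 v) hv⟩,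
      fun v => by simpa [incidenceSum] using h7 v, by simp⟩
    (fun i hi τ hu hri hI => by
      have hin := h.of_unchanged hu (by decide)
      have e1 := hin.fst i hi
      have e2 := hin.snd i hi
      have d1 : ∀ v : Fin n, τ.narr 2 v = G.degree v := fun v => by
        rw [hu.narr 2 (by decide), hd]
      obtain ⟨I1, I2, I3⟩ := hI
      have hadj := hes.adj (List.getElem_mem hi)
      have hne := hadj.ne
      by_cases c1 : G.degree es[i].1 = 1
      · have c2 := hG _ _ hadj c1
        have hyes : (Cond.neq (.cell 2 .fstEnd) (.const 1)).holds τ := by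
          simpa [Cond.holds, NExp.eval, NExp.fstEnd, hri, e1, d1] using c1
        have hex : (leafBody.exec τ).narr 7
            = Function.update (τ.narr 7) es[i].2 (τ.narr 7 es[i].2 + 1) ∧
            (leafBody.exec τ).narr 6
            = Function.update (τ.narr 6) es[i].1 (τ.narr 7 es[i].2 + 1) ∧
            (leafBody.exec τ).narr 11 = Function.update (τ.narr 11) es[i].1 es[i].2 := by
          rw [leafBody, Prog.exec, if_pos hyes]
          simp [leafStep, Prog.exec, Prog.addTo, NExp.eval, NExp.fstEnd, NExp.sndEnd, hri, e1, e2]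
        simp only [hex]
        refine ⟨I1.step c1 hadj, fun v => ?_, ?_⟩
        · rw [take_succ_eq hi, incidenceSum_append_singleton, ← I2 v, Function.update_apply]
          simp only [Fin.val_inj, c1, c2]
          grind
        · rw [take_succ_eq hi]
          intro e he
          rw [List.mem_append, List.mem_singleton] at he
          simp only [Function.update_apply, Fin.val_inj]
          rcases he with he | rfl
          · have := I3 e he
            grind
          · simp [c2]
      · have hno : ¬ (Cond.neq (.cell 2 .fstEnd) (.const 1)).holds τ := by
          simpa [Cond.holds, NExp.eval, NExp.fstEnd, hri, e1, d1] using c1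
        by_cases c2 : G.degree es[i].2 = 1
        · have hyes : (Cond.neq (.cell 2 .sndEnd) (.const 1)).holds τ := by
            simpa [Cond.holds, NExp.eval, NExp.sndEnd, hri, e2, d1] using c2
          have hex : (leafBody.exec τ).narr 7
              = Function.update (τ.narr 7) es[i].1 (τ.narr 7 es[i].1 + 1) ∧
              (leafBody.exec τ).narr 6
              = Function.update (τ.narr 6) es[i].2 (τ.narr 7 es[i].1 + 1) ∧
              (leafBody.exec τ).narr 11 = Function.update (τ.narr 11) es[i].2 es[i].1 := by
            rw [leafBody, Prog.exec, if_neg hno, Prog.exec, if_pos hyes]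
            simp [leafStep, Prog.exec, Prog.addTo, NExp.eval, NExp.fstEnd, NExp.sndEnd, hri, e1, e2]
          simp only [hex]
          refine ⟨I1.step c2 hadj.symm, fun v => ?_, ?_⟩
          · rw [take_succ_eq hi, incidenceSum_append_singleton, ← I2 v, Function.update_apply]
            simp only [Fin.val_inj, c1, c2]
            grind
          · rw [take_succ_eq hi]
            intro e he
            rw [List.mem_append, List.mem_singleton] at he
            simp only [Function.update_apply, Fin.val_inj]
            rcases he with he | rfl
            · have := I3 e he
              grind
            · simp [c1]
        · have hno2 : ¬ (Cond.neq (.cell 2 .sndEnd) (.const 1)).holds τ := by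
            simpa [Cond.holds, NExp.eval, NExp.sndEnd, hri, e2, d1] using c2
          have hex : leafBody.exec τ = τ := by
            rw [leafBody, Prog.exec, if_neg hno, Prog.exec, if_neg hno2, Prog.exec]
          rw [hex]
          refine ⟨I1, fun v => ?_, ?_⟩
          · rw [take_succ_eq hi, incidenceSum_append_singleton]
            simpa [c1, c2] using I2 v
          · rw [take_succ_eq hi]
            intro e he
            rw [List.mem_append, List.mem_singleton] at he
            rcases he with he | rfl
            · exact I3 e he
            · exact ⟨fun h => absurd h c1, fun h => absurd h c2⟩)
  refine ⟨t, τ, r1, r2, r3, by simpa using r4, fun v hv => ?_⟩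
  rw [List.take_length] at r5
  have : (G.neighborFinset v).Nonempty := by
    rw [← Finset.card_pos, SimpleGraph.card_neighborFinset_eq_degree, hv]; norm_num
  obtain ⟨u, hu⟩ := this
  rcases hes.exists_mem ((G.mem_neighborFinset v u).1 hu) with he | he
  · exact (r5 _ he).1 hv
  · exact (r5 _ he).2 hv

end RealRAM

/-! ### Walking along the spine, and storing the tables -/

namespace RealRAM

/-- If the current vertex lies on the spine, it is counted in register `5`, and register `6` is
set to it if it has at most one neighbour on the spine. -/
def startBody : Prog :=
  .ite (.neq (.cell 2 (.reg 2)) (.const 1)) .skip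
    (.seq (.setNCell 11 (.reg 2) (.reg 2)) (.seq (.setNReg 5 (.add (.reg 5) (.const 1)))
      (.ite (.nlt (.cell 4 (.reg 2)) (.const 2)) (.setNReg 6 (.reg 2)) .skip)))

/-- Computes the number of vertices of the spine and finds one of its ends. -/
def startLoop : Prog := .forTo 2 (.reg 0) startBody

theorem card_filter_val_lt_succ {n : ℕ} (P : Fin n → Prop) [DecidablePred P] {i : ℕ} (hi : i < n) :
    (Finset.univ.filter fun v : Fin n => (v : ℕ) < i + 1 ∧ P v).card
      = (Finset.univ.filter fun v : Fin n => (v : ℕ) < i ∧ P v).card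
        + if P ⟨i, hi⟩ then 1 else 0 := by
  split_ifs with hP
  · rw [← Finset.card_insert_of_notMem (a := (⟨i, hi⟩ : Fin n)) (by simp)]
    congr 1
    ext v
    simp only [Finset.mem_filter, Finset.mem_univ, true_and, Finset.mem_insert, Fin.ext_iff]
    constructor
    · rintro ⟨h1, h2⟩
      by_cases h : (v : ℕ) = i
      · exact Or.inl h
      · exact Or.inr ⟨by omega, h2⟩
    · rintro (h | ⟨h1, h2⟩)
      · have : v = ⟨i, hi⟩ := Fin.ext h
        subst this
        exact ⟨by simp, hP⟩
      · exact ⟨by omega, h2⟩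
  · rw [add_zero]
    congr 1
    ext v
    simp only [Finset.mem_filter, Finset.mem_univ, true_and]
    constructor
    · rintro ⟨h1, h2⟩
      refine ⟨?_, h2⟩
      by_contra hlt
      have : v = ⟨i, hi⟩ := Fin.ext (by simp only; omega)
      subst this
      exact hP h2
    · rintro ⟨h1, h2⟩
      exact ⟨by omega, h2⟩

theorem startLoop_spec : ∃ C, ∀ {n : ℕ} {σ : State} {d : Fin n → ℕ},
    σ.nreg 0 = n → (∀ v : Fin n, σ.narr 2 v = d v) → σ.nreg 5 = 0 →
    ∃ t τ, Runs startLoop σ t τ ∧ t ≤ C * (n + 1) ∧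
      τ.nreg 5 = (Finset.univ.filter fun v : Fin n => d v ≠ 1).card ∧
      (∀ v : Fin n, τ.narr 11 v = if d v = 1 then σ.narr 11 v else (v : ℕ)) ∧
      ((∃ v : Fin n, d v ≠ 1 ∧ σ.narr 4 v < 2) →
        ∃ v : Fin n, τ.nreg 6 = v ∧ d v ≠ 1 ∧ σ.narr 4 v < 2) := by
  refine ⟨Prog.loopFactor (.reg 0) startBody, fun {n σ d} h0 hd h5 => ?_⟩
  obtain ⟨t, τ, r1, r2, r3, r4, r5⟩ := runs_forTo (r := 2) (b := .reg 0) (p := startBody)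
    ⟨trivial, trivial, trivial, trivial, trivial⟩ (by decide)
    (fun i τ => τ.nreg 5 = (Finset.univ.filter fun v : Fin n => (v : ℕ) < i ∧ d v ≠ 1).card ∧
      (∀ v : Fin n, τ.narr 11 v = if (v : ℕ) < i ∧ d v ≠ 1 then (v : ℕ) else σ.narr 11 v) ∧
      ((∃ v : Fin n, (v : ℕ) < i ∧ d v ≠ 1 ∧ σ.narr 4 v < 2) →
        ∃ v : Fin n, τ.nreg 6 = v ∧ d v ≠ 1 ∧ σ.narr 4 v < 2))
    n σ
    (fun τ hu => by rw [NExp.eval, hu.nreg 0 (by decide), h0])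
    ⟨by simpa using h5, by simp, by simp⟩
    (fun i hi τ hu hri hI => by
      have d1 : τ.narr 2 i = d ⟨i, hi⟩ := by rw [hu.narr 2 (by decide), ← hd]
      have b1 : τ.narr 4 i = σ.narr 4 i := by rw [hu.narr 4 (by decide)]
      obtain ⟨I1, I2, I3⟩ := hI
      by_cases c1 : d ⟨i, hi⟩ = 1
      · have hyes : (Cond.neq (.cell 2 (.reg 2)) (.const 1)).holds τ := by
          simpa [Cond.holds, NExp.eval, hri, d1] using c1
        rw [startBody, Prog.exec, if_pos hyes, Prog.exec]
        refine ⟨?_, fun v => ?_, ?_⟩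
        · rw [card_filter_val_lt_succ _ hi]
          simpa [c1] using I1
        · have : (v : ℕ) = i → d v = 1 := fun h => by
            have : v = ⟨i, hi⟩ := Fin.ext h
            rw [this, c1]
          simp only [I2 v]
          grind
        · rintro ⟨v, h1, h2, h3⟩
          have : (v : ℕ) ≠ i := fun h => h2 (by
            have : v = ⟨i, hi⟩ := Fin.ext h
            rw [this, c1])
          obtain ⟨w, hw⟩ := I3 ⟨v, by omega, h2, h3⟩
          exact ⟨w, by simpa using hw⟩
      · have hno : ¬ (Cond.neq (.cell 2 (.reg 2)) (.const 1)).holds τ := by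
          simpa [Cond.holds, NExp.eval, hri, d1] using c1
        have x5 : (startBody.exec τ).nreg 5 = τ.nreg 5 + 1 := by
          rw [startBody, Prog.exec, if_neg hno]
          simp only [Prog.exec]
          simp [NExp.eval, Cond.holds, apply_ite State.nreg, ite_apply]
        have x6 : (startBody.exec τ).nreg 6 = if σ.narr 4 i < 2 then i else τ.nreg 6 := by
          rw [startBody, Prog.exec, if_neg hno]
          simp only [Prog.exec]
          simp [NExp.eval, Cond.holds, hri, b1, apply_ite State.nreg, ite_apply]
        have x11 : (startBody.exec τ).narr 11 = Function.update (τ.narr 11) i i := by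
          rw [startBody, Prog.exec, if_neg hno]
          simp only [Prog.exec]
          simp [NExp.eval, Cond.holds, hri, apply_ite State.narr, ite_apply]
        refine ⟨?_, fun v => ?_, ?_⟩
        · rw [card_filter_val_lt_succ _ hi]
          simp [x5, c1, I1]
        · have : (v : ℕ) = i → d v ≠ 1 := fun h => by
            have : v = ⟨i, hi⟩ := Fin.ext h
            rwa [this]
          simp only [x11, Function.update_apply, I2 v]
          grind
        · rintro ⟨v, h1, h2, h3⟩
          simp only [ne_eq, Nat.reduceEqDiff, not_false_eq_true, Function.update_of_ne, x6]
          split_ifs with hlt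
          · exact ⟨⟨i, hi⟩, rfl, c1, hlt⟩
          · have : (v : ℕ) ≠ i := fun h => hlt (h ▸ h3)
            exact I3 ⟨v, by omega, h2, h3⟩)
  refine ⟨t, τ, r1, r2, ?_, fun v => ?_, ?_⟩
  · rw [r3]; congr 1; ext v; simp
  · rw [r4 v]; simp only [v.isLt, true_and]; split_ifs <;> first | rfl | contradiction
  · rintro ⟨v, h⟩; exact r5 ⟨v, v.isLt, h⟩

/-- One step of the walk along the spine: register `6` holds the current vertex and register `7`
the preceding one (or zero).  The index of the vertex is stored in array `5`, and cells of array `8`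
are set to one at the indices of the vertices of degree five. -/
def walkBody : Prog :=
  .seq (.setNCell 5 (.reg 6) (.add (.reg 2) (.const 1)))
    (.seq (.ite (.neq (.cell 2 (.reg 6)) (.const 5))
        (.setNCell 8 (.add (.reg 2) (.const 1)) (.const 1)) .skip)
      (.seq (.setNReg 8 (.sub (.cell 3 (.reg 6)) (.reg 7)))
        (.seq (.setNReg 7 (.reg 6)) (.setNReg 6 (.reg 8)))))

/-- The walk along the spine. -/
def walkLoop : Prog := .forTo 2 (.reg 5) walkBody

theorem walkLoop_spec : ∃ C, ∀ {n K : ℕ} {σ : State} {d : Fin n → ℕ} {q : ℕ → Fin n},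
    (∀ i < K, ∀ j < K, q i = q j → i = j) →
    (∀ v : Fin n, σ.narr 2 v = d v) → σ.nreg 5 = K → σ.nreg 6 = q 0 → σ.nreg 7 = 0 →
    (∀ j, σ.narr 8 j = 0) →
    (∀ i < K, σ.narr 3 (q i) =
      (if 0 < i then (q (i - 1) : ℕ) else 0) + (if i + 1 < K then (q (i + 1) : ℕ) else 0)) →
    ∃ t τ, Runs walkLoop σ t τ ∧ t ≤ C * (K + 1) ∧ (∀ i < K, τ.narr 5 (q i) = i + 1) ∧
      ∀ j, τ.narr 8 j = if 0 < j ∧ j ≤ K ∧ d (q (j - 1)) = 5 then 1 else 0 := by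
  refine ⟨Prog.loopFactor (.reg 5) walkBody, fun {n K σ d q} hq hd h5 h6 h7 h8 h3 => ?_⟩
  obtain ⟨t, τ, r1, r2, r3, r4, r5, r6⟩ := runs_forTo (r := 2) (b := .reg 5) (p := walkBody)
    ⟨trivial, ⟨trivial, trivial⟩, trivial, trivial, trivial⟩ (by decide)
    (fun i τ => (i < K → τ.nreg 6 = q i) ∧ τ.nreg 7 = (if 0 < i then (q (i - 1) : ℕ) else 0) ∧
      (∀ j < i, τ.narr 5 (q j) = j + 1) ∧
      ∀ j, τ.narr 8 j = if 0 < j ∧ j ≤ i ∧ d (q (j - 1)) = 5 then 1 else 0)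
    K σ
    (fun τ hu => by rw [NExp.eval, hu.nreg 5 (by decide), h5])
    ⟨fun _ => by simpa using h6, by simpa using h7, by simp, fun j => by
      rw [if_neg (by omega)]; exact h8 j⟩
    (fun i hi τ hu hri hI => by
      obtain ⟨I1, I2, I3, I4⟩ := hI
      have I1 := I1 hi
      have d1 : τ.narr 2 (q i) = d (q i) := by rw [hu.narr 2 (by decide), ← hd]
      have s1 : τ.narr 3 (q i) = (if 0 < i then (q (i - 1) : ℕ) else 0) +
          (if i + 1 < K then (q (i + 1) : ℕ) else 0) := by rw [hu.narr 3 (by decide), ← h3 i hi]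
      have x6 : (walkBody.exec τ).nreg 6 = if i + 1 < K then (q (i + 1) : ℕ) else 0 := by
        simp only [walkBody, Prog.exec, NExp.eval, Cond.holds]
        simp [I1, I2, s1, apply_ite State.nreg, apply_ite State.narr, ite_apply]
      have x7 : (walkBody.exec τ).nreg 7 = q i := by
        simp only [walkBody, Prog.exec, NExp.eval, Cond.holds]
        simp [I1, apply_ite State.nreg, ite_apply]
      have xa5 : (walkBody.exec τ).narr 5 = Function.update (τ.narr 5) (q i) (i + 1) := by
        simp only [walkBody, Prog.exec, NExp.eval, Cond.holds]
        simp [I1, hri, apply_ite State.narr, ite_apply]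
      have xa8 : (walkBody.exec τ).narr 8 = if d (q i) = 5 then
          Function.update (τ.narr 8) (i + 1) 1 else τ.narr 8 := by
        simp only [walkBody, Prog.exec, NExp.eval, Cond.holds]
        simp [I1, hri, d1, apply_ite State.narr, ite_apply]
      refine ⟨fun hK => ?_, ?_, fun j hj => ?_, fun j => ?_⟩
      · simp [x6, hK]
      · simp [x7]
      · simp only [xa5, Function.update_apply, Fin.val_inj]
        by_cases hji : j = i
        · simp [hji]
        · rw [if_neg fun he => hji (hq j (by omega) i hi he)]
          exact I3 j (by omega)
      · simp only [xa8]
        by_cases h : j = i + 1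
        · subst h
          have := I4 (i + 1)
          rw [if_neg (by omega)] at this
          split_ifs <;> simp_all
        · have e : (0 < j ∧ j ≤ i + 1 ∧ d (q (j - 1)) = 5) ↔
              (0 < j ∧ j ≤ i ∧ d (q (j - 1)) = 5) := by
            omega
          simp only [e, ← I4 j]
          split_ifs
          · rw [Function.update_of_ne h]
          · rfl)
  exact ⟨t, τ, r1, r2, r5, r6⟩

open CaterpillarLayout

/-- The tables of the layout are stored in the arrays. -/
structure HoldsTables (σ : State) : Prop where
  next : ∀ j < 32, σ.narr 10 j = nextTable.getD j 0
  dx : ∀ j < 64, σ.rarr 5 j = (dxTable.getD j 0 : ℤ)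
  dy : ∀ j < 64, σ.rarr 6 j = (dyTable.getD j 0 : ℤ)
  ox : ∀ j < 32, σ.rarr 7 j = (oxTable.getD j 0 : ℤ)
  oy : ∀ j < 32, σ.rarr 8 j = (oyTable.getD j 0 : ℤ)
  flip : ∀ j < 8, σ.rarr 9 j = (flipTable.getD j 0 : ℤ)

/-- Stores the tables of the layout, and the state and the orientation of the first spine vertex. -/
def tableProg : Prog :=
  .seq (.storeN 10 0 nextTable) (.seq (.storeR 5 0 dxTable) (.seq (.storeR 6 0 dyTable)
    (.seq (.storeR 7 0 oxTable) (.seq (.storeR 8 0 oyTable) (.seq (.storeR 9 0 flipTable)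
      (.seq (.setRCell 4 (.const 0) (.ofNat (.const 1)))
        (.setNCell 9 (.const 0) (.cell 10 (.add (.const 28) (.cell 8 (.const 1)))))))))))

theorem tableProg_spec : ∃ C, ∀ {σ : State} {f : ℕ → ℕ}, IsFlags f → σ.narr 8 = f →
    ∃ t τ, Runs tableProg σ t τ ∧ t ≤ C ∧ HoldsTables τ ∧ τ.narr 9 0 = state f 0 ∧
      τ.rarr 4 0 = 1 := by
  refine ⟨tableProg.bound, fun {σ f} hf h8 => ?_⟩
  have lf1 := Prog.loopFree_storeN 10 0 nextTable
  have lf2 := Prog.loopFree_storeR 5 0 dxTable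
  have lf3 := Prog.loopFree_storeR 6 0 dyTable
  have lf4 := Prog.loopFree_storeR 7 0 oxTable
  have lf5 := Prog.loopFree_storeR 8 0 oyTable
  have lf6 := Prog.loopFree_storeR 9 0 flipTable
  obtain ⟨t, ht, hrun⟩ := Prog.LoopFree.runs (p := tableProg)
    ⟨lf1, lf2, lf3, lf4, lf5, lf6, trivial, trivial⟩ σ
  obtain ⟨σ1, hσ1⟩ : ∃ σ1, σ1 = (Prog.storeN 10 0 nextTable).exec σ := ⟨_, rfl⟩
  obtain ⟨σ2, hσ2⟩ : ∃ σ2, σ2 = (Prog.storeR 5 0 dxTable).exec σ1 := ⟨_, rfl⟩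
  obtain ⟨σ3, hσ3⟩ : ∃ σ3, σ3 = (Prog.storeR 6 0 dyTable).exec σ2 := ⟨_, rfl⟩
  obtain ⟨σ4, hσ4⟩ : ∃ σ4, σ4 = (Prog.storeR 7 0 oxTable).exec σ3 := ⟨_, rfl⟩
  obtain ⟨σ5, hσ5⟩ : ∃ σ5, σ5 = (Prog.storeR 8 0 oyTable).exec σ4 := ⟨_, rfl⟩
  obtain ⟨σ6, hσ6⟩ : ∃ σ6, σ6 = (Prog.storeR 9 0 flipTable).exec σ5 := ⟨_, rfl⟩
  have u1 : Unchanged (Prog.storeN 10 0 nextTable) σ σ1 := by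
    obtain ⟨_, _, h⟩ := lf1.runs σ; rw [hσ1]; exact h.unchanged
  have u2 : Unchanged (Prog.storeR 5 0 dxTable) σ1 σ2 := by
    obtain ⟨_, _, h⟩ := lf2.runs σ1; rw [hσ2]; exact h.unchanged
  have u3 : Unchanged (Prog.storeR 6 0 dyTable) σ2 σ3 := by
    obtain ⟨_, _, h⟩ := lf3.runs σ2; rw [hσ3]; exact h.unchanged
  have u4 : Unchanged (Prog.storeR 7 0 oxTable) σ3 σ4 := by
    obtain ⟨_, _, h⟩ := lf4.runs σ3; rw [hσ4]; exact h.unchanged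
  have u5 : Unchanged (Prog.storeR 8 0 oyTable) σ4 σ5 := by
    obtain ⟨_, _, h⟩ := lf5.runs σ4; rw [hσ5]; exact h.unchanged
  have u6 : Unchanged (Prog.storeR 9 0 flipTable) σ5 σ6 := by
    obtain ⟨_, _, h⟩ := lf6.runs σ5; rw [hσ6]; exact h.unchanged
  have n10 : ∀ j < 32, σ6.narr 10 j = nextTable.getD j 0 := by
    intro j hj
    rw [u6.narr 10 (by decide), u5.narr 10 (by decide), u4.narr 10 (by decide),
      u3.narr 10 (by decide), u2.narr 10 (by decide), hσ1]
    simpa using Prog.exec_storeN 10 0 nextTable σ hj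
  have f8 : σ6.narr 8 = f := by
    rw [u6.narr 8 (by decide), u5.narr 8 (by decide), u4.narr 8 (by decide),
      u3.narr 8 (by decide), u2.narr 8 (by decide), u1.narr 8 (by decide), h8]
  have f1 := hf.lt_two 1
  have e : tableProg.exec σ = (Prog.setNCell 9 (.const 0)
      (.cell 10 (.add (.const 28) (.cell 8 (.const 1))))).exec
      ((Prog.setRCell 4 (.const 0) (.ofNat (.const 1))).exec σ6) := by
    rw [hσ6, hσ5, hσ4, hσ3, hσ2, hσ1]; rfl
  refine ⟨t, _, hrun, ht, ⟨fun j hj => ?_, fun j hj => ?_, fun j hj => ?_, fun j hj => ?_,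
    fun j hj => ?_, fun j hj => ?_⟩, ?_, ?_⟩ <;> rw [e] <;> simp only [Prog.exec]
  · simpa using n10 j hj
  · simp only [ne_eq, Nat.reduceEqDiff, not_false_eq_true, Function.update_of_ne]
    rw [u6.rarr 5 (by decide), u5.rarr 5 (by decide), u4.rarr 5 (by decide),
      u3.rarr 5 (by decide), hσ2]
    simpa using Prog.exec_storeR 5 0 dxTable σ1 hj
  · simp only [ne_eq, Nat.reduceEqDiff, not_false_eq_true, Function.update_of_ne]
    rw [u6.rarr 6 (by decide), u5.rarr 6 (by decide), u4.rarr 6 (by decide), hσ3]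
    simpa using Prog.exec_storeR 6 0 dyTable σ2 hj
  · simp only [ne_eq, Nat.reduceEqDiff, not_false_eq_true, Function.update_of_ne]
    rw [u6.rarr 7 (by decide), u5.rarr 7 (by decide), hσ4]
    simpa using Prog.exec_storeR 7 0 oxTable σ3 hj
  · simp only [ne_eq, Nat.reduceEqDiff, not_false_eq_true, Function.update_of_ne]
    rw [u6.rarr 8 (by decide), hσ5]
    simpa using Prog.exec_storeR 8 0 oyTable σ4 hj
  · simp only [ne_eq, Nat.reduceEqDiff, not_false_eq_true, Function.update_of_ne]
    rw [hσ6]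
    simpa using Prog.exec_storeR 9 0 flipTable σ5 hj
  · simp only [NExp.eval, Function.update_self, f8]
    rw [n10 _ (by omega)]
    rfl
  · simp [RExp.eval, NExp.eval]

end RealRAM

/-! ### Computing the coordinates -/

namespace RealRAM

open CaterpillarLayout

theorem HoldsTables.of_unchanged {σ τ : State} {p : Prog} (h : HoldsTables σ)
    (hu : Unchanged p σ τ) (hp : 10 ∉ p.narrs ∧ 5 ∉ p.rarrs ∧ 6 ∉ p.rarrs ∧ 7 ∉ p.rarrs ∧
      8 ∉ p.rarrs ∧ 9 ∉ p.rarrs) : HoldsTables τ where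
  next j hj := by rw [hu.narr 10 hp.1, h.next j hj]
  dx j hj := by rw [hu.rarr 5 hp.2.1, h.dx j hj]
  dy j hj := by rw [hu.rarr 6 hp.2.2.1, h.dy j hj]
  ox j hj := by rw [hu.rarr 7 hp.2.2.2.1, h.ox j hj]
  oy j hj := by rw [hu.rarr 8 hp.2.2.2.2.1, h.oy j hj]
  flip j hj := by rw [hu.rarr 9 hp.2.2.2.2.2, h.flip j hj]

/-- `e + e`. -/
def NExp.double (e : NExp) : NExp := .add e e

/-- Advances the layout from the current spine vertex to the next one: states are stored in array
`9`, orientations in the real array `4`, and coordinates in the real arrays `2` and `3`. -/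
def advanceBody : Prog :=
  .seq (.setNReg 9 (.cell 9 (.reg 2)))
    (.seq (.setNReg 10 (.cell 10 (.add (NExp.double (NExp.double (.reg 9)))
        (.add (NExp.double (.cell 8 (.add (.reg 2) (.const 1))))
          (.cell 8 (.add (.reg 2) (.const 2)))))))
      (.seq (.setNReg 11 (.add (NExp.double (NExp.double (NExp.double (.reg 9)))) (.reg 10)))
        (.seq (.setNCell 9 (.add (.reg 2) (.const 1)) (.reg 10))
          (.seq (.setRCell 4 (.add (.reg 2) (.const 1))
              (.mul (.cell 4 (.reg 2)) (.cell 9 (.reg 9))))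
            (.seq (.setRCell 2 (.add (.reg 2) (.const 1))
                (.add (.cell 2 (.reg 2)) (.cell 5 (.reg 11))))
              (.setRCell 3 (.add (.reg 2) (.const 1)) (.add (.cell 3 (.reg 2))
                (.mul (.cell 4 (.add (.reg 2) (.const 1))) (.cell 6 (.reg 11))))))))))

/-- Computes the positions of the spine vertices. -/
def advanceLoop : Prog := .forTo 2 (.add (.reg 5) (.const 1)) advanceBody

/-- The arrays hold the layout of the spine vertices with numbers up to `N`. -/
structure HoldsSpine (f : ℕ → ℕ) (N : ℕ) (σ : State) : Prop where
  state : ∀ j ≤ N, σ.narr 9 j = state f j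
  orientation : ∀ j ≤ N, σ.rarr 4 j = orientation f j
  spineX : ∀ j ≤ N, σ.rarr 2 j = spineX f j
  spineY : ∀ j ≤ N, σ.rarr 3 j = spineY f j

theorem HoldsSpine.step {f : ℕ → ℕ} {i : ℕ} {σ τ : State} (hf : IsFlags f) (h : HoldsSpine f i σ)
    (ht : HoldsTables σ) (h8 : σ.narr 8 = f) (hri : σ.nreg 2 = i)
    (h1 : τ.narr 9 = (advanceBody.exec σ).narr 9) (h2 : τ.rarr = (advanceBody.exec σ).rarr) :
    HoldsSpine f (i + 1) τ := by
  have e9 := h.state i le_rfl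
  have e4 := h.orientation i le_rfl
  have e2 := h.spineX i le_rfl
  have e3 := h.spineY i le_rfl
  have l0 := state_lt hf i
  have l1 := state_lt hf (i + 1)
  have f1 := hf.lt_two (i + 1)
  have f2 := hf.lt_two (i + 2)
  have en : σ.narr 10 (CaterpillarLayout.state f i + CaterpillarLayout.state f i +
      (CaterpillarLayout.state f i + CaterpillarLayout.state f i) +
      (f (i + 1) + f (i + 1) + f (i + 2))) = CaterpillarLayout.state f (i + 1) := by
    rw [ht.next _ (by omega), CaterpillarLayout.state, CaterpillarLayout.next]
    congr 1; omega
  set s := CaterpillarLayout.state f i with hs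
  set s' := CaterpillarLayout.state f (i + 1) with hs'
  have ex : σ.rarr 5 (s + s + (s + s) + (s + s + (s + s)) + s') = dx s s' := by
    rw [ht.dx _ (by omega), dx]
    congr 2; omega
  have ey : σ.rarr 6 (s + s + (s + s) + (s + s + (s + s)) + s') = dy s s' := by
    rw [ht.dy _ (by omega), dy]
    congr 2; omega
  have ef : σ.rarr 9 s = CaterpillarLayout.flip s := by
    rw [ht.flip _ l0, CaterpillarLayout.flip]
  have x9 : τ.narr 9 = Function.update (σ.narr 9) (i + 1) s' := by
    rw [h1]
    simp [advanceBody, Prog.exec, NExp.eval, NExp.double, hri, e9, en, h8]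
  have x4 : τ.rarr 4 = Function.update (σ.rarr 4) (i + 1)
      (CaterpillarLayout.orientation f (i + 1) : ℝ) := by
    rw [h2]
    simp [advanceBody, Prog.exec, NExp.eval, RExp.eval, NExp.double, hri, e9, ef, e4,
      CaterpillarLayout.orientation, ← hs]
  have x2 : τ.rarr 2 = Function.update (σ.rarr 2) (i + 1)
      (CaterpillarLayout.spineX f (i + 1) : ℝ) := by
    rw [h2]
    simp [advanceBody, Prog.exec, NExp.eval, RExp.eval, NExp.double, hri, e9, en, h8, ex, e2,
      CaterpillarLayout.spineX, ← hs, ← hs']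
  have x3 : τ.rarr 3 = Function.update (σ.rarr 3) (i + 1)
      (CaterpillarLayout.spineY f (i + 1) : ℝ) := by
    rw [h2]
    simp [advanceBody, Prog.exec, NExp.eval, RExp.eval, NExp.double, hri, e9, en, h8, ey, e3, ef,
      e4, CaterpillarLayout.spineY, CaterpillarLayout.orientation, ← hs, ← hs']
  refine ⟨fun j hj => ?_, fun j hj => ?_, fun j hj => ?_, fun j hj => ?_⟩
  · rw [x9, Function.update_apply]
    split_ifs with hc
    · rw [hc]
    · exact h.state j (by omega)
  · rw [x4, Function.update_apply]
    split_ifs with hc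
    · rw [hc]
    · exact h.orientation j (by omega)
  · rw [x2, Function.update_apply]
    split_ifs with hc
    · rw [hc]
    · exact h.spineX j (by omega)
  · rw [x3, Function.update_apply]
    split_ifs with hc
    · rw [hc]
    · exact h.spineY j (by omega)

theorem advanceLoop_spec : ∃ C, ∀ {K : ℕ} {σ : State} {f : ℕ → ℕ}, IsFlags f → σ.narr 8 = f →
    σ.nreg 5 = K → HoldsTables σ → σ.narr 9 0 = state f 0 → σ.rarr 4 0 = 1 → σ.rarr 2 0 = 0 →
    σ.rarr 3 0 = 0 →
    ∃ t τ, Runs advanceLoop σ t τ ∧ t ≤ C * (K + 1 + 1) ∧ HoldsSpine f (K + 1) τ := by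
  refine ⟨Prog.loopFactor (.add (.reg 5) (.const 1)) advanceBody,
    fun {K σ f} hf h8 h5 ht h9 h4 h2 h3 => ?_⟩
  exact runs_forTo (r := 2) (b := .add (.reg 5) (.const 1)) (p := advanceBody)
    ⟨trivial, trivial, trivial, trivial, trivial, trivial, trivial⟩ (by decide)
    (fun i τ => HoldsSpine f i τ) (K + 1) σ
    (fun τ hu => by rw [NExp.eval, NExp.eval, NExp.eval, hu.nreg 5 (by decide), h5])
    (by
      refine ⟨fun j hj => ?_, fun j hj => ?_, fun j hj => ?_, fun j hj => ?_⟩ <;>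
        obtain rfl : j = 0 := by omega
      · exact h9
      · simpa [orientation] using h4
      · simpa [spineX] using h2
      · simpa [spineY] using h3)
    (fun i hi τ hu hri hI => hI.step hf (ht.of_unchanged hu (by decide))
      (by rw [hu.narr 8 (by decide), h8]) hri rfl rfl)

/-- Replaces the spine number, in register `12`, and the rank, in register `13`, of a vertex by its
place in the layout, see `CaterpillarLayout.place`. -/
def placeProg : Prog :=
  .seq (.ite (.neq (.reg 12) (.const 1)) (.setNReg 15 (.const 1)) (.setNReg 15 (.const 0)))
    (.seq (.ite (.neq (.reg 12) (.reg 5)) (.setNReg 16 (.add (.reg 15) (.const 1)))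
        (.setNReg 16 (.reg 15)))
      (.ite (.neq (.reg 13) (.const 0)) .skip
        (.ite (.not (.nlt (.reg 15) (.reg 13)))
          (.seq (.setNReg 12 (.const 0)) (.setNReg 13 (.const 0)))
          (.ite (.not (.nlt (.reg 16) (.reg 13)))
            (.seq (.setNReg 12 (.add (.reg 5) (.const 1))) (.setNReg 13 (.const 0)))
            (.setNReg 13 (.sub (.reg 13) (.reg 16)))))))

theorem exec_placeProg (σ : State) : (placeProg.exec σ).nreg 12
      = (place (σ.nreg 5) (σ.nreg 12) (σ.nreg 13)).1 ∧
    (placeProg.exec σ).nreg 13 = (place (σ.nreg 5) (σ.nreg 12) (σ.nreg 13)).2 := by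
  by_cases h1 : σ.nreg 12 = 1 <;> by_cases hK : σ.nreg 12 = σ.nreg 5 <;>
    simp only [placeProg, Prog.exec, Cond.holds, NExp.eval, place, h1, hK, if_true, if_false] <;>
    by_cases hs : σ.nreg 13 = 0 <;>
    simp [hs, h1, hK, apply_ite State.nreg, apply_ite Prod.fst, apply_ite Prod.snd, ite_apply] <;>
    grind

/-- Looks up the spine number and the rank of the current vertex. -/
def lookupProg : Prog :=
  .seq (.setNReg 12 (.cell 5 (.cell 11 (.reg 2)))) (.setNReg 13 (.cell 6 (.reg 2)))

/-- Computes the coordinates of the current vertex from its place in the layout. -/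
def emitProg : Prog :=
  .seq (.setNReg 14 (.add (NExp.double (NExp.double (.cell 9 (.reg 12)))) (.reg 13)))
    (.seq (.setRCell 0 (.reg 2) (.div (.add (.cell 2 (.reg 12)) (.cell 7 (.reg 14)))
        (.ofNat (.const 1000))))
      (.setRCell 1 (.reg 2) (.div (.add (.cell 3 (.reg 12))
        (.mul (.cell 4 (.reg 12)) (.cell 8 (.reg 14)))) (.ofNat (.const 1000)))))

theorem exec_emitProg {f : ℕ → ℕ} {N v : ℕ} {σ : State} (hf : IsFlags f) (h : HoldsSpine f N σ)
    (ht : HoldsTables σ) (h2 : σ.nreg 2 = v) (h12 : σ.nreg 12 ≤ N)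
    (h13 : σ.nreg 13 ≤ slots (state f (σ.nreg 12))) :
    (emitProg.exec σ).rarr 0 = Function.update (σ.rarr 0) v
        ((posX f (σ.nreg 12) (σ.nreg 13) : ℝ) / 1000) ∧
      (emitProg.exec σ).rarr 1 = Function.update (σ.rarr 1) v
        ((posY f (σ.nreg 12) (σ.nreg 13) : ℝ) / 1000) := by
  have l0 := state_lt hf (σ.nreg 12)
  have l1 := (slots_le (state f (σ.nreg 12))).2
  set i := σ.nreg 12 with hi
  set j := σ.nreg 13 with hj
  set s := state f i with hs
  have ex : σ.rarr 7 (s + s + (s + s) + j) = ox s j := by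
    rw [ht.ox _ (by omega), ox]
    congr 2; omega
  have ey : σ.rarr 8 (s + s + (s + s) + j) = oy s j := by
    rw [ht.oy _ (by omega), oy]
    congr 2; omega
  have e9 := h.state i h12
  have e4 := h.orientation i h12
  have e2 := h.spineX i h12
  have e3 := h.spineY i h12
  simp [emitProg, Prog.exec, NExp.eval, RExp.eval, NExp.double, h2, posX, posY, e9, e4, e2, e3,
    ex, ey, ← hs, ← hi, ← hj]

/-- Computes the coordinates of the current vertex. -/
def finalBody : Prog := .seq lookupProg (.seq placeProg emitProg)

/-- Computes the coordinates of all vertices. -/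
def finalLoop : Prog := .forTo 2 (.reg 0) finalBody

theorem finalLoop_spec : ∃ C, ∀ {n K : ℕ} {σ : State} {f : ℕ → ℕ} {i s : Fin n → ℕ}, IsFlags f →
    σ.nreg 0 = n → σ.nreg 5 = K → HoldsTables σ → HoldsSpine f (K + 1) σ →
    (∀ v : Fin n, σ.narr 5 (σ.narr 11 v) = i v) → (∀ v : Fin n, σ.narr 6 v = s v) →
    (∀ v, (place K (i v) (s v)).1 ≤ K + 1) →
    (∀ v, (place K (i v) (s v)).2 ≤ slots (state f (place K (i v) (s v)).1)) →
    ∃ t τ, Runs finalLoop σ t τ ∧ t ≤ C * (n + 1) ∧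
      τ.points n = fun v => point f (place K (i v) (s v)) := by
  refine ⟨Prog.loopFactor (.reg 0) finalBody,
    fun {n K σ f i s} hf h0 h5 ht hs hi hr hp1 hp2 => ?_⟩
  have hfree : finalBody.LoopFree := by
    simp [finalBody, lookupProg, placeProg, emitProg, Prog.LoopFree]
  obtain ⟨t, τ, r1, r2, r3⟩ := runs_forTo (r := 2) (b := .reg 0) (p := finalBody) hfree (by decide)
    (fun k τ => ∀ v : Fin n, (v : ℕ) < k →
      τ.rarr 0 v = (posX f (place K (i v) (s v)).1 (place K (i v) (s v)).2 : ℝ) / 1000 ∧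
      τ.rarr 1 v = (posY f (place K (i v) (s v)).1 (place K (i v) (s v)).2 : ℝ) / 1000)
    n σ
    (fun τ hu => by rw [NExp.eval, hu.nreg 0 (by decide), h0])
    (fun v hv => absurd hv (Nat.not_lt_zero _))
    (fun k hk τ hu hri hI v hv => by
      obtain ⟨σ1, hσ1⟩ : ∃ σ1, σ1 = lookupProg.exec τ := ⟨_, rfl⟩
      obtain ⟨σ2, hσ2⟩ : ∃ σ2, σ2 = placeProg.exec σ1 := ⟨_, rfl⟩
      have u1 : Unchanged lookupProg τ σ1 := by
        obtain ⟨_, _, h⟩ := Prog.LoopFree.runs (p := lookupProg) ⟨trivial, trivial⟩ τ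
        rw [hσ1]; exact h.unchanged
      have u2 : Unchanged placeProg σ1 σ2 := by
        obtain ⟨_, _, h⟩ := Prog.LoopFree.runs (p := placeProg)
          ⟨⟨trivial, trivial⟩, ⟨trivial, trivial⟩, trivial, ⟨trivial, trivial⟩,
            ⟨trivial, trivial⟩, trivial⟩ σ1
        rw [hσ2]; exact h.unchanged
      have a1 : σ1.nreg 12 = i ⟨k, hk⟩ := by
        rw [← hi, ← hu.narr 5 (by decide), ← hu.narr 11 (by decide), hσ1]
        simp [lookupProg, Prog.exec, NExp.eval, hri]
      have a2 : σ1.nreg 13 = s ⟨k, hk⟩ := by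
        rw [← hr, ← hu.narr 6 (by decide), hσ1]
        simp [lookupProg, Prog.exec, NExp.eval, hri]
      have a3 : σ1.nreg 5 = K := by
        rw [u1.nreg 5 (by decide), hu.nreg 5 (by decide), h5]
      obtain ⟨b1, b2⟩ := exec_placeProg σ1
      rw [← hσ2, a1, a2, a3] at b1 b2
      have ht2 : HoldsTables σ2 := ((ht.of_unchanged hu (by decide)).of_unchanged u1
        (by decide)).of_unchanged u2 (by decide)
      have n9 : σ2.narr 9 = σ.narr 9 := by
        rw [u2.narr 9 (by decide), u1.narr 9 (by decide), hu.narr 9 (by decide)]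
      have hrr : ∀ a, a ≠ 0 → a ≠ 1 → σ2.rarr a = σ.rarr a := by
        intro a ha0 ha1
        rw [u2.rarr a (by simp [placeProg, Prog.rarrs]),
          u1.rarr a (by simp [lookupProg, Prog.rarrs]),
          hu.rarr a (by simp [Prog.forTo, finalBody, lookupProg, placeProg, emitProg, Prog.rarrs,
            ha0, ha1])]
      have hs2 : HoldsSpine f (K + 1) σ2 :=
        ⟨fun j hj => by rw [n9, hs.state j hj],
          fun j hj => by rw [hrr 4 (by decide) (by decide), hs.orientation j hj],
          fun j hj => by rw [hrr 2 (by decide) (by decide), hs.spineX j hj],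
          fun j hj => by rw [hrr 3 (by decide) (by decide), hs.spineY j hj]⟩
      have hri2 : σ2.nreg 2 = k := by
        rw [u2.nreg 2 (by decide), u1.nreg 2 (by decide), hri]
      obtain ⟨c1, c2⟩ := exec_emitProg hf hs2 ht2 hri2 (by rw [b1]; exact hp1 _)
        (by rw [b1, b2]; exact hp2 _)
      have e : finalBody.exec τ = emitProg.exec σ2 := by rw [hσ2, hσ1]; rfl
      simp only [e, c1, c2, b1, b2, Function.update_apply]
      split_ifs with hc
      · have : v = ⟨k, hk⟩ := Fin.ext hc
        subst this
        exact ⟨rfl, rfl⟩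
      · have := hI v (by omega)
        rw [u2.rarr 0 (by decide), u1.rarr 0 (by decide), u2.rarr 1 (by decide),
          u1.rarr 1 (by decide)]
        exact this)
  refine ⟨t, τ, r1, r2, ?_⟩
  ext v k
  obtain ⟨e1, e2⟩ := r3 v v.isLt
  simp [State.points, point, e1, e2]

end RealRAM

/-! ### The layout program -/

section

variable {n : ℕ} {G : SimpleGraph (Fin n)} [DecidableRel G.Adj]

theorem sum_neighbors_degree_eq_one_add (v : Fin n) :
    ∑ u ∈ G.neighborFinset v, (if G.degree u = 1 then 1 else 0)
      + ∑ u ∈ G.neighborFinset v, (if G.degree u ≠ 1 then 1 else 0) = G.degree v := by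
  rw [← Finset.sum_add_distrib, ← SimpleGraph.card_neighborFinset_eq_degree,
    Finset.card_eq_sum_ones]
  refine Finset.sum_congr rfl fun u _ => ?_
  split_ifs <;> simp_all

theorem eq_of_adj_of_degree_eq_one {l u v : Fin n} (hl : G.degree l = 1) (hu : G.Adj l u)
    (hv : G.Adj l v) : u = v := by
  rw [← SimpleGraph.card_neighborFinset_eq_degree] at hl
  exact Finset.card_le_one.1 hl.le u (by simpa using hu) v (by simpa using hv)

/-- The flags of the spine vertices of degree five; the numbering of the spine starts with one, as
`0` and `K + 1` belong to the dummy vertices of the layout. -/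
def fiveFlags (G : SimpleGraph (Fin n)) [DecidableRel G.Adj] (K : ℕ) (q : ℕ → Fin n) (j : ℕ) : ℕ :=
  if 0 < j ∧ j ≤ K ∧ G.degree (q (j - 1)) = 5 then 1 else 0

variable {K : ℕ} {q : ℕ → Fin n}

theorem IsSpine.isFlags (hq : IsSpine G K q) (hG : DegreeCondition G) :
    CaterpillarLayout.IsFlags (fiveFlags G K q) := by
  refine ⟨fun i => by unfold fiveFlags; split_ifs <;> omega, by simp [fiveFlags], fun i hi => ?_⟩
  unfold fiveFlags at hi ⊢
  rw [if_neg]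
  rintro ⟨-, h2, h3⟩
  split_ifs at hi with h
  obtain ⟨h4, h5, h6⟩ := h
  rw [Nat.add_sub_cancel] at h3
  exact hG.2 _ (hq.degree_ne (i - 1) (by omega)) _ (hq.degree_ne i (by omega))
    ((hq.adj_iff _ (by omega) _ (by omega)).2 (by omega)) ⟨h6, h3⟩

/-- The labelling of a caterpillar from which its layout is read off: a spine vertex is labelled by
its number on the spine and by zero, and a leaf is labelled by the number of its neighbour and by
its rank among the leaves of this neighbour. -/
theorem IsSpine.isLabelling (hq : IsSpine G K q) (hG : G.Connected) (hn : n ≠ 2)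
    (hdeg : DegreeCondition G) {c s b idx : ℕ → ℕ} (hL : RealRAM.LeafInv G c s b)
    (hc : ∀ v : Fin n, c v = ∑ u ∈ G.neighborFinset v, (if G.degree u = 1 then 1 else 0))
    (hs : ∀ v : Fin n, G.degree v = 1 → s v ≠ 0) (hidx : ∀ i < K, idx (q i) = i + 1) :
    CaterpillarLayout.IsLabelling G K (fiveFlags G K q)
      (fun v : Fin n => idx (if G.degree v = 1 then b v else v)) (fun v => s v) := by
  have key : ∀ v : Fin n, ∃ j < K, idx (if G.degree v = 1 then b v else v) = j + 1 ∧
      ((s v = 0 ∧ v = q j) ∨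
        (s v ≠ 0 ∧ G.degree v = 1 ∧ G.Adj v (q j) ∧ b v = q j ∧ s v ≤ c (q j))) := by
    intro v
    by_cases hv : G.degree v = 1
    · obtain ⟨-, u, h1, h2, h3⟩ := hL.spec v (hs v hv)
      obtain ⟨j, hj, rfl⟩ := hq.surj u (degree_ne_one_of_adj_leaf hG hn h1 hv)
      exact ⟨j, hj, by rw [if_pos hv, h2, hidx j hj], Or.inr ⟨hs v hv, hv, h1, h2, h3⟩⟩
    · obtain ⟨j, hj, rfl⟩ := hq.surj v hv
      refine ⟨j, hj, by rw [if_neg hv, hidx j hj], Or.inl ⟨?_, rfl⟩⟩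
      by_contra h
      exact hv (hL.spec _ h).1
  refine ⟨fun v => ?_, fun v => ?_, fun u v h1 h2 => ?_, fun u v hne => ?_, fun v => ?_⟩
  · obtain ⟨j, hj, e, -⟩ := key v
    simp only [e]; omega
  · obtain ⟨j, hj, e, -⟩ := key v
    simp only [e]; omega
  · obtain ⟨j, hj, e, hu⟩ := key u
    obtain ⟨j', hj', e', hv⟩ := key v
    simp only [e, e', Nat.add_right_cancel_iff] at h1 h2
    subst h1
    rcases hu with ⟨a1, a2⟩ | ⟨a1, -, -, a2, -⟩ <;> rcases hv with ⟨b1, b2⟩ | ⟨b1, -, -, b2, -⟩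
    · rw [a2, b2]
    · omega
    · omega
    · exact hL.inj u v a1 h2 (a2.trans b2.symm)
  · obtain ⟨j, hj, e, hu⟩ := key u
    obtain ⟨j', hj', e', hv⟩ := key v
    simp only [e, e', Nat.add_right_cancel_iff]
    rcases hu with ⟨a1, a2⟩ | ⟨a1, a2, a3, -, -⟩ <;> rcases hv with ⟨b1, b2⟩ | ⟨b1, b2, b3, -, -⟩
    · rw [a2, b2, hq.adj_iff j hj j' hj']
      have : j ≠ j' := fun h => hne (by rw [a2, b2, h])
      rw [← a2, ← b2]
      omega
    · have : G.Adj u v ↔ j = j' := by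
        rw [a2]
        refine ⟨fun h => hq.inj j hj j' hj' (eq_of_adj_of_degree_eq_one b2 h.symm b3), ?_⟩
        rintro rfl
        exact b3.symm
      rw [this]; omega
    · have : G.Adj u v ↔ j = j' := by
        rw [b2]
        refine ⟨fun h => hq.inj j hj j' hj' (eq_of_adj_of_degree_eq_one a2 a3 h), ?_⟩
        rintro rfl
        exact a3
      rw [this]; omega
    · have : ¬ G.Adj u v := fun h => degree_ne_one_of_adj_leaf hG hn h a2 b2
      simp only [this, a1, b1]; simp
  · obtain ⟨j, hj, e, hv⟩ := key v
    simp only [e]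
    rcases hv with ⟨a1, -⟩ | ⟨-, -, -, -, a1⟩
    · omega
    · have h1 := sum_neighbors_degree_eq_one_add (G := G) (q j)
      rw [← hc, hq.sum_neighbors (fun _ => 1) hj] at h1
      have h5 := hdeg.1 (q j)
      rw [fiveFlags, Nat.add_sub_cancel]
      split_ifs at h1 ⊢ <;> omega

end

namespace RealRAM

open CaterpillarLayout

/-- Computes the layout of a caterpillar whose spine is not empty. Register `5` holds the number of
spine vertices. Among the arrays of natural numbers, `2` holds the degrees, `3` and `4` the sums
and the numbers of spine neighbours, `5` the numbers on the spine, `6` the ranks of the leaves, `7`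
the numbers of leaves, `8` the flags, `9` the states, `10` the successor table, and `11` the spine
vertex that a vertex belongs to. Among the arrays of real numbers, `2` and `3` hold the coordinates
of the spine, `4` the orientations, and `5` to `9` the tables. -/
def layoutProg : Prog :=
  .seq degreeLoop (.seq spineLoop (.seq leafLoop (.seq startLoop (.seq walkLoop
    (.seq tableProg (.seq advanceLoop finalLoop))))))

theorem layoutProg_spec : ∃ C, ∀ {n : ℕ} {G : SimpleGraph (Fin n)} [DecidableRel G.Adj]
    {es : List (Fin n × Fin n)}, IsCaterpillar G → IsEdgeList G es → DegreeCondition G → n ≠ 2 →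
    ∃ t τ, Runs layoutProg (initial n es) t τ ∧ t ≤ C * n ∧ IsUDR G (τ.points n) := by
  obtain ⟨C1, s1⟩ := degreeLoop_spec
  obtain ⟨C2, s2⟩ := spineLoop_spec
  obtain ⟨C3, s3⟩ := leafLoop_spec
  obtain ⟨C4, s4⟩ := startLoop_spec
  obtain ⟨C5, s5⟩ := walkLoop_spec
  obtain ⟨C6, s6⟩ := tableProg_spec
  obtain ⟨C7, s7⟩ := advanceLoop_spec
  obtain ⟨C8, s8⟩ := finalLoop_spec
  refine ⟨C1 + C2 + C3 + 2 * C4 + 2 * C5 + C6 + 3 * C7 + 2 * C8,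
    fun {n G _ es} hG hes hdeg hn => ?_⟩
  have hconn := hG.isTree.connected
  have hm := hes.length_lt hG.isTree
  have hnl : ∀ u v, G.Adj u v → G.degree u = 1 → G.degree v ≠ 1 :=
    fun u v => degree_ne_one_of_adj_leaf hconn hn
  obtain ⟨K, q', hq'⟩ := hG.exists_isSpine
  have hK := hq'.pos hconn hn
  have hKn : K ≤ n := by
    rw [← hq'.card_eq]
    exact (Finset.card_le_univ _).trans (Fintype.card_fin n).le
  -- the degrees
  have i0 := holdsInput_initial n es
  obtain ⟨t1, σ1, r1, b1, d1⟩ := s1 i0 fun v => rfl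
  have u1 := r1.unchanged
  have i1 := i0.of_unchanged u1 (by decide)
  have d1 : ∀ v : Fin n, σ1.narr 2 v = G.degree v := fun v => by
    rw [d1, hes.incidenceSum_eq]
    simp
  -- the neighbours on the spine
  obtain ⟨t2, σ2, r2, b2, e3, e4⟩ := s2 i1 d1 (fun v => by rw [u1.narr 3 (by decide)]; rfl)
    (fun v => by rw [u1.narr 4 (by decide)]; rfl)
  have u2 := r2.unchanged
  have i2 := i1.of_unchanged u2 (by decide)
  have d2 : ∀ v : Fin n, σ2.narr 2 v = G.degree v := fun v => by
    rw [u2.narr 2 (by decide), d1]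
  have nbr : ∀ {q : ℕ → Fin n} (_ : IsSpine G K q) (w : Fin n → ℕ) (i : ℕ) (_ : i < K),
      incidenceSum (fun v u => if G.degree v ≠ 1 ∧ G.degree u ≠ 1 then w u else 0) es (q i)
        = (if 0 < i then w (q (i - 1)) else 0) + (if i + 1 < K then w (q (i + 1)) else 0) := by
    intro q hq w i hi
    rw [hes.incidenceSum_eq, ← hq.sum_neighbors w hi]
    exact Finset.sum_congr rfl fun u _ => by simp [hq.degree_ne i hi]
  -- the leaves
  obtain ⟨t3, σ3, r3, b3, hL, hc, hleaf⟩ := s3 hes hnl i2 d2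
    (fun v => by rw [u2.narr 6 (by decide), u1.narr 6 (by decide)]; rfl)
    (fun v => by rw [u2.narr 7 (by decide), u1.narr 7 (by decide)]; rfl)
  have u3 := r3.unchanged
  have i3 := i2.of_unchanged u3 (by decide)
  have d3 : ∀ v : Fin n, σ3.narr 2 v = G.degree v := fun v => by
    rw [u3.narr 2 (by decide), d2]
  have f4 : ∀ v : Fin n, σ3.narr 4 v = incidenceSum
      (fun v u => if G.degree v ≠ 1 ∧ G.degree u ≠ 1 then 1 else 0) es v := fun v => by
    rw [u3.narr 4 (by decide), e4]
  -- the first vertex of the spine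
  obtain ⟨t4, σ4, r4, b4, k4, base, start⟩ := s4 i3.size d3
    (by rw [u3.nreg 5 (by decide), u2.nreg 5 (by decide), u1.nreg 5 (by decide)]; rfl)
  have u4 := r4.unchanged
  rw [hq'.card_eq] at k4
  obtain ⟨v0, hv0, hv1, hv2⟩ := start ⟨q' 0, hq'.degree_ne 0 hK, by
    rw [f4, nbr hq' (fun _ => 1) 0 hK]
    simp only [lt_irrefl, if_false]
    split_ifs <;> omega⟩
  -- an enumeration of the spine that begins with this vertex
  obtain ⟨q, hq, hq0⟩ : ∃ q, IsSpine G K q ∧ q 0 = v0 := by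
    obtain ⟨i, hi, hqi⟩ := hq'.surj v0 hv1
    rw [f4, ← hqi, nbr hq' (fun _ => 1) i hi] at hv2
    by_cases h0 : i = 0
    · exact ⟨q', hq', by rw [← h0, hqi]⟩
    · refine ⟨_, hq'.reverse, ?_⟩
      rw [← hqi]
      congr 1
      split_ifs at hv2 <;> omega
  have d4 : ∀ v : Fin n, σ4.narr 2 v = G.degree v := fun v => by
    rw [u4.narr 2 (by decide), d3]
  -- the numbers of the vertices of the spine
  obtain ⟨t5, σ5, r5, b5, hidx, hflag⟩ := s5 hq.inj d4 k4 (by rw [hv0, hq0])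
    (by rw [u4.nreg 7 (by decide), u3.nreg 7 (by decide), u2.nreg 7 (by decide),
      u1.nreg 7 (by decide)]; rfl)
    (fun j => by rw [u4.narr 8 (by decide), u3.narr 8 (by decide), u2.narr 8 (by decide),
      u1.narr 8 (by decide)]; rfl)
    (fun i hi => by
      rw [u4.narr 3 (by decide), u3.narr 3 (by decide), e3]
      exact nbr hq (fun u => (u : ℕ)) i hi)
  have u5 := r5.unchanged
  have hflag : σ5.narr 8 = fiveFlags G K q := funext hflag
  have hf := hq.isFlags hdeg
  -- the layout of the spine
  obtain ⟨t6, σ6, r6, b6, tab, st, ori⟩ := s6 hf hflag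
  have u6 := r6.unchanged
  have k6 : σ6.nreg 5 = K := by rw [u6.nreg 5 (by decide), u5.nreg 5 (by decide), k4]
  obtain ⟨t7, σ7, r7, b7, sp⟩ := s7 hf (by rw [u6.narr 8 (by decide), hflag]) k6 tab st ori
    (by rw [u6.rarr 2 (by decide), u5.rarr 2 (by decide), u4.rarr 2 (by decide),
      u3.rarr 2 (by decide), u2.rarr 2 (by decide), u1.rarr 2 (by decide)]; rfl)
    (by rw [u6.rarr 3 (by decide), u5.rarr 3 (by decide), u4.rarr 3 (by decide),
      u3.rarr 3 (by decide), u2.rarr 3 (by decide), u1.rarr 3 (by decide)]; rfl)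
  have u7 := r7.unchanged
  -- the coordinates of all vertices
  have lab := hq.isLabelling hconn hn hdeg hL (fun v => by rw [hc, hes.incidenceSum_eq]) hleaf hidx
  obtain ⟨t8, σ8, r8, b8, pts⟩ := s8 (n := n)
    (i := fun v => σ5.narr 5 (if G.degree v = 1 then σ3.narr 11 v else v))
    (s := fun v => σ3.narr 6 v) hf
    (by rw [u7.nreg 0 (by decide), u6.nreg 0 (by decide), u5.nreg 0 (by decide),
      u4.nreg 0 (by decide), i3.size])
    (by rw [u7.nreg 5 (by decide), k6]) (tab.of_unchanged u7 (by decide)) sp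
    (fun v => by
      rw [u7.narr 5 (by decide), u6.narr 5 (by decide), u7.narr 11 (by decide),
        u6.narr 11 (by decide), u5.narr 11 (by decide), base])
    (fun v => by
      rw [u7.narr 6 (by decide), u6.narr 6 (by decide), u5.narr 6 (by decide),
        u4.narr 6 (by decide)])
    (fun v => by
      have h1 := lab.le v
      rcases place_cases K (σ5.narr 5 (if G.degree v = 1 then σ3.narr 11 v else v)) (σ3.narr 6 v)
        with h | h | h | h <;> omega)
    (lab.place_le_slots hf)
  refine ⟨_, σ8, r1.seq (r2.seq (r3.seq (r4.seq (r5.seq (r6.seq (r7.seq r8)))))), ?_, ?_⟩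
  · have bound : ∀ {C k a : ℕ}, a ≤ k * n → C * a ≤ k * C * n := fun {C k a} h =>
      (Nat.mul_le_mul_left C h).trans (by rw [← mul_assoc, mul_comm C k])
    have c1 := b1.trans (bound (k := 1) (by omega))
    have c2 := b2.trans (bound (k := 1) (by omega))
    have c3 := b3.trans (bound (k := 1) (by omega))
    have c4 := b4.trans (bound (k := 2) (by omega))
    have c5 := b5.trans (bound (k := 2) (by omega))
    have c6 := b6.trans (Nat.le_mul_of_pos_right C6 (by omega : 0 < n))
    have c7 := b7.trans (bound (k := 3) (by omega))
    have c8 := b8.trans (bound (k := 2) (by omega))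
    rw [one_mul] at c1 c2 c3
    simp only [add_mul]
    omega
  · rw [pts]
    exact lab.isUDR hf

/-- Places the second of two adjacent vertices at distance one from the first one. -/
def pairProg : Prog := .setRCell 0 (.const 1) (.ofNat (.const 1))

theorem isUDR_pairProg {G : SimpleGraph (Fin 2)} (hG : G.Connected) (es : List (Fin 2 × Fin 2)) :
    IsUDR G ((pairProg.exec (initial 2 es)).points 2) := by
  have h01 : G.Adj 0 1 := by
    obtain ⟨u, hu⟩ := hG.preconnected.exists_adj_of_nontrivial 0
    have : u = 1 := by
      have := hu.ne
      omega
    exact this ▸ hu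
  have e0 : (pairProg.exec (initial 2 es)).points 2 0 = !₂[0, 0] := by
    simp [State.points, pairProg, Prog.exec, initial, NExp.eval, RExp.eval]
  have e1 : (pairProg.exec (initial 2 es)).points 2 1 = !₂[1, 0] := by
    simp [State.points, pairProg, Prog.exec, initial, NExp.eval, RExp.eval]
  have hd : dist (!₂[0, 0] : Plane) !₂[1, 0] = 1 := by
    rw [EuclideanSpace.dist_eq]; simp
  have hd' : dist (!₂[1, 0] : Plane) !₂[0, 0] = 1 := by rw [dist_comm, hd]
  have hne : unitDisk (!₂[0, 0] : Plane) ≠ unitDisk !₂[1, 0] := fun h => by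
    rw [unitDisk_injective h, dist_self] at hd
    exact zero_ne_one hd
  refine ⟨fun u v huv => ?_, fun u v huv => ?_⟩
  · fin_cases u <;> fin_cases v <;> simp_all
  · rw [unitDisk_inter_nonempty_iff]
    fin_cases u <;> fin_cases v
    · exact absurd rfl huv
    · simp [e0, e1, hd, h01]
    · simp [e0, e1, hd', h01.symm]
    · exact absurd rfl huv

/-- Computes the centres of the disks of a representation. -/
def centresProg : Prog := .ite (.neq (.reg 0) (.const 2)) pairProg layoutProg

theorem centresProg_spec : ∃ C, ∀ {n : ℕ} {G : SimpleGraph (Fin n)} [DecidableRel G.Adj]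
    {es : List (Fin n × Fin n)}, IsCaterpillar G → IsEdgeList G es → DegreeCondition G →
    ∃ t τ, Runs centresProg (initial n es) t τ ∧ t ≤ C * n ∧ IsUDR G (τ.points n) := by
  obtain ⟨C, h⟩ := layoutProg_spec
  refine ⟨pairProg.bound + C + 4, fun {n G _ es} hG hes hdeg => ?_⟩
  by_cases hn : n = 2
  · subst hn
    obtain ⟨t, ht, hr⟩ := Prog.LoopFree.runs (p := pairProg) trivial (initial 2 es)
    refine ⟨_, _, Runs.ite_true ?_ hr, ?_, isUDR_pairProg hG.isTree.connected es⟩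
    · simp [Cond.holds, NExp.eval, initial]
    · simp only [Cond.cost, NExp.cost]; omega
  · obtain ⟨t, τ, hr, ht, hu⟩ := h hG hes hdeg hn
    have hpos : 0 < n := by
      obtain ⟨x⟩ := hG.isTree.connected.nonempty
      exact x.pos
    refine ⟨_, τ, Runs.ite_false ?_ hr, ?_, hu⟩
    · simpa [Cond.holds, NExp.eval, initial] using hn
    · simp only [Cond.cost, NExp.cost]
      nlinarith
end RealRAM

/-! ### Testing the condition, and the theorem -/

namespace RealRAM

/-- Sets register `3` to zero if the degree of the current vertex exceeds five. -/
def vertexTestBody : Prog :=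
  .ite (.nlt (.const 5) (.cell 2 (.reg 2))) (.setNReg 3 (.const 0)) .skip

/-- Sets register `3` to zero if both ends of the current edge have degree five. -/
def edgeTestBody : Prog :=
  .ite (.and (.neq (.cell 2 .fstEnd) (.const 5)) (.neq (.cell 2 .sndEnd) (.const 5)))
    (.setNReg 3 (.const 0)) .skip

/-- Tests the condition on the degrees. -/
def testProg : Prog :=
  .seq degreeLoop (.seq (.setNReg 3 (.const 1)) (.seq (.forTo 2 (.reg 0) vertexTestBody)
    (.seq (.forTo 2 (.reg 1) edgeTestBody) (.setNReg 0 (.reg 3)))))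

theorem vertexTest_spec : ∃ C, ∀ {n : ℕ} {σ : State} {d : Fin n → ℕ}, σ.nreg 0 = n →
    (∀ v : Fin n, σ.narr 2 v = d v) →
    ∃ t τ, Runs (.forTo 2 (.reg 0) vertexTestBody) σ t τ ∧ t ≤ C * (n + 1) ∧
      ((∀ v, d v ≤ 5) → τ.nreg 3 = σ.nreg 3) ∧ (¬ (∀ v, d v ≤ 5) → τ.nreg 3 = 0) := by
  refine ⟨Prog.loopFactor (.reg 0) vertexTestBody, fun {n σ d} h0 hd => ?_⟩
  obtain ⟨t, τ, r1, r2, r3, r4⟩ := runs_forTo (r := 2) (b := .reg 0) (p := vertexTestBody)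
    ⟨trivial, trivial⟩ (by decide)
    (fun i τ => ((∀ v : Fin n, (v : ℕ) < i → d v ≤ 5) → τ.nreg 3 = σ.nreg 3) ∧
      ((∃ v : Fin n, (v : ℕ) < i ∧ 5 < d v) → τ.nreg 3 = 0)) n σ
    (fun τ hu => by rw [NExp.eval, hu.nreg 0 (by decide), h0])
    ⟨fun _ => by simp, by simp⟩
    (fun i hi τ hu hri hI => by
      have d1 : τ.narr 2 i = d ⟨i, hi⟩ := by rw [hu.narr 2 (by decide), ← hd]
      have x3 : (vertexTestBody.exec τ).nreg 3 = if 5 < d ⟨i, hi⟩ then 0 else τ.nreg 3 := by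
        simp [vertexTestBody, Prog.exec, Cond.holds, NExp.eval, hri, d1, apply_ite State.nreg,
          ite_apply]
      simp only [ne_eq, Nat.reduceEqDiff, not_false_eq_true, Function.update_of_ne, x3]
      refine ⟨fun h => ?_, fun ⟨v, h1, h2⟩ => ?_⟩
      · rw [if_neg (by have := h ⟨i, hi⟩ (Nat.lt_succ_self i); omega)]
        exact hI.1 fun v hv => h v (by omega)
      · split_ifs with h5
        · rfl
        · refine hI.2 ⟨v, lt_of_le_of_ne (Nat.lt_succ_iff.1 h1) fun h => h5 ?_, h2⟩
          rwa [show v = ⟨i, hi⟩ from Fin.ext h] at h2)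
  refine ⟨t, τ, r1, r2, fun h => r3 fun v _ => h v, fun h => r4 ?_⟩
  push Not at h
  obtain ⟨v, hv⟩ := h
  exact ⟨v, v.isLt, hv⟩

theorem edgeTest_spec : ∃ C, ∀ {n : ℕ} {es : List (Fin n × Fin n)} {σ : State} {d : Fin n → ℕ},
    HoldsInput n es σ → (∀ v : Fin n, σ.narr 2 v = d v) →
    ∃ t τ, Runs (.forTo 2 (.reg 1) edgeTestBody) σ t τ ∧ t ≤ C * (es.length + 1) ∧
      ((∀ e ∈ es, ¬ (d e.1 = 5 ∧ d e.2 = 5)) → τ.nreg 3 = σ.nreg 3) ∧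
      ((∃ e ∈ es, d e.1 = 5 ∧ d e.2 = 5) ∨ σ.nreg 3 = 0 → τ.nreg 3 = 0) := by
  refine ⟨Prog.loopFactor (.reg 1) edgeTestBody, fun {n es σ d} h hd => ?_⟩
  obtain ⟨t, τ, r1, r2, r3, r4⟩ := runs_forTo (r := 2) (b := .reg 1) (p := edgeTestBody)
    ⟨trivial, trivial⟩ (by decide)
    (fun i τ => ((∀ e ∈ es.take i, ¬ (d e.1 = 5 ∧ d e.2 = 5)) → τ.nreg 3 = σ.nreg 3) ∧
      ((∃ e ∈ es.take i, d e.1 = 5 ∧ d e.2 = 5) ∨ σ.nreg 3 = 0 → τ.nreg 3 = 0)) es.length σ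
    (fun τ hu => (h.of_unchanged hu (by decide)).length)
    ⟨fun _ => by simp, by simp⟩
    (fun i hi τ hu hri hI => by
      have hin := h.of_unchanged hu (by decide)
      have e1 := hin.fst i hi
      have e2 := hin.snd i hi
      have d1 : ∀ v : Fin n, τ.narr 2 v = d v := fun v => by rw [hu.narr 2 (by decide), hd]
      have x3 : (edgeTestBody.exec τ).nreg 3
          = if d es[i].1 = 5 ∧ d es[i].2 = 5 then 0 else τ.nreg 3 := by
        simp [edgeTestBody, Prog.exec, Cond.holds, NExp.eval, NExp.fstEnd, NExp.sndEnd, hri, e1, e2,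
          d1, apply_ite State.nreg, ite_apply]
      simp only [ne_eq, Nat.reduceEqDiff, not_false_eq_true, Function.update_of_ne, x3,
        take_succ_eq hi, List.mem_append, List.mem_singleton]
      refine ⟨fun h => ?_, fun h => ?_⟩
      · rw [if_neg (h _ (Or.inr rfl))]
        exact hI.1 fun e he => h e (Or.inl he)
      · split_ifs with h5
        · rfl
        · refine hI.2 ?_
          rcases h with ⟨e, he | rfl, h⟩ | h
          · exact Or.inl ⟨e, he, h⟩
          · exact absurd h h5
          · exact Or.inr h)
  rw [List.take_length] at r3 r4
  exact ⟨t, τ, r1, r2, r3, r4⟩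

theorem testProg_spec : ∃ C, ∀ {n : ℕ} {G : SimpleGraph (Fin n)} [DecidableRel G.Adj]
    {es : List (Fin n × Fin n)}, G.IsTree → IsEdgeList G es →
    ∃ t τ, Runs testProg (initial n es) t τ ∧ t ≤ C * n ∧
      (DegreeCondition G → τ.nreg 0 = 1) ∧ (¬ DegreeCondition G → τ.nreg 0 = 0) := by
  obtain ⟨C1, s1⟩ := degreeLoop_spec
  obtain ⟨C2, s2⟩ := vertexTest_spec
  obtain ⟨C3, s3⟩ := edgeTest_spec
  refine ⟨C1 + 2 * C2 + C3 + 4, fun {n G _ es} hG hes => ?_⟩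
  have hm := hes.length_lt hG
  have i0 := holdsInput_initial n es
  obtain ⟨t1, σ1, r1, b1, d1⟩ := s1 i0 fun v => rfl
  have i1 := i0.of_unchanged r1.unchanged (by decide)
  have d1 : ∀ v : Fin n, σ1.narr 2 v = G.degree v := fun v => by
    rw [d1, hes.incidenceSum_eq]
    simp
  have r' := Runs.setNReg σ1 3 (.const 1)
  have i' := i1.of_unchanged r'.unchanged (by decide)
  obtain ⟨t2, σ2, r2, b2, v1, v2⟩ := s2 (d := fun v => G.degree v) i'.size d1
  have i2 := i'.of_unchanged r2.unchanged (by decide)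
  have d2 : ∀ v : Fin n, σ2.narr 2 v = G.degree v := fun v => by
    rw [r2.unchanged.narr 2 (by decide), ← d1]
  obtain ⟨t3, σ3, r3, b3, w1, w2⟩ := s3 i2 d2
  simp only [NExp.eval, Function.update_self] at v1
  refine ⟨_, _, r1.seq (r'.seq (r2.seq (r3.seq (Runs.setNReg σ3 0 (.reg 3))))), ?_, ?_, ?_⟩
  · simp only [NExp.cost, add_mul]
    have c1 := b1.trans (Nat.mul_le_mul_left C1 (by omega : es.length + 1 ≤ n))
    have c2 := b2.trans (Nat.mul_le_mul_left C2 (by omega : n + 1 ≤ 2 * n))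
    have c3 := b3.trans (Nat.mul_le_mul_left C3 (by omega : es.length + 1 ≤ n))
    rw [← mul_assoc, mul_comm C2] at c2
    omega
  · rintro ⟨h1, h2⟩
    simp only [NExp.eval, Function.update_self]
    rw [w1 fun e he h => ?_, v1 h1]
    refine h2 e.1 ?_ e.2 ?_ (hes.adj he) h
    · simp [backbone, h.1]
    · simp [backbone, h.2]
  · intro h
    simp only [NExp.eval, Function.update_self]
    refine w2 ?_
    by_cases h5 : ∀ v, G.degree v ≤ 5
    · left
      by_contra hno
      push Not at hno
      refine h ⟨h5, fun u _ v _ huv ⟨hu, hv⟩ => ?_⟩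
      rcases hes.exists_mem huv with he | he
      · exact hno _ he hu hv
      · exact hno _ he hv hu
    · exact Or.inr (v2 h5)

end RealRAM

theorem exists_isEdgeList {n : ℕ} (G : SimpleGraph (Fin n)) : ∃ es, IsEdgeList G es := by
  classical
  have h : (G.edgeFinset.toList.map Quot.out).map (fun e => s(e.1, e.2)) = G.edgeFinset.toList := by
    rw [List.map_map]
    refine (List.map_congr_left fun e _ => ?_).trans (List.map_id _)
    exact Quot.out_eq e
  refine ⟨G.edgeFinset.toList.map Quot.out, ?_, fun e => ?_⟩
  · rw [h]
    exact Finset.nodup_toList _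
  · rw [h, Finset.mem_toList, SimpleGraph.mem_edgeFinset]

theorem AdmitsUDR.of_iso {V W : Type*} {G : SimpleGraph V} {H : SimpleGraph W}
    (h : AdmitsUDR H) (φ : G ≃g H) : AdmitsUDR G := by
  obtain ⟨c, hc⟩ := h
  refine ⟨fun v => c (φ v), fun u v huv => φ.injective (hc.injective huv), fun u v huv => ?_⟩
  rw [← hc.adj_iff _ _ (φ.injective.ne huv), φ.map_adj_iff]

section

variable {V W : Type*} [Fintype V] [Fintype W] {G : SimpleGraph V} {H : SimpleGraph W}
  [DecidableRel G.Adj] [DecidableRel H.Adj]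

theorem IsCaterpillar.of_iso (h : IsCaterpillar G) (φ : G ≃g H) : IsCaterpillar H := by
  obtain ⟨k, ⟨ψ⟩⟩ := h.backbone_path
  have hd : ∀ v, v ∈ backbone G ↔ φ v ∈ backbone H := fun v => by
    simp [backbone, φ.degree_eq]
  exact ⟨φ.isTree_iff.1 h.isTree, k,
    ⟨(RelIso.symm ⟨φ.toEquiv.subtypeEquiv hd, φ.map_adj_iff⟩).trans ψ⟩⟩

theorem DegreeCondition.of_iso (h : DegreeCondition G) (φ : G ≃g H) : DegreeCondition H := by
  have hd : ∀ v, H.degree v = G.degree (φ.symm v) := fun v => (φ.symm.degree_eq v).symm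
  refine ⟨fun v => by rw [hd]; exact h.1 _, fun u hu v hv huv => ?_⟩
  rw [hd, hd]
  refine h.2 _ ?_ _ ?_ (φ.symm.map_adj_iff.2 huv)
  · rwa [backbone, Set.mem_ofPred, ← hd]
  · rwa [backbone, Set.mem_ofPred, ← hd]

theorem DegreeCondition.admitsUDR (h : DegreeCondition G) (hG : IsCaterpillar G) :
    AdmitsUDR G := by
  classical
  obtain ⟨es, hes⟩ := exists_isEdgeList (G.overFin rfl)
  obtain ⟨C, hC⟩ := RealRAM.centresProg_spec
  obtain ⟨t, τ, -, -, hτ⟩ := hC (hG.of_iso (G.overFinIso rfl)) hes (h.of_iso (G.overFinIso rfl))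
  exact AdmitsUDR.of_iso ⟨_, hτ⟩ (G.overFinIso rfl)

end

theorem theorem4 :
    -- the characterization
    (∀ (V : Type*) [Fintype V] (G : SimpleGraph V) [DecidableRel G.Adj], IsCaterpillar G →
      (AdmitsUDR G ↔ DegreeCondition G)) ∧
    -- the condition can be tested in linear time
    (∃ (P : RealRAM.Prog) (C : ℕ),
      ∀ (n : ℕ) (G : SimpleGraph (Fin n)) [DecidableRel G.Adj] (es : List (Fin n × Fin n)),
        IsCaterpillar G → IsEdgeList G es →
        ∃ (t : ℕ) (τ : RealRAM.State),
          RealRAM.Runs P (RealRAM.initial n es) t τ ∧ t ≤ C * n ∧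
          (DegreeCondition G → τ.nreg 0 = 1) ∧ (¬ DegreeCondition G → τ.nreg 0 = 0)) ∧
    -- if a representation exists, then one can be constructed in linear time
    (∃ (Q : RealRAM.Prog) (C : ℕ),
      ∀ (n : ℕ) (G : SimpleGraph (Fin n)) [DecidableRel G.Adj] (es : List (Fin n × Fin n)),
        IsCaterpillar G → IsEdgeList G es → AdmitsUDR G →
        ∃ (t : ℕ) (τ : RealRAM.State),
          RealRAM.Runs Q (RealRAM.initial n es) t τ ∧ t ≤ C * n ∧
          IsUDR G (τ.points n)) := by
  obtain ⟨C, hC⟩ := RealRAM.testProg_spec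
  obtain ⟨C', hC'⟩ := RealRAM.centresProg_spec
  exact ⟨fun V _ G _ hG =>
      ⟨fun h => h.degreeCondition hG.isTree.isAcyclic, fun h => h.admitsUDR hG⟩,
    ⟨RealRAM.testProg, C, fun n G _ es hG hes => hC hG.isTree hes⟩,
    ⟨RealRAM.centresProg, C', fun n G _ es hG hes h =>
      hC' hG hes (h.degreeCondition hG.isTree.isAcyclic)⟩⟩
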